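/- Let $G$ be a finite group with center $Z(G)$; write $[x,y]=x^{-1}y^{-1}xy$. Then $G$ has an automorphism $\alpha$ such that $\alpha(g)=g^3$ for more than half of the elements $g\in G$ if and only if $G$ is of (at least) one of the following types. (I) $G$ is abelian and $\gcd(|G|,3)=1$. (II) $G$ is non-abelian and has a normal Sylow $3$-subgroup $S$ (possibly trivial) such that (a) $S\subseteq K$ for some abelian subgroup $K$ of $G$ of index $2$, and (b) $S\cap Z(G)=\{1\}$. (III) $G$ is nilpotent of class exactly $2$, $\gcd(|G|,3)=1$, all Sylow $p$-subgroups of $G$ with $p>2$ are abelian, and the Sylow $2$-subgroup $P$ of $G$, with center $Z=Z(P)$ and commutator subgroup $P'$, has one of the following two structures: (i) $P'=\langle z\rangle$ has order $2$, and $P/Z$ is an elementary abelian $2$-group generated by $Zx_1,\dots,Zx_k,Za_1,\dots,Za_k$ for some $k$ and some $x_i,a_i\in P$ such that $[x_i,x_j]=[a_i,a_j]=[a_i,x_j]=1$ whenever $i\ne j$, and $[a_i,x_i]=z$ for all $i$; (ii) $P'=\langle z_1\rangle\times\langle z_2\rangle$ with $z_1,z_2$ of order $2$, and $P/Z$ is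 elementary abelian of order $16$, generated by $Zx_1,Zx_2,Za_1,Za_2$ for some $x_i,a_i\in P$ such that $[x_i,x_j]=[a_i,a_j]=[a_i,x_j]=1$ whenever $i\neq j$, and $[a_i,x_i]=z_i$ for $i=1,2$. In particular, if $G$ is non-abelian, $\gcd(|G|,3)=1$, and $G$ has an abelian subgroup of index $2$, then $G$ is of type (II). -/

import Mathlib

namespace CubingAutomorphism

/-- The set of elements of `G` that the automorphism `α` sends to their cubes. -/
def cubeSet {G : Type*} [Group G] (α : G ≃* G) : Set G :=
  {g | α g = g ^ 3}

/-- The proportion of elements of the (finite) group `G` that `α` sends to their cubes. -/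
noncomputable def cubeRatio {G : Type*} [Group G] (α : G ≃* G) : ℚ :=
  (Nat.card (cubeSet α) : ℚ) / (Nat.card G : ℚ)

/-- The commutator `[x, y] = x⁻¹ y⁻¹ x y`. -/
def commElt {P : Type*} [Group P] (x y : P) : P :=
  x⁻¹ * y⁻¹ * x * y

/-- A group is an elementary abelian 2-group: it is commutative and `q ^ 2 = 1` throughout. -/
def IsElementaryAbelianTwo (Q : Type*) [Group Q] : Prop :=
  (∀ q r : Q, q * r = r * q) ∧ ∀ q : Q, q ^ 2 = 1

/-- The images of the `x i` and the `a i` generate `P` modulo its center. -/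
def GenerateModCenter {P : Type*} [Group P] {k : ℕ} (x a : Fin k → P) : Prop :=
  Subgroup.closure
    (Set.range (fun i => (x i : P ⧸ Subgroup.center P)) ∪
      Set.range (fun i => (a i : P ⧸ Subgroup.center P))) = ⊤

/-- The relations `[x i, x j] = [a i, a j] = [a i, x j] = 1` for `i ≠ j`
and `[a i, x i] = z i`. -/
def CommutatorRelations {P : Type*} [Group P] {k : ℕ} (x a z : Fin k → P) : Prop :=
  (∀ i j, i ≠ j → commElt (x i) (x j) = 1 ∧ commElt (a i) (a j) = 1 ∧ commElt (a i) (x j) = 1) ∧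
    ∀ i, commElt (a i) (x i) = z i

/-- First commutator structure: `P' = ⟨z⟩` has order two, `P / Z(P)` is elementary abelian,
generated by `Z x₁, …, Z x_k, Z a₁, …, Z a_k`, with `[a i, x i] = z` for all `i`. -/
def StructureOne (P : Type*) [Group P] : Prop :=
  ∃ z : P, orderOf z = 2 ∧ commutator P = Subgroup.zpowers z ∧
    IsElementaryAbelianTwo (P ⧸ Subgroup.center P) ∧
    ∃ (k : ℕ) (x a : Fin k → P), GenerateModCenter x a ∧
      CommutatorRelations x a (fun _ => z)

/-- Second commutator structure: `P' = ⟨z₁⟩ × ⟨z₂⟩` (internal direct product of two groups of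
order two), `P / Z(P)` is elementary abelian of order 16, generated by
`Z x₁, Z x₂, Z a₁, Z a₂`, with `[a i, x i] = z i`. -/
def StructureTwo (P : Type*) [Group P] : Prop :=
  ∃ z : Fin 2 → P, (∀ i, orderOf (z i) = 2) ∧ Commute (z 0) (z 1) ∧
    Subgroup.zpowers (z 0) ⊓ Subgroup.zpowers (z 1) = ⊥ ∧
    commutator P = Subgroup.zpowers (z 0) ⊔ Subgroup.zpowers (z 1) ∧
    IsElementaryAbelianTwo (P ⧸ Subgroup.center P) ∧
    Nat.card (P ⧸ Subgroup.center P) = 16 ∧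
    ∃ x a : Fin 2 → P, GenerateModCenter x a ∧ CommutatorRelations x a z

/-- Type I: abelian of order prime to 3. -/
def TypeI (G : Type*) [Group G] : Prop :=
  (∀ g h : G, g * h = h * g) ∧ (Nat.card G).Coprime 3

/-- Type II: non-abelian, with a normal Sylow 3-subgroup that lies in an abelian subgroup of
index 2 and meets the center trivially. -/
def TypeII (G : Type*) [Group G] : Prop :=
  (¬ ∀ g h : G, g * h = h * g) ∧
    ∃ S : Sylow 3 G, (S : Subgroup G).Normal ∧
      (∃ K : Subgroup G, (S : Subgroup G) ≤ K ∧ K.index = 2 ∧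
        ∀ g ∈ K, ∀ h ∈ K, g * h = h * g) ∧
      (S : Subgroup G) ⊓ Subgroup.center G = ⊥

/-- Type III: nilpotent of class (exactly) two, of order prime to 3, all Sylow `p`-subgroups
for `p > 2` abelian, and the Sylow 2-subgroup of one of the two structures above. -/
def TypeIII (G : Type*) [Group G] : Prop :=
  Group.IsNilpotent G ∧ Group.nilpotencyClass G = 2 ∧ (Nat.card G).Coprime 3 ∧
    (∀ p : ℕ, p.Prime → 2 < p → ∀ P : Sylow p G, ∀ g ∈ P, ∀ h ∈ P, g * h = h * g) ∧
    ∃ S : Sylow 2 G, StructureOne S ∨ StructureTwo S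

end CubingAutomorphism

/-! Let T be the set of elements that α cubes and suppose |T| > |G|/2. Elements of T have order
prime to 3, and for x, y ∈ T the condition xy ∈ T reads yxyx = x²y². Relations of this kind among
the translates xⁱgxʲ show that T covers at most a quarter of the complement of C(x²), for x ∈ T
(`four_mul_ncard_diff_centralizer_sq_le`). So a single non-central square x² makes C(x²) a subgroup
of index 2 of which T fills more than three quarters, and such a subgroup is abelian
(`abelian_index_two_or_sq_central`).

If all squares of elements of T are central, then g ↦ g⁻¹α(g) is a homomorphism φ into the center Z,
and T = {g : g² = φ(g)}. Now a product of two elements of T lies in T exactly when they commute. A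
subgroup H maximal inside T is therefore abelian, and {h ∈ H : hg ∈ T} has at most |C_H(g)|
elements. Summing over g, the average of |C(a)| over a ∈ H exceeds |G|/2; nearly every later step
plays this average against lower bounds for centralizer indices.

If commuting non-central elements of T always multiply into Z, the non-central part of T is the
complement of an abelian subgroup of index 2. Otherwise some H has |H| ≥ 4|Z|; the average forces H
into the second center, and then G has class at most 2 or an abelian subgroup of index 2
(`secondCenter_eq_top_or_abelian_index_two`). In class 2 the maps [a,·] are homomorphisms with
values of order at most 2. If all C(a), a ∈ H, have index at most 2, then |G'| = 2 or there is an
abelian subgroup of index 2; structure (i) is a symplectic basis for the commutator form. If some b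
∈ H has larger index, the average leaves room only for the coset bZ, H/Z has order 4, and structure
(ii) appears (`structureTwo_of_large_index`). All squares being central, the odd part of G is
central and the structure passes to the Sylow 2-subgroup.

Conversely, cubing itself serves for type I. With an abelian K of index 2 and x ∉ K, cubing off K
extends by k ↦ k²·xkx⁻¹ on K. For type III, G = AX with A, X abelian, and ax ↦ (ax)³[a,x] is an
automorphism that cubes ax exactly when a and x commute, so counting commuting pairs finishes
(`exists_cubing_of_factorization`). -/

namespace CubingAutomorphism

open scoped commutatorElement

/-! ### Relations between elements that are cubed -/

section CubeSet
variable {G : Type*} [Group G] {α : G ≃* G} {x y : G}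

theorem mem_cubeSet : x ∈ cubeSet α ↔ α x = x ^ 3 := Iff.rfl

theorem zpow_mem_cubeSet (hx : x ∈ cubeSet α) (n : ℤ) : x ^ n ∈ cubeSet α := by
  rw [mem_cubeSet] at *
  rw [map_zpow, hx, ← zpow_natCast, ← zpow_natCast, ← zpow_mul, ← zpow_mul, mul_comm]

theorem pow_mem_cubeSet (hx : x ∈ cubeSet α) (n : ℕ) : x ^ n ∈ cubeSet α := by
  simpa using zpow_mem_cubeSet hx n

theorem inv_mem_cubeSet (hx : x ∈ cubeSet α) : x⁻¹ ∈ cubeSet α := by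
  simpa using zpow_mem_cubeSet hx (-1)

theorem mul_mem_cubeSet_of_commute (hx : x ∈ cubeSet α) (hy : y ∈ cubeSet α)
    (h : Commute x y) : x * y ∈ cubeSet α := by
  rw [mem_cubeSet] at *
  rw [map_mul, hx, hy, h.mul_pow]

theorem mul_mem_cubeSet_iff (hx : x ∈ cubeSet α) (hy : y ∈ cubeSet α) :
    x * y ∈ cubeSet α ↔ y * x * y * x = x ^ 2 * y ^ 2 := by
  rw [mem_cubeSet] at *
  rw [map_mul, hx, hy]
  have e1 : x ^ 3 * y ^ 3 = x * (x ^ 2 * y ^ 2) * y := by group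
  have e2 : (x * y) ^ 3 = x * (y * x * y * x) * y := by simp only [pow_succ, pow_zero]; group
  rw [e1, e2, mul_left_inj, mul_right_inj, eq_comm]

theorem commute_of_commute_sq (hx : x ∈ cubeSet α) (hy : y ∈ cubeSet α)
    (hxy : x * y ∈ cubeSet α) (hc : Commute (x ^ 2) (y ^ 2)) : Commute x y := by
  have h4 := (mul_mem_cubeSet_iff hx hy).1 hxy
  rw [hc.eq] at h4
  have e1 : y * x * y * x = y * (x * y) * x := by group
  have e2 : y ^ 2 * x ^ 2 = y * (y * x) * x := by simp only [pow_succ, pow_zero]; group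
  rw [e1, e2, mul_left_inj, mul_right_inj] at h4
  exact h4

theorem mem_zpowers_pow_of_coprime {n : ℕ} (h : (orderOf x).Coprime n) :
    x ∈ Subgroup.zpowers (x ^ n) := by
  obtain ⟨m, hm⟩ := exists_pow_eq_self_of_coprime h.symm
  exact ⟨m, by simpa using hm⟩

theorem commute_of_pow_of_coprime {n : ℕ} (h : (orderOf x).Coprime n)
    (hc : Commute (x ^ n) y) : Commute x y := by
  obtain ⟨m, hm⟩ := mem_zpowers_pow_of_coprime h
  have := hc.zpow_left m
  simp only at hm
  rwa [hm] at this

variable [Finite G]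

/-- An automorphism preserves orders, so x and x³ have the same order. -/
theorem orderOf_coprime_three (hx : x ∈ cubeSet α) : (orderOf x).Coprime 3 := by
  have h1 : orderOf (x ^ 3) = orderOf x := by
    rw [← mem_cubeSet.1 hx]; exact MulEquiv.orderOf_eq α x
  rw [orderOf_pow' x (by norm_num : (3 : ℕ) ≠ 0)] at h1
  have hpos := orderOf_pos x
  rcases Nat.div_eq_self.1 h1 with h | h
  · omega
  · exact h

theorem commute_of_cube_left (hx : x ∈ cubeSet α) (hc : Commute (x ^ 3) y) : Commute x y :=
  commute_of_pow_of_coprime (orderOf_coprime_three hx) hc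

theorem conj_mem_cubeSet_iff (hx : x ∈ cubeSet α) (hy : y ∈ cubeSet α) :
    y * x * y⁻¹ ∈ cubeSet α ↔ Commute (y ^ 2) x := by
  have key : y * x * y⁻¹ ∈ cubeSet α ↔ Commute (x ^ 3) (y ^ 2) := by
    rw [mem_cubeSet, map_mul, map_mul, map_inv, mem_cubeSet.1 hx, mem_cubeSet.1 hy, conj_pow]
    rw [Commute, SemiconjBy]
    have e1 : y ^ 3 * x ^ 3 * (y ^ 3)⁻¹ = y * (y ^ 2 * x ^ 3) * (y ^ 3)⁻¹ := by
      rw [pow_succ' y 2]; group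
    have e2 : y * x ^ 3 * y⁻¹ = y * (x ^ 3 * y ^ 2) * (y ^ 3)⁻¹ := by
      rw [pow_succ y 2]; group
    rw [e1, e2, mul_left_inj, mul_right_inj, eq_comm]
  rw [key]
  refine ⟨fun h => (commute_of_cube_left hx h).symm, fun h => (h.pow_right 3).symm⟩

/-- Put u = yxy⁻¹x⁻¹, which commutes with x. Membership of xy gives yuy⁻¹ = u⁻², hence y³xy⁻³ = u³x
and α(u) = u⁹. Evaluating α(yuy⁻¹) in two ways gives u⁵⁴ = 1, while the order of u is prime to 2 and
to 3 because u² and u⁹ have the same order as u. -/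
theorem commute_of_commute_conj (hx : x ∈ cubeSet α) (hy : y ∈ cubeSet α)
    (hxy : x * y ∈ cubeSet α) (hc : Commute x (y * x * y⁻¹)) : Commute x y := by
  have h4 := (mul_mem_cubeSet_iff hx hy).1 hxy
  set x' := y * x * y⁻¹ with hx'
  set u := x' * x⁻¹ with hu
  have hux : Commute u x := by
    refine Commute.mul_left hc.symm ?_
    exact (Commute.refl x).inv_left
  have hx1 : x' = u * x := by simp [hu]
  have h5 : x ^ 2 = x' * (y * x' * y⁻¹) := by
    rw [eq_mul_inv_of_mul_eq h4.symm, hx']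
    simp only [pow_succ, pow_zero]; group
  have h6 : y * x' * y⁻¹ = u⁻¹ * x := by
    have : y * x' * y⁻¹ = x'⁻¹ * x ^ 2 := by rw [h5]; group
    rw [this, hx1, mul_inv_rev, hux.inv_inv.eq.symm]; simp only [pow_succ, pow_zero]; group
  have hyu : y * u * y⁻¹ = u ^ (-2 : ℤ) := by
    have : y * u * y⁻¹ = (y * x' * y⁻¹) * x'⁻¹ := by rw [hu, hx']; group
    rw [this, h6, hx1]; group
  have hyun : ∀ n : ℤ, y * u ^ n * y⁻¹ = u ^ (-2 * n : ℤ) := fun n => by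
    rw [← conj_zpow, hyu, zpow_mul]
  have hyx : y * x * y⁻¹ = u * x := by rw [← hx1]
  have hyux : ∀ n : ℤ, y * (u ^ n * x) * y⁻¹ = u ^ (-2 * n + 1 : ℤ) * x := fun n => by
    have : y * (u ^ n * x) * y⁻¹ = (y * u ^ n * y⁻¹) * (y * x * y⁻¹) := by group
    rw [this, hyun, hyx, zpow_add, zpow_one, mul_assoc (u ^ (-2 * n)) u x]
  have h7 : y ^ 3 * x * (y ^ 3)⁻¹ = u ^ (3 : ℤ) * x := by
    have : y ^ 3 * x * (y ^ 3)⁻¹ = y * (y * (y * (u ^ (0 : ℤ) * x) * y⁻¹) * y⁻¹) * y⁻¹ := by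
      simp [pow_succ, mul_assoc]
    rw [this, hyux, hyux, hyux]; norm_num
  have h8 : α u = u ^ (9 : ℤ) := by
    have : α u = (y ^ 3 * x * (y ^ 3)⁻¹) ^ 3 * (x ^ 3)⁻¹ := by
      rw [hu, hx', map_mul, map_mul, map_mul, map_inv, map_inv, mem_cubeSet.1 hx,
        mem_cubeSet.1 hy, conj_pow]
    rw [this, h7, (hux.zpow_left 3).mul_pow, mul_assoc, mul_inv_cancel, mul_one]
    group
  -- Here −72 = 9·(−2)³, since α(y) = y³ conjugates three times. The other evaluation is α(u⁻²) =
  -- u⁻¹⁸.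
  have h9 : α (y * u * y⁻¹) = u ^ (-72 : ℤ) := by
    have : α (y * u * y⁻¹) = y * (y * (y * u ^ (9 : ℤ) * y⁻¹) * y⁻¹) * y⁻¹ := by
      rw [map_mul, map_mul, map_inv, mem_cubeSet.1 hy, h8]; simp [pow_succ, mul_assoc]
    rw [this, hyun, hyun, hyun]; norm_num
  rw [hyu, map_zpow, h8] at h9
  have h10 : u ^ 54 = 1 := by
    have : u ^ (54 : ℤ) = u ^ (-18 : ℤ) * (u ^ (-72 : ℤ))⁻¹ := by group
    rw [← h9] at this
    have h := this
    rw [← zpow_mul] at h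
    norm_num at h
    exact_mod_cast h
  have h11 : (orderOf u).Coprime 9 := by
    have h1 : orderOf (u ^ 9) = orderOf u := by
      rw [← MulEquiv.orderOf_eq α u, h8]; norm_cast
    rw [orderOf_pow' u (by norm_num : (9 : ℕ) ≠ 0)] at h1
    have hpos := orderOf_pos u
    rcases Nat.div_eq_self.1 h1 with h | h
    · omega
    · exact h
  have h12 : (orderOf u).Coprime 2 := by
    have h1 : orderOf (u ^ 2) = orderOf u := by
      have e : u ^ 2 = (y * u * y⁻¹)⁻¹ := by rw [hyu]; group
      rw [e, orderOf_inv]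
      exact MulEquiv.orderOf_eq (MulAut.conj y) u
    rw [orderOf_pow' u (by norm_num : (2 : ℕ) ≠ 0)] at h1
    have hpos := orderOf_pos u
    rcases Nat.div_eq_self.1 h1 with h | h
    · omega
    · exact h
  have h13 : u = 1 := by
    have hd := orderOf_dvd_of_pow_eq_one h10
    have h3 : (orderOf u).Coprime 3 := Nat.Coprime.of_dvd_right (by norm_num : 3 ∣ 9) h11
    have : (orderOf u).Coprime 54 := by
      rw [show 54 = 2 * (3 * 9) by norm_num]
      exact h12.mul_right (h3.mul_right h11)
    rw [← orderOf_eq_one_iff]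
    exact Nat.Coprime.eq_one_of_dvd this hd
  rw [h13, one_mul] at hyx
  rw [Commute, SemiconjBy]
  nth_rewrite 1 [← hyx]; group

/-- With vᵢ = xⁱvx⁻ⁱ, the two memberships say v₁v₂ = v² and v₂v₁ = v². So v₁ and v₂ commute;
conjugating back, v commutes with v₁ and `commute_of_commute_conj` applies. -/
theorem commute_of_mul_mem_of_inv_mul_mem {v : G} (hx : x ∈ cubeSet α) (hv : v ∈ cubeSet α)
    (h1 : v * x ∈ cubeSet α) (h2 : x⁻¹ * v ∈ cubeSet α) : Commute v x := by
  have e1 := (mul_mem_cubeSet_iff hv hx).1 h1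
  have e2 := (mul_mem_cubeSet_iff (inv_mem_cubeSet hx) hv).1 h2
  set v1 := x * v * x⁻¹ with hv1
  set v2 := x * v1 * x⁻¹ with hv2
  have f1 : v1 * v2 = v ^ 2 := by
    rw [eq_mul_inv_of_mul_eq e1.symm, hv2, hv1]
    simp only [pow_succ, pow_zero]; group
  have f2 : v2 * v1 = v ^ 2 := by
    have : v ^ 2 = x ^ 2 * (v * x⁻¹ * v * x⁻¹) := by rw [e2]; group
    rw [this, hv2, hv1]
    simp only [pow_succ, pow_zero]; group
  have hc : Commute v v1 := by
    have h : v1 * v2 = v2 * v1 := f1.trans f2.symm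
    have h' : v * v1 = x⁻¹ * (v1 * v2) * x := by rw [hv2, hv1]; group
    have h'' : v1 * v = x⁻¹ * (v2 * v1) * x := by rw [hv2, hv1]; group
    rw [Commute, SemiconjBy, h', h'', h]
  exact commute_of_commute_conj hv hx h1 hc

end CubeSet

-- Double counting of the pairs (i, g) with g ∈ U and fᵢ(g) ∈ T: each bijection fᵢ preserves U, so
-- it contributes |T ∩ U|.
open scoped Classical in
theorem card_mul_ncard_inter_le {G ι : Type*} [Finite G] [Fintype ι] (f : ι → G ≃ G)
    (T U : Set G) (r : ℕ) (hU : ∀ i g, f i g ∈ U ↔ g ∈ U)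
    (h : ∀ g ∈ U, ∑ i, (if f i g ∈ T then 1 else 0) ≤ r) :
    Fintype.card ι * (T ∩ U).ncard ≤ r * U.ncard := by
  have := Fintype.ofFinite G
  have h1 : ∀ i, ∑ g ∈ U.toFinset, (if f i g ∈ T then 1 else 0) = (T ∩ U).ncard := by
    intro i
    rw [Finset.sum_boole, Nat.cast_id, ← Set.ncard_coe_finset]
    rw [← Set.ncard_preimage_of_injective_subset_range (f i).injective (s := T ∩ U)
      (by rw [(f i).surjective.range_eq]; exact Set.subset_univ _)]
    congr 1
    ext g
    simp [hU, and_comm]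
  have h2 : ∑ g ∈ U.toFinset, ∑ i, (if f i g ∈ T then 1 else 0) ≤ U.toFinset.card * r :=
    Finset.sum_le_card_nsmul _ _ _ (fun g hg => h g (by simpa using hg))
  rw [Finset.sum_comm, Finset.sum_congr rfl (fun i _ => h1 i), Finset.sum_const,
    Finset.card_univ, smul_eq_mul, ← Set.ncard_eq_toFinset_card'] at h2
  rw [mul_comm r]
  exact h2

/-! ### Which translates of an element can be cubed together -/

section Pattern
variable {G : Type*} [Group G] [Finite G] {α : G ≃* G} {x y : G}

/-- Combinatorial core, with `M i j` standing for xⁱyxʲ ∈ T. The eight positions represent ℤ² modulo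
the lattice spanned by (4,0), (0,4), (2,2): the first four have i + j even, the last four odd. -/
theorem sum_ite_pattern_le_two {M : ℤ → ℤ → Prop} [∀ i j, Decidable (M i j)]
    (shift : ∀ i j {k l}, M i j → k = i + 2 → l = j + 2 → M k l)
    (unshift : ∀ i j {k l}, M i j → k = i - 2 → l = j - 2 → M k l)
    (per : ∀ i j {k}, M i j → k = i + 4 → M k j)
    (per' : ∀ i j {l}, M i j → l = j - 4 → M i l)
    (left : ∀ i j {k}, k = i + 2 → ¬ (M i j ∧ M k j))
    (right : ∀ i j {l}, l = j + 2 → ¬ (M i j ∧ M i l))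
    (conj : ∀ i j {k l}, k = i + 1 → l = j - 1 → ¬ (M i j ∧ M k l))
    (tri : ∀ i j {k l}, l = j + 1 → k = i - 1 → ¬ (M i j ∧ M i l ∧ M k j))
    (tri' : ∀ i j {k l}, l = j - 1 → k = i + 1 → ¬ (M i j ∧ M i l ∧ M k j)) :
    ∑ k : Fin 8, (if M (![0, 2, 1, 1, 1, -1, 0, 0] k) (![0, 0, -1, 1, 0, 0, 1, -1] k)
      then 1 else 0) ≤ 2 := by
  have two : ∀ P Q : Prop, [Decidable P] → [Decidable Q] → ¬ (P ∧ Q) →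
      (if P then 1 else 0) + (if Q then 1 else 0) ≤ 1 := by
    intro P Q _ _ h; split_ifs <;> simp_all
  have three : ∀ P Q R : Prop, [Decidable P] → [Decidable Q] → [Decidable R] →
      ¬ (P ∧ Q ∧ R) →
      (if P then 1 else 0) + (if Q then 1 else 0) + (if R then 1 else 0) ≤ 2 := by
    intro P Q R _ _ _ h; split_ifs <;> simp_all
  -- The exclusions a1–a8 form a 4-cycle inside each parity class, so a class contributes at most
  -- two positions, and two only if they are opposite. The triples below forbid an opposite pair of
  -- one class together with any position of the other.
  have a1 := two (M 0 0) (M 2 0) (left 0 0 (by norm_num))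
  have a2 := two (M 0 0) (M 1 (-1)) (conj 0 0 (by norm_num) (by norm_num))
  have a3 := two (M 1 1) (M 2 0) (conj 1 1 (by norm_num) (by norm_num))
  have a4 := two (M 1 (-1)) (M 1 1) (right 1 (-1) (by norm_num))
  have a5 := two (M (-1) 0) (M 1 0) (left (-1) 0 (by norm_num))
  have a6 := two (M 0 (-1)) (M 0 1) (right 0 (-1) (by norm_num))
  have a7 := two (M 0 1) (M 1 0) (conj 0 1 (by norm_num) (by norm_num))
  have a8 := two (M (-1) 0) (M 0 (-1)) (conj (-1) 0 (by norm_num) (by norm_num))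
  have b1 := three (M 1 0) (M 0 (-1)) (M 0 0) fun ⟨h, k, l⟩ => tri' 0 0 (by norm_num) (by norm_num) ⟨l, k, h⟩
  have b2 := three (M 1 0) (M 0 (-1)) (M 2 0) fun ⟨h, k, l⟩ =>
    have k' : M 2 1 := shift _ _ k (by norm_num) (by norm_num)
    tri 2 0 (by norm_num) (by norm_num) ⟨l, k', h⟩
  have b3 := three (M 1 0) (M 0 (-1)) (M 1 (-1)) fun ⟨h, k, l⟩ =>
    tri 1 (-1) (by norm_num) (by norm_num) ⟨l, h, k⟩
  have b4 := three (M 1 0) (M 0 (-1)) (M 1 1) fun ⟨h, k, l⟩ =>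
    have k' : M 2 1 := shift _ _ k (by norm_num) (by norm_num)
    tri' 1 1 (by norm_num) (by norm_num) ⟨l, h, k'⟩
  have c1 := three (M (-1) 0) (M 0 1) (M 0 0) fun ⟨h, k, l⟩ => tri 0 0 (by norm_num) (by norm_num) ⟨l, k, h⟩
  have c2 := three (M (-1) 0) (M 0 1) (M 2 0) fun ⟨h, k, l⟩ =>
    have k' : M 2 3 := shift _ _ k (by norm_num) (by norm_num)
    have k'' : M 2 (-1) := per' _ _ k' (by norm_num)
    have h' : M 3 0 := per _ _ h (by norm_num)
    tri' 2 0 (by norm_num) (by norm_num) ⟨l, k'', h'⟩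
  have c3 := three (M (-1) 0) (M 0 1) (M 1 (-1)) fun ⟨h, k, l⟩ =>
    have k' : M 2 3 := shift _ _ k (by norm_num) (by norm_num)
    have k'' : M 2 (-1) := per' _ _ k' (by norm_num)
    have h' : M 1 2 := shift _ _ h (by norm_num) (by norm_num)
    have h'' : M 1 (-2) := per' _ _ h' (by norm_num)
    tri' 1 (-1) (by norm_num) (by norm_num) ⟨l, h'', k''⟩
  have c4 := three (M (-1) 0) (M 0 1) (M 1 1) fun ⟨h, k, l⟩ =>
    have h' : M 1 2 := shift _ _ h (by norm_num) (by norm_num)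
    tri 1 1 (by norm_num) (by norm_num) ⟨l, h', k⟩
  have d1 := three (M 0 0) (M 1 1) (M 1 0) fun ⟨h, k, l⟩ => tri 1 0 (by norm_num) (by norm_num) ⟨l, k, h⟩
  have d2 := three (M 0 0) (M 1 1) (M (-1) 0) fun ⟨h, k, l⟩ =>
    have k' : M (-1) (-1) := unshift _ _ k (by norm_num) (by norm_num)
    tri' (-1) 0 (by norm_num) (by norm_num) ⟨l, k', h⟩
  have d3 := three (M 0 0) (M 1 1) (M 0 1) fun ⟨h, k, l⟩ => tri' 0 1 (by norm_num) (by norm_num) ⟨l, h, k⟩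
  have d4 := three (M 0 0) (M 1 1) (M 0 (-1)) fun ⟨h, k, l⟩ =>
    have k' : M (-1) (-1) := unshift _ _ k (by norm_num) (by norm_num)
    tri 0 (-1) (by norm_num) (by norm_num) ⟨l, h, k'⟩
  have e1 := three (M 2 0) (M 1 (-1)) (M 1 0) fun ⟨h, k, l⟩ => tri' 1 0 (by norm_num) (by norm_num) ⟨l, k, h⟩
  have e2 := three (M 2 0) (M 1 (-1)) (M (-1) 0) fun ⟨h, k, l⟩ =>
    have k' : M 3 1 := shift _ _ k (by norm_num) (by norm_num)
    have l' : M 3 0 := per _ _ l (by norm_num)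
    tri 3 0 (by norm_num) (by norm_num) ⟨l', k', h⟩
  have e3 := three (M 2 0) (M 1 (-1)) (M 0 1) fun ⟨h, k, l⟩ =>
    have l' : M 2 3 := shift _ _ l (by norm_num) (by norm_num)
    have l'' : M 2 (-1) := per' _ _ l' (by norm_num)
    tri 2 (-1) (by norm_num) (by norm_num) ⟨l'', h, k⟩
  have e4 := three (M 2 0) (M 1 (-1)) (M 0 (-1)) fun ⟨h, k, l⟩ =>
    have h' : M 0 (-2) := unshift _ _ h (by norm_num) (by norm_num)
    tri' 0 (-1) (by norm_num) (by norm_num) ⟨l, h', k⟩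
  rw [Fin.sum_univ_eight]
  change (if M 0 0 then 1 else 0) + (if M 2 0 then 1 else 0) + (if M 1 (-1) then 1 else 0) +
    (if M 1 1 then 1 else 0) + (if M 1 0 then 1 else 0) + (if M (-1) 0 then 1 else 0) +
    (if M 0 1 then 1 else 0) + (if M 0 (-1) then 1 else 0) ≤ 2
  clear left right conj tri tri' shift unshift per per' two three
  generalize (if M 0 0 then 1 else 0) = a at *
  generalize (if M 1 0 then 1 else 0) = b at *
  generalize (if M 2 0 then 1 else 0) = c at *
  generalize (if M (-1) 0 then 1 else 0) = d at *
  have ha : a = 0 ∨ a = 1 := by omega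
  have hb : b = 0 ∨ b = 1 := by omega
  have hc : c = 0 ∨ c = 1 := by omega
  have hd : d = 0 ∨ d = 1 := by omega
  rcases ha with rfl | rfl <;> rcases hb with rfl | rfl <;> rcases hc with rfl | rfl <;>
    rcases hd with rfl | rfl <;> omega

-- Periodicity comes from conjugating by x² and multiplying by x⁴, both harmless because x⁴ commutes
-- with y. Each excluded configuration would make x² commute with xⁱyxʲ, hence with y.
open scoped Classical in
theorem sum_ite_translate_le_two (hx : x ∈ cubeSet α) (h4 : Commute (x ^ 4) y)
    (h2 : ¬ Commute (x ^ 2) y) :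
    ∑ k : Fin 8, (if x ^ ((![0, 2, 1, 1, 1, -1, 0, 0] : Fin 8 → ℤ) k) * y *
      x ^ ((![0, 0, -1, 1, 0, 0, 1, -1] : Fin 8 → ℤ) k) ∈ cubeSet α then 1 else 0) ≤ 2 := by
  have hc4 : ∀ i j : ℤ, Commute (x ^ 4) (x ^ i * y * x ^ j) := fun i j =>
    (((Commute.refl x).pow_left 4).zpow_right i |>.mul_right h4).mul_right
      (((Commute.refl x).pow_left 4).zpow_right j)
  have hc2 : ∀ i j : ℤ, ¬ Commute (x ^ 2) (x ^ i * y * x ^ j) := fun i j h => h2 (by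
    have e : y = x ^ (-i) * (x ^ i * y * x ^ j) * x ^ (-j) := by group
    rw [e]
    exact (((Commute.refl x).pow_left 2).zpow_right _ |>.mul_right h).mul_right
      (((Commute.refl x).pow_left 2).zpow_right _))
  have hx2 := pow_mem_cubeSet hx 2
  have hx4 := pow_mem_cubeSet hx 4
  have e4 : (x ^ 2) ^ 2 = x ^ 4 := by rw [← pow_mul]
  refine sum_ite_pattern_le_two (M := fun i j => x ^ i * y * x ^ j ∈ cubeSet α)
    ?_ ?_ ?_ ?_ ?_ ?_ ?_ ?_ ?_
  · rintro i j _ _ h rfl rfl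
    have h1 := (conj_mem_cubeSet_iff h hx2).2 (by rw [e4]; exact hc4 i j)
    have h3 := mul_mem_cubeSet_of_commute h1 hx4
      (by
        refine ((Commute.mul_right (Commute.mul_right ?_ (hc4 i j)) ?_)).symm
        · exact ((Commute.refl x).pow_left 4).pow_right 2
        · exact (((Commute.refl x).pow_left 4).pow_right 2).inv_right)
    convert h3 using 1; group
  · rintro i j _ _ h rfl rfl
    have h1 := (conj_mem_cubeSet_iff h (inv_mem_cubeSet hx2)).2
      (by rw [inv_pow, e4]; exact (hc4 i j).inv_left)
    have h3 := mul_mem_cubeSet_of_commute h1 (inv_mem_cubeSet hx4)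
      (by
        refine ((Commute.mul_right (Commute.mul_right ?_ (hc4 i j).inv_left) ?_)).symm
        · exact (((Commute.refl x).pow_left 4).pow_right 2).inv_inv
        · exact (((Commute.refl x).pow_left 4).pow_right 2).inv_inv.inv_right)
    convert h3 using 1; group
  · rintro i j _ h rfl
    have h3 := mul_mem_cubeSet_of_commute hx4 h (hc4 i j)
    convert h3 using 1; group
  · rintro i j _ h rfl
    have h3 := mul_mem_cubeSet_of_commute h (inv_mem_cubeSet hx4) (hc4 i j).symm.inv_right
    convert h3 using 1; group
  · rintro i j _ rfl ⟨h, h'⟩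
    refine hc2 i j (commute_of_commute_sq hx2 h ?_ ?_)
    · convert h' using 1; group
    · rw [e4]; exact (hc4 i j).pow_right 2
  · rintro i j _ rfl ⟨h, h'⟩
    refine hc2 i j (commute_of_commute_sq h hx2 ?_ ?_).symm
    · convert h' using 1; group
    · rw [e4]; exact ((hc4 i j).pow_right 2).symm
  · rintro i j _ _ rfl rfl ⟨h, h'⟩
    refine hc2 i j ((conj_mem_cubeSet_iff h hx).1 ?_)
    convert h' using 1; group
  · rintro i j _ _ rfl rfl ⟨h, h', h''⟩
    refine hc2 i j ((commute_of_mul_mem_of_inv_mul_mem hx h ?_ ?_).symm.pow_left 2)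
    · convert h' using 1; group
    · convert h'' using 1; group
  · rintro i j _ _ rfl rfl ⟨h, h', h''⟩
    refine hc2 i j ((commute_of_mul_mem_of_inv_mul_mem (inv_mem_cubeSet hx) h ?_ ?_).symm.inv_left.pow_left 2 |> fun h => by simpa using h)
    · convert h' using 1; group
    · convert h'' using 1; group

end Pattern

/-! ### The quarter bound outside C(x²) -/

section Quarter
variable {G : Type*} [Group G] [Finite G] {α : G ≃* G} {x y : G}

theorem mem_centralizer_iff_commute {G : Type*} [Group G] {a g : G} :
    g ∈ Subgroup.centralizer {a} ↔ Commute a g := by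
  rw [Subgroup.mem_centralizer_singleton_iff, eq_comm]; rfl

theorem commute_conj_pow_iff {G : Type*} [Group G] {x y : G} (n k : ℕ) :
    Commute (x ^ n) (x ^ k * y * (x ^ k)⁻¹) ↔ Commute (x ^ n) y := by
  have h : x ^ n = x ^ k * x ^ n * (x ^ k)⁻¹ := by
    rw [← pow_add, add_comm, pow_add, mul_inv_cancel_right]
  nth_rewrite 1 [h]
  exact Commute.conj_iff _

/-- The two conjugates differ by conjugation by xᵈ with d = j − i ∈ {1, 2, 3}, so x²ᵈ commutes with
y. For d = 3 the cube in x⁶ = (x²)³ can be dropped, as x² has order prime to 3. -/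
theorem commute_pow_four_of_conj_mem {i j : ℕ} (hij : i < j) (hj : j < 4) (hx : x ∈ cubeSet α)
    (h1 : x ^ i * y * (x ^ i)⁻¹ ∈ cubeSet α) (h2 : x ^ j * y * (x ^ j)⁻¹ ∈ cubeSet α) :
    Commute (x ^ 4) y := by
  obtain ⟨d, rfl⟩ := Nat.exists_eq_add_of_lt hij
  have h3 := (conj_mem_cubeSet_iff h1 (pow_mem_cubeSet hx (d + 1))).1 (by
    convert h2 using 1
    rw [add_assoc, add_comm i, pow_add x (d + 1) i]; group)
  rw [← pow_mul, commute_conj_pow_iff] at h3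
  have hd : d = 0 ∨ d = 1 ∨ d = 2 := by omega
  rcases hd with rfl | rfl | rfl
  · have := h3.pow_left 2
    rwa [← pow_mul] at this
  · exact h3
  · have h4 : Commute ((x ^ 2) ^ 3) y := by rwa [← pow_mul]
    have := (commute_of_cube_left (pow_mem_cubeSet hx 2) h4).pow_left 2
    rwa [← pow_mul] at this

/-- Outside C(x⁴) at most one of four conjugates by powers of x lies in T; on C(x⁴) \ C(x²) at most
two of eight translates do. Both proportions are 1/4. -/
theorem four_mul_ncard_diff_centralizer_sq_le (hx : x ∈ cubeSet α) :
    4 * (cubeSet α \ (Subgroup.centralizer {x ^ 2} : Set G)).ncard ≤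
      ((Subgroup.centralizer {x ^ 2} : Set G)ᶜ).ncard := by
  classical
  set T := cubeSet α
  set U : Set G := (Subgroup.centralizer {x ^ 4} : Set G)ᶜ with hU
  set V : Set G := (Subgroup.centralizer {x ^ 4} : Set G) \ Subgroup.centralizer {x ^ 2} with hV
  have hle : (Subgroup.centralizer {x ^ 2} : Set G) ⊆ Subgroup.centralizer {x ^ 4} := by
    intro g hg
    rw [SetLike.mem_coe, mem_centralizer_iff_commute] at *
    have := hg.pow_left 2
    rwa [← pow_mul] at this
  have hUV : (Subgroup.centralizer {x ^ 2} : Set G)ᶜ = U ∪ V := by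
    ext g
    have := @hle g
    simp only [hU, hV, Set.mem_compl_iff, Set.mem_union, Set.mem_sdiff]
    tauto
  have hdisj : Disjoint U V := by
    rw [Set.disjoint_left]
    intro g h1 h2
    exact h1 h2.1
  have memU : ∀ g, g ∈ U ↔ ¬ Commute (x ^ 4) g := fun g => by
    rw [hU, Set.mem_compl_iff, SetLike.mem_coe, mem_centralizer_iff_commute]
  have memV : ∀ g, g ∈ V ↔ Commute (x ^ 4) g ∧ ¬ Commute (x ^ 2) g := fun g => by
    rw [hV, Set.mem_sdiff, SetLike.mem_coe, SetLike.mem_coe, mem_centralizer_iff_commute,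
      mem_centralizer_iff_commute]
  have b1 : 4 * (T ∩ U).ncard ≤ U.ncard := by
    have := card_mul_ncard_inter_le (fun i : Fin 4 => (MulAut.conj (x ^ (i : ℕ))).toEquiv) T U 1
      (by
        intro i g
        simp only [memU, MulEquiv.toEquiv_eq_coe, EquivLike.coe_coe, MulAut.conj_apply,
          commute_conj_pow_iff])
      (by
        intro g hg
        rw [memU] at hg
        rw [Finset.sum_boole, Nat.cast_id, Finset.card_le_one]
        have key : ∀ i j : Fin 4, i < j → x ^ (i : ℕ) * g * (x ^ (i : ℕ))⁻¹ ∈ T →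
            x ^ (j : ℕ) * g * (x ^ (j : ℕ))⁻¹ ∈ T → False := fun i j hij h1 h2 =>
          hg (commute_pow_four_of_conj_mem (i := i) (j := j) hij j.2 hx h1 h2)
        intro i hi j hj
        replace hi := (Finset.mem_filter.1 hi).2
        replace hj := (Finset.mem_filter.1 hj).2
        rcases lt_trichotomy i j with h | h | h
        · exact (key i j h hi hj).elim
        · exact h
        · exact (key j i h hj hi).elim)
    simpa using this
  have b2 : 4 * (T ∩ V).ncard ≤ V.ncard := by
    have := card_mul_ncard_inter_le (fun k : Fin 8 =>
        (Equiv.mulLeft (x ^ ((![0, 2, 1, 1, 1, -1, 0, 0] : Fin 8 → ℤ) k))).trans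
          (Equiv.mulRight (x ^ ((![0, 0, -1, 1, 0, 0, 1, -1] : Fin 8 → ℤ) k)))) T V 2
      (by
        intro k g
        have hc : ∀ (n : ℕ) (i j : ℤ), Commute (x ^ n) (x ^ i * g * x ^ j) ↔
            Commute (x ^ n) g := by
          intro n i j
          have hi : ∀ m : ℤ, Commute (x ^ n) (x ^ m) := fun m =>
            ((Commute.refl x).pow_left n).zpow_right m
          refine ⟨fun h => ?_, fun h => ((hi i).mul_right h).mul_right (hi j)⟩
          have e : g = x ^ (-i) * (x ^ i * g * x ^ j) * x ^ (-j) := by group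
          rw [e]
          exact ((hi _).mul_right h).mul_right (hi _)
        simp only [memV, Equiv.trans_apply, Equiv.coe_mulLeft, Equiv.coe_mulRight, hc])
      (by
        intro g hg
        rw [memV] at hg
        exact sum_ite_translate_le_two hx hg.1 hg.2)
    simp only [Fintype.card_fin] at this
    omega
  have e1 : T \ (Subgroup.centralizer {x ^ 2} : Set G) = (T ∩ U) ∪ (T ∩ V) := by
    rw [Set.sdiff_eq, hUV, Set.inter_union_distrib_left]
  rw [e1, hUV, Set.ncard_union_eq hdisj, Set.ncard_union_eq
    (hdisj.mono Set.inter_subset_right Set.inter_subset_right)]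
  omega

end Quarter

/-! ### Majority arguments for subgroups -/

section Generalities
variable {G : Type*} [Group G] [Finite G]

theorem ncard_compl_subgroup (H : Subgroup G) :
    ((H : Set G)ᶜ).ncard + Nat.card H = Nat.card G := by
  rw [← Set.ncard_add_ncard_compl (H : Set G), add_comm]; rfl

theorem two_mul_card_le_of_ne_top {H : Subgroup G} (h : H ≠ ⊤) :
    2 * Nat.card H ≤ Nat.card G := by
  have h1 := H.card_mul_index
  have h2 : H.index ≠ 1 := fun h' => h (Subgroup.index_eq_one.1 h')
  have h3 : H.index ≠ 0 := Subgroup.index_ne_zero_of_finite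
  have h4 : 2 ≤ H.index := by omega
  rw [← h1, mul_comm]
  exact Nat.mul_le_mul_left _ h4

theorem eq_top_of_two_mul_ncard_gt {H : Subgroup G} {S : Set G} (hS : S ⊆ H)
    (h : Nat.card G < 2 * S.ncard) : H = ⊤ := by
  by_contra hne
  have h1 := two_mul_card_le_of_ne_top hne
  have h2 : S.ncard ≤ Nat.card H := Set.ncard_le_ncard hS
  omega

theorem two_mul_card_le_of_lt {H K : Subgroup G} (h : H < K) :
    2 * Nat.card H ≤ Nat.card K := by
  have h1 := two_mul_card_le_of_ne_top (G := K) (H := H.subgroupOf K)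
    (fun h' => h.not_ge (Subgroup.subgroupOf_eq_top.1 h'))
  rwa [Nat.card_congr (Subgroup.subgroupOfEquivOfLe h.le).toEquiv] at h1

theorem le_of_two_mul_ncard_gt {H K : Subgroup G} {S : Set G} (hSK : S ⊆ K) (hS : S ⊆ H)
    (h : Nat.card K < 2 * S.ncard) : K ≤ H := by
  by_contra hne
  have h1 := two_mul_card_le_of_lt (H := H ⊓ K) (K := K)
    (lt_of_le_of_ne inf_le_right (fun h' => hne (h' ▸ inf_le_left)))
  have h2 : S.ncard ≤ Nat.card (H ⊓ K : Subgroup G) :=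
    Set.ncard_le_ncard (fun s hs => ⟨hS hs, hSK hs⟩)
  omega

theorem ncard_inter_smul_gt (S : Set G) (K : Subgroup G) (hSK : S ⊆ K) {w : G} (hw : w ∈ K) :
    2 * S.ncard ≤ Nat.card K + (S ∩ {y | w * y ∈ S}).ncard := by
  have e1 : {y | w * y ∈ S}.ncard = S.ncard :=
    Set.ncard_preimage_of_injective_subset_range (f := fun y => w * y)
      (mul_right_injective w) (fun s _ => ⟨w⁻¹ * s, by simp⟩)
  have h1 := Set.ncard_union_add_ncard_inter S {y | w * y ∈ S}
  have h2 : (S ∪ {y | w * y ∈ S}).ncard ≤ Nat.card K := by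
    refine Set.ncard_le_ncard (t := (K : Set G)) (Set.union_subset hSK ?_)
    intro y hy
    exact (K.mul_mem_cancel_left hw).1 (hSK hy)
  omega

end Generalities

/-! ### An abelian subgroup of index 2, or central squares -/

section Dichotomy
variable {G : Type*} [Group G] [Finite G] {α : G ≃* G} {x : G}

/-- If x² is not central, K = C(x²) has index 2 and more than 3/8 of G, that is 3/4 of K, lies in T
∩ K. This density makes the squares, next the elements of T ∩ K, and finally all of K central in K.
-/
theorem abelian_index_two_or_sq_central (hα : Nat.card G < 2 * (cubeSet α).ncard) :
    (∃ K : Subgroup G, K.index = 2 ∧ ∀ g ∈ K, ∀ h ∈ K, g * h = h * g) ∨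
      ∀ x ∈ cubeSet α, x ^ 2 ∈ Subgroup.center G := by
  have split : ∀ (C : Subgroup G), (cubeSet α).ncard =
      (cubeSet α ∩ C).ncard + (cubeSet α \ C).ncard := fun C =>
    (Set.ncard_inter_add_ncard_sdiff_eq_ncard _ _).symm
  have hcard : ∀ x ∈ cubeSet α, Subgroup.centralizer {x ^ 2} ≠ ⊤ →
      2 * Nat.card (Subgroup.centralizer {x ^ 2}) = Nat.card G := by
    intro x hx hne
    have h1 := four_mul_ncard_diff_centralizer_sq_le hx
    have h2 := ncard_compl_subgroup (Subgroup.centralizer {x ^ 2})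
    have h3 := split (Subgroup.centralizer {x ^ 2})
    have h4 : (cubeSet α ∩ (Subgroup.centralizer {x ^ 2} : Set G)).ncard ≤
      Nat.card (Subgroup.centralizer {x ^ 2}) := Set.ncard_le_ncard Set.inter_subset_right
    have h5 := two_mul_card_le_of_ne_top hne
    have h6 := (Subgroup.centralizer {x ^ 2}).card_mul_index
    -- The quarter bound gives |T| ≤ |C| + (|G| − |C|)/4, which is at most |G|/2 as soon as |C| ≤
    -- |G|/3.
    have h7 : (Subgroup.centralizer {x ^ 2}).index < 3 := by
      by_contra hge
      push Not at hge
      have := Nat.mul_le_mul_left (Nat.card (Subgroup.centralizer {x ^ 2})) hge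
      omega
    have h8 : (Subgroup.centralizer {x ^ 2}).index ≠ 1 := fun h => hne (Subgroup.index_eq_one.1 h)
    have h9 : (Subgroup.centralizer {x ^ 2}).index ≠ 0 := Subgroup.index_ne_zero_of_finite
    have h10 : (Subgroup.centralizer {x ^ 2}).index = 2 := by omega
    rw [h10] at h6
    omega
  by_cases hall : ∀ x ∈ cubeSet α, Subgroup.centralizer {x ^ 2} = ⊤
  · right
    intro x hx
    exact (Subgroup.centralizer_eq_top_iff_subset.1 (hall x hx)) rfl
  left
  push Not at hall
  obtain ⟨x, hx, hne⟩ := hall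
  set K := Subgroup.centralizer {x ^ 2} with hK
  have hK2 : 2 * Nat.card K = Nat.card G := hcard x hx hne
  refine ⟨K, ?_, ?_⟩
  · have := K.card_mul_index
    have hpos : 0 < Nat.card K := Nat.card_pos
    rw [← hK2, mul_comm] at this
    exact Nat.eq_of_mul_eq_mul_right hpos this
  have quarter : ∀ w ∈ cubeSet α, Subgroup.centralizer {w ^ 2} ≠ ⊤ →
      8 * (cubeSet α \ (Subgroup.centralizer {w ^ 2} : Set G)).ncard ≤ Nat.card G := by
    intro w hw hne
    have h1 := four_mul_ncard_diff_centralizer_sq_le hw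
    have h2 := ncard_compl_subgroup (Subgroup.centralizer {w ^ 2})
    have h3 := hcard w hw hne
    omega
  have hTK := split K
  have hq : 8 * (cubeSet α \ (K : Set G)).ncard ≤ Nat.card G := quarter x hx hne
  -- If C(w²) missed part of K, it would contain at most half of K, and outside it T has at most
  -- |G|/8 = |K|/4 elements: |T ∩ K| would not exceed 3|K|/4.
  have hsq : ∀ w ∈ cubeSet α ∩ K, K ≤ Subgroup.centralizer {w ^ 2} := by
    intro w hw
    by_contra hnle
    have hne' : Subgroup.centralizer {w ^ 2} ≠ ⊤ := fun h => hnle (h ▸ le_top)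
    have h1 := quarter w hw.1 hne'
    have h2 := two_mul_card_le_of_lt (H := Subgroup.centralizer {w ^ 2} ⊓ K) (K := K)
      (lt_of_le_of_ne inf_le_right (fun h' => hnle (h' ▸ inf_le_left)))
    have h3 : (cubeSet α ∩ K).ncard ≤
        Nat.card (Subgroup.centralizer {w ^ 2} ⊓ K : Subgroup G) +
        (cubeSet α \ (Subgroup.centralizer {w ^ 2} : Set G)).ncard := by
      refine le_trans (Set.ncard_le_ncard (t := ((Subgroup.centralizer {w ^ 2} ⊓ K :
        Subgroup G) : Set G) ∪ (cubeSet α \ (Subgroup.centralizer {w ^ 2} : Set G))) ?_)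
        (Set.ncard_union_le _ _)
      intro t ht
      by_cases h : t ∈ Subgroup.centralizer {w ^ 2}
      · exact Or.inl ⟨h, ht.2⟩
      · exact Or.inr ⟨ht.1, h⟩
    omega
  -- More than half of the y ∈ K satisfy y, wy ∈ T; for these the squares of w and y commute, so w
  -- and y commute.
  have hcent : ∀ w ∈ cubeSet α ∩ K, K ≤ Subgroup.centralizer {w} := by
    intro w hw
    refine le_of_two_mul_ncard_gt (S := (cubeSet α ∩ K) ∩ {y | w * y ∈ cubeSet α ∩ K})
      (fun y hy => hy.1.2) ?_ ?_
    · intro y hy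
      rw [SetLike.mem_coe, mem_centralizer_iff_commute]
      exact commute_of_commute_sq hw.1 hy.1.1 hy.2.1
        ((mem_centralizer_iff_commute.1 (hsq w hw hy.1.2)).pow_right 2)
    · have := ncard_inter_smul_gt (cubeSet α ∩ K) K Set.inter_subset_right hw.2
      omega
  intro g hg
  have : K ≤ Subgroup.centralizer {g} := by
    refine le_of_two_mul_ncard_gt (S := cubeSet α ∩ K) Set.inter_subset_right ?_ ?_
    · intro y hy
      rw [SetLike.mem_coe, mem_centralizer_iff_commute]
      exact (mem_centralizer_iff_commute.1 (hcent y hy hg)).symm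
    · omega
  intro h hh
  exact mem_centralizer_iff_commute.1 (this hh)

/-- Both T and z⁻¹T exceed half of G, so some y has y, zy ∈ T; comparing the cubes gives α(z) = 1.
-/
theorem eq_one_of_central_of_cube_eq_one (hα : Nat.card G < 2 * (cubeSet α).ncard) {z : G}
    (hz : z ∈ Subgroup.center G) (h3 : z ^ 3 = 1) : z = 1 := by
  have h := ncard_inter_smul_gt (cubeSet α) ⊤ (fun _ _ => Subgroup.mem_top _)
    (Subgroup.mem_top z)
  rw [Subgroup.card_top] at h
  have hpos : 0 < (cubeSet α ∩ {y | z * y ∈ cubeSet α}).ncard := by omega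
  obtain ⟨y, hy, hzy⟩ := (Set.ncard_pos).1 hpos
  have hc : Commute z y := (Subgroup.mem_center_iff.1 hz y).symm
  have h1 : α (z * y) = (z * y) ^ 3 := hzy
  rw [hc.mul_pow, h3, one_mul, map_mul, mem_cubeSet.1 hy, mul_eq_right] at h1
  simpa using h1

end Dichotomy

/-! ### Centralizer indices of elements with central square -/

section Commutators
variable {G : Type*} [Group G] {a b f g h : G}

theorem commutator_mul_left (hb : ⁅b, g⁆ ∈ Subgroup.center G) :
    ⁅a * b, g⁆ = ⁅a, g⁆ * ⁅b, g⁆ := by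
  have h1 : ⁅a * b, g⁆ = a * ⁅b, g⁆ * g * a⁻¹ * g⁻¹ := by
    simp only [commutatorElement_def]; group
  have h2 : a * ⁅b, g⁆ = ⁅b, g⁆ * a := Subgroup.mem_center_iff.1 hb a
  have h3 : ⁅a, g⁆ * ⁅b, g⁆ = ⁅b, g⁆ * ⁅a, g⁆ := Subgroup.mem_center_iff.1 hb _
  rw [h1, h2, h3]
  simp only [commutatorElement_def]; group

theorem commutator_mul_right (hh : ⁅a, h⁆ ∈ Subgroup.center G) :
    ⁅a, g * h⁆ = ⁅a, g⁆ * ⁅a, h⁆ := by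
  have h1 : ⁅a, g * h⁆ = ⁅a, g⁆ * (g * ⁅a, h⁆ * g⁻¹) := by
    simp only [commutatorElement_def]; group
  rw [h1, Subgroup.mem_center_iff.1 hh g, mul_inv_cancel_right]

theorem commutator_sq_eq_one (ha : a ^ 2 ∈ Subgroup.center G) (hc : ⁅a, g⁆ ∈ Subgroup.center G) :
    ⁅a, g⁆ ^ 2 = 1 := by
  have h1 : ⁅a ^ 2, g⁆ = 1 :=
    commutatorElement_eq_one_iff_commute.2 (Subgroup.mem_center_iff.1 ha g).symm
  rwa [pow_two, commutator_mul_left hc, ← pow_two] at h1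

theorem commutator_eq_one_of_mem_center (ha : a ∈ Subgroup.center G) : ⁅a, g⁆ = 1 :=
  commutatorElement_eq_one_iff_commute.2 (Subgroup.mem_center_iff.1 ha g).symm

theorem commute_of_mem_center (ha : a ∈ Subgroup.center G) : Commute a g :=
  (Subgroup.mem_center_iff.1 ha g).symm

/-- The homomorphism `g ↦ ⁅a, g⁆` for an element `a` of the second center. -/
def commHom (a : G) (ha : ∀ g, ⁅a, g⁆ ∈ Subgroup.center G) : G →* G where
  toFun g := ⁅a, g⁆
  map_one' := by simp
  map_mul' _ h := commutator_mul_right (ha h)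

theorem ker_commHom (ha : ∀ g, ⁅a, g⁆ ∈ Subgroup.center G) :
    (commHom a ha).ker = Subgroup.centralizer {a} := by
  ext g
  rw [MonoidHom.mem_ker, mem_centralizer_iff_commute]
  exact commutatorElement_eq_one_iff_commute

theorem centralizer_ne_top (ha : a ∉ Subgroup.center G) : Subgroup.centralizer {a} ≠ ⊤ :=
  fun h => ha (Subgroup.centralizer_eq_top_iff_subset.1 h rfl)

theorem centralizer_index_ne_one (ha : a ∉ Subgroup.center G) :
    (Subgroup.centralizer {a}).index ≠ 1 :=
  fun h => centralizer_ne_top ha (Subgroup.index_eq_one.1 h)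

/-- C = C(a) is normal, so b = ga⁻¹g⁻¹ centralizes C, and so does [a,g] = ab. As a² is central,
(ab)² = 1; conjugation by g ∉ C inverts ab, hence fixes it. Thus ab commutes with C and g, which
generate G. -/
theorem commutator_mem_center_of_index_two (ha : a ^ 2 ∈ Subgroup.center G)
    (hi : (Subgroup.centralizer {a}).index = 2) (g : G) : ⁅a, g⁆ ∈ Subgroup.center G := by
  set C := Subgroup.centralizer {a} with hC
  have hN : C.Normal := Subgroup.normal_of_index_eq_two hi
  have haC : a ∈ C := mem_centralizer_iff_commute.2 (Commute.refl a)
  by_cases hg : g ∈ C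
  · rw [commutatorElement_eq_one_iff_commute.2 (mem_centralizer_iff_commute.1 hg)]
    exact one_mem _
  set b := g * a⁻¹ * g⁻¹ with hb
  have hab : ⁅a, g⁆ = a * b := by rw [commutatorElement_def, hb]; group
  have hbC : ∀ w ∈ C, Commute b w := by
    intro w hw
    have h1 : g⁻¹ * w * g ∈ C := by simpa using hN.conj_mem w hw g⁻¹
    have h2 : Commute a⁻¹ (g⁻¹ * w * g) := (mem_centralizer_iff_commute.1 h1).inv_left
    have h3 := (Commute.conj_iff g).2 h2
    convert h3 using 1; group
  have hcC : ∀ w ∈ C, Commute (a * b) w := fun w hw =>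
    (mem_centralizer_iff_commute.1 hw).mul_left (hbC w hw)
  have hba : Commute a b := (hbC a haC).symm
  have hsq : (a * b) * (a * b) = 1 := by
    rw [← pow_two, hba.mul_pow, hb, conj_pow, inv_pow,
      ((commute_of_mem_center ha (g := g)).inv_left.eq).symm]
    group
  have hgc : Commute (a * b) g := by
    have hg2 : g ^ 2 ∈ C := by
      rw [pow_two]
      exact (Subgroup.mul_mem_iff_of_index_two hi).2 Iff.rfl
    have h1 : g ^ 2 * a⁻¹ * (g ^ 2)⁻¹ = a⁻¹ := by
      rw [← (mem_centralizer_iff_commute.1 hg2).inv_left.eq]; group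
    have h2 : g * (a * b) * g⁻¹ = b⁻¹ * (g ^ 2 * a⁻¹ * (g ^ 2)⁻¹) := by
      rw [hb]; simp [pow_two, mul_assoc]
    have h3 : b⁻¹ * a⁻¹ = a * b := by
      rw [← mul_inv_rev]; exact inv_eq_of_mul_eq_one_left hsq
    rw [h1, h3, mul_inv_eq_iff_eq_mul] at h2
    exact h2.symm
  rw [hab, Subgroup.mem_center_iff]
  intro h
  by_cases hh : h ∈ C
  · exact (hcC h hh).symm
  · have h1 : g⁻¹ * h ∈ C := by
      rw [Subgroup.mul_mem_iff_of_index_two hi, inv_mem_iff]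
      tauto
    have h2 := hgc.mul_right (hcC _ h1)
    rw [mul_inv_cancel_left] at h2
    exact h2.symm

/-- The homomorphism [a,·] has values of order at most 2, while index 3 would kill the cubes of
those values. -/
theorem centralizer_index_ne_three (ha : a ^ 2 ∈ Subgroup.center G)
    (hc : ∀ g, ⁅a, g⁆ ∈ Subgroup.center G) : (Subgroup.centralizer {a}).index ≠ 3 := by
  intro hi
  have h0 : ∀ g : G, ⁅a, g⁆ = 1 := by
    intro g
    have h2 := commutator_sq_eq_one ha (hc g)
    have h3 : (commHom a hc) (g ^ 3) = 1 := by
      rw [← MonoidHom.mem_ker]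
      have := Subgroup.pow_index_mem (H := (commHom a hc).ker) g
      rwa [ker_commHom, hi, ← ker_commHom hc] at this
    rw [map_pow] at h3
    change ⁅a, g⁆ ^ 3 = 1 at h3
    rwa [pow_succ, h2, one_mul] at h3
  have : Subgroup.centralizer {a} = ⊤ := by
    rw [← ker_commHom hc, eq_top_iff]
    intro g _
    exact h0 g
  rw [this, Subgroup.index_top] at hi
  omega

theorem mul_card_le_of_index_ge {H : Subgroup G} {n : ℕ} (h : n ≤ H.index) :
    n * Nat.card H ≤ Nat.card G := by
  rw [← H.card_mul_index, mul_comm]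
  exact Nat.mul_le_mul_left _ h

variable [Finite G]

theorem three_mul_card_centralizer_le (ha : a ^ 2 ∈ Subgroup.center G)
    (hn : ¬ ∀ g, ⁅a, g⁆ ∈ Subgroup.center G) :
    3 * Nat.card (Subgroup.centralizer {a}) ≤ Nat.card G := by
  refine mul_card_le_of_index_ge ?_
  have h1 : (Subgroup.centralizer {a}).index ≠ 1 := centralizer_index_ne_one fun hz =>
    hn fun g => by rw [commutator_eq_one_of_mem_center hz]; exact one_mem _
  have h2 : (Subgroup.centralizer {a}).index ≠ 2 := fun h =>
    hn (commutator_mem_center_of_index_two ha h)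
  have h0 : (Subgroup.centralizer {a}).index ≠ 0 := Subgroup.index_ne_zero_of_finite
  omega

/-- Individually C(a) and C(af) have index at least 3; pairing improves the average to 1/4. The
reason is that any element in two of C(a), C(af), C(f) lies in the third. -/
theorem two_mul_card_centralizer_add_le (ha : a ^ 2 ∈ Subgroup.center G)
    (hf : f ^ 2 ∈ Subgroup.center G) (haf : Commute a f) (hfz : f ∉ Subgroup.center G)
    (hf2 : ∀ g, ⁅f, g⁆ ∈ Subgroup.center G) (hn : ¬ ∀ g, ⁅a, g⁆ ∈ Subgroup.center G) :
    2 * (Nat.card (Subgroup.centralizer {a}) + Nat.card (Subgroup.centralizer {a * f})) ≤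
      Nat.card G := by
  have haf2 : (a * f) ^ 2 ∈ Subgroup.center G := by
    rw [haf.mul_pow]; exact mul_mem ha hf
  have hn' : ¬ ∀ g, ⁅a * f, g⁆ ∈ Subgroup.center G := fun h => hn fun g => by
    have := h g
    rw [commutator_mul_left (hf2 g)] at this
    exact (Subgroup.mul_mem_cancel_right _ (hf2 g)).1 this
  have b1 := three_mul_card_centralizer_le ha hn
  have b2 := three_mul_card_centralizer_le haf2 hn'
  set D₁ := Subgroup.centralizer {a} with hD1
  set D₂ := Subgroup.centralizer {a * f} with hD2
  set F := Subgroup.centralizer {f} with hF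
  have hI : ∀ x ∈ F, x ∈ D₁ ↔ x ∈ D₂ := by
    intro x hx
    rw [hF, mem_centralizer_iff_commute] at hx
    rw [hD1, hD2, mem_centralizer_iff_commute, mem_centralizer_iff_commute]
    refine ⟨fun h => h.mul_left hx, fun h => ?_⟩
    have := h.mul_left hx.inv_left
    rwa [mul_inv_cancel_right] at this
  have hI' : ∀ x ∈ D₁, x ∈ D₂ → x ∈ F := by
    intro x h1 h2
    rw [hD1, mem_centralizer_iff_commute] at h1
    rw [hD2, mem_centralizer_iff_commute] at h2
    rw [hF, mem_centralizer_iff_commute]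
    have := h1.inv_left.mul_left h2
    rwa [inv_mul_cancel_left] at this
  -- Both inside F: they coincide, and index 3 would force C(f) to have index 1 or 3. Only one
  -- inside F: it is proper in the other, and 1/6 + 1/3 = 1/2.
  by_cases h1 : D₁ ≤ F <;> by_cases h2 : D₂ ≤ F
  · have h12 : D₁ = D₂ := le_antisymm (fun x hx => (hI x (h1 hx)).1 hx)
      (fun x hx => (hI x (h2 hx)).2 hx)
    have h3 : D₁.index ≠ 3 := by
      intro h3
      have hd := Subgroup.index_dvd_of_le h1
      rw [h3, Nat.dvd_prime Nat.prime_three] at hd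
      rcases hd with hd | hd
      · exact centralizer_index_ne_one hfz hd
      · exact centralizer_index_ne_three hf hf2 hd
    have h4 : D₁.index ≠ 1 := centralizer_index_ne_one fun hz =>
      hn fun g => by rw [commutator_eq_one_of_mem_center hz]; exact one_mem _
    have h5 : D₁.index ≠ 2 := fun h => hn (commutator_mem_center_of_index_two ha h)
    have h0 : D₁.index ≠ 0 := Subgroup.index_ne_zero_of_finite
    have h6 := mul_card_le_of_index_ge (H := D₁) (n := 4) (by omega)
    rw [← h12]
    omega
  · have : D₁ < D₂ := lt_of_le_of_ne (fun x hx => (hI x (h1 hx)).1 hx) (fun h => h2 (h ▸ h1))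
    have := two_mul_card_le_of_lt this
    omega
  · have : D₂ < D₁ := lt_of_le_of_ne (fun x hx => (hI x (h2 hx)).2 hx) (fun h => h1 (h ▸ h2))
    have := two_mul_card_le_of_lt this
    omega
  -- M consists of the x with [a,x] central. It is proper because a is outside the second center,
  -- and properly contains both centralizers, so each has index at least 4.
  · set M := (Subgroup.centralizer {(a : G ⧸ Subgroup.center G)}).comap
      (QuotientGroup.mk' (Subgroup.center G)) with hM
    have memM : ∀ x, x ∈ M ↔ ⁅a, x⁆ ∈ Subgroup.center G := by
      intro x
      rw [hM, Subgroup.mem_comap, mem_centralizer_iff_commute,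
        ← commutatorElement_eq_one_iff_commute, ← QuotientGroup.eq_one_iff]
      rfl
    have hMt : M ≠ ⊤ := fun h => hn fun g => (memM g).1 (h ▸ Subgroup.mem_top g)
    have hD1M : D₁ ≤ M := fun x hx => (memM x).2 (by
      rw [commutatorElement_eq_one_iff_commute.2 (mem_centralizer_iff_commute.1 hx)]
      exact one_mem _)
    have hD2M : D₂ ≤ M := fun x hx => (memM x).2 (by
      have h3 := commutatorElement_eq_one_iff_commute.2 (mem_centralizer_iff_commute.1 hx)
      rw [commutator_mul_left (hf2 x), mul_eq_one_iff_eq_inv] at h3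
      rw [h3]
      exact inv_mem (hf2 x))
    obtain ⟨x, hx, hxF⟩ := SetLike.not_le_iff_exists.1 h1
    obtain ⟨y, hy, hyF⟩ := SetLike.not_le_iff_exists.1 h2
    have l1 := two_mul_card_le_of_lt (lt_of_le_of_ne hD1M
      (fun h => hyF (hI' y (h ▸ hD2M hy) hy)))
    have l2 := two_mul_card_le_of_lt (lt_of_le_of_ne hD2M
      (fun h => hxF (hI' x hx (h ▸ hD1M hx))))
    have l3 := two_mul_card_le_of_ne_top hMt
    omega

end Commutators

/-! ### Linearization: elements whose square is given by a central homomorphism -/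

section SquareSet
variable {G : Type*} [Group G]

/-- The elements whose square is given by the homomorphism `φ`. -/
def sqSet (φ : G →* G) : Set G := {g | g ^ 2 = φ g}

/-- For x ∈ T, α(x) = x·x² ≡ x modulo the center. The elements with α(g) ≡ g form a subgroup
containing T, hence all of G, so g ↦ g⁻¹α(g) is central and therefore multiplicative. -/
theorem exists_central_hom [Finite G] {α : G ≃* G} (hα : Nat.card G < 2 * (cubeSet α).ncard)
    (hsq : ∀ x ∈ cubeSet α, x ^ 2 ∈ Subgroup.center G) :
    ∃ φ : G →* G, (∀ g, φ g ∈ Subgroup.center G) ∧ cubeSet α = sqSet φ := by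
  let K : Subgroup G := MonoidHom.eqLocus
    ((QuotientGroup.mk' (Subgroup.center G)).comp α.toMonoidHom)
    (QuotientGroup.mk' (Subgroup.center G))
  have hK : K = ⊤ := by
    refine eq_top_of_two_mul_ncard_gt (S := cubeSet α) ?_ hα
    intro x hx
    change QuotientGroup.mk' (Subgroup.center G) (α x) = QuotientGroup.mk' (Subgroup.center G) x
    rw [eq_comm, QuotientGroup.mk'_apply, QuotientGroup.mk'_apply, QuotientGroup.eq,
      mem_cubeSet.1 hx, pow_succ', inv_mul_cancel_left]
    exact hsq x hx
  have hc : ∀ g, g⁻¹ * α g ∈ Subgroup.center G := by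
    intro g
    have : g ∈ K := hK ▸ Subgroup.mem_top g
    exact QuotientGroup.eq.1 (Eq.symm this)
  refine ⟨⟨⟨fun g => g⁻¹ * α g, by simp⟩, ?_⟩, hc, ?_⟩
  · intro g h
    have := Subgroup.mem_center_iff.1 (hc g) h⁻¹
    change (g * h)⁻¹ * α (g * h) = g⁻¹ * α g * (h⁻¹ * α h)
    rw [← mul_assoc, ← this, map_mul]
    group
  · ext g
    change α g = g ^ 3 ↔ g ^ 2 = g⁻¹ * α g
    rw [eq_inv_mul_iff_mul_eq, ← pow_succ', eq_comm]

variable {φ : G →* G} {x y : G}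

theorem mem_sqSet : x ∈ sqSet φ ↔ x ^ 2 = φ x := Iff.rfl

theorem one_mem_sqSet : (1 : G) ∈ sqSet φ := by simp [mem_sqSet]

theorem inv_mem_sqSet (hx : x ∈ sqSet φ) : x⁻¹ ∈ sqSet φ := by
  rw [mem_sqSet] at *
  rw [inv_pow, hx, map_inv]

theorem mul_mem_sqSet_iff (hx : x ∈ sqSet φ) (hy : y ∈ sqSet φ) :
    x * y ∈ sqSet φ ↔ Commute x y := by
  rw [mem_sqSet] at *
  rw [map_mul, ← hx, ← hy]
  have e1 : (x * y) ^ 2 = x * (y * x) * y := by simp [pow_two, mul_assoc]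
  have e2 : x ^ 2 * y ^ 2 = x * (x * y) * y := by simp [pow_two, mul_assoc]
  rw [e1, e2, mul_left_inj, mul_right_inj, eq_comm]
  rfl

theorem sq_mem_center (hφ : ∀ g, φ g ∈ Subgroup.center G) (hx : x ∈ sqSet φ) : x ^ 2 ∈ Subgroup.center G :=
  mem_sqSet.1 hx ▸ hφ x

end SquareSet

/-! ### Subgroups maximal inside the square set -/

section MaximalSubgroup
variable {G : Type*} [Group G] {φ : G →* G} {H : Subgroup G} {x y : G}

theorem closure_subset_sqSet {S : Set G} (hS : S ⊆ sqSet φ)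
    (hc : ∀ a ∈ S, ∀ b ∈ S, Commute a b) : (Subgroup.closure S : Set G) ⊆ sqSet φ := by
  have hcomm : ∀ a ∈ Subgroup.closure S, ∀ b ∈ Subgroup.closure S, Commute a b := by
    intro a ha b hb
    have h1 : ∀ b ∈ S, Subgroup.closure S ≤ Subgroup.centralizer {b} := fun b hb => by
      rw [Subgroup.closure_le]
      exact fun a ha => mem_centralizer_iff_commute.2 (hc b hb a ha)
    have h2 : Subgroup.closure S ≤ Subgroup.centralizer {a} := by
      rw [Subgroup.closure_le]
      exact fun b hb => mem_centralizer_iff_commute.2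
        (mem_centralizer_iff_commute.1 (h1 b hb ha)).symm
    exact mem_centralizer_iff_commute.1 (h2 hb)
  intro g hg
  induction hg using Subgroup.closure_induction with
  | mem x hx => exact hS hx
  | one => exact one_mem_sqSet
  | mul a b ha hb ha' hb' => exact (mul_mem_sqSet_iff ha' hb').2 (hcomm a ha b hb)
  | inv a _ ha' => exact inv_mem_sqSet ha'

/-- `H` is maximal among the subgroups contained in `sqSet φ`. -/
def IsMaximalIn (φ : G →* G) (H : Subgroup G) : Prop :=
  Maximal (fun K : Subgroup G => (K : Set G) ⊆ sqSet φ) H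

theorem commute_of_subset_sqSet (hH : (H : Set G) ⊆ sqSet φ) (hx : x ∈ H) (hy : y ∈ H) :
    Commute x y :=
  (mul_mem_sqSet_iff (hH hx) (hH hy)).1 (hH (mul_mem hx hy))

theorem exists_isMaximalIn [Finite G] {S : Set G} (hS : S ⊆ sqSet φ)
    (hc : ∀ a ∈ S, ∀ b ∈ S, Commute a b) : ∃ H : Subgroup G, IsMaximalIn φ H ∧ S ⊆ H := by
  obtain ⟨H, hle, hH⟩ := Finite.exists_le_maximal
    (p := fun K : Subgroup G => (K : Set G) ⊆ sqSet φ) (closure_subset_sqSet hS hc)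
  exact ⟨H, hH, Subgroup.subset_closure.trans hle⟩

namespace IsMaximalIn

theorem subset (hH : IsMaximalIn φ H) : (H : Set G) ⊆ sqSet φ := hH.prop

theorem commute (hH : IsMaximalIn φ H) (hx : x ∈ H) (hy : y ∈ H) : Commute x y :=
  commute_of_subset_sqSet hH.subset hx hy

theorem mem_of_commute (hH : IsMaximalIn φ H) (hy : y ∈ sqSet φ)
    (hc : ∀ h ∈ H, Commute h y) : y ∈ H := by
  have h1 : (Subgroup.closure (insert y (H : Set G)) : Set G) ⊆ sqSet φ := by
    refine closure_subset_sqSet (Set.insert_subset hy hH.subset) ?_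
    rintro a (rfl | ha) b (rfl | hb)
    · exact Commute.refl _
    · exact (hc b hb).symm
    · exact hc a ha
    · exact hH.commute ha hb
  have h2 : H ≤ Subgroup.closure (insert y (H : Set G)) := fun h hh =>
    Subgroup.subset_closure (Or.inr hh)
  exact hH.le_of_ge h1 h2 (Subgroup.subset_closure (Or.inl rfl))

theorem inf_centralizer_lt (hH : IsMaximalIn φ H) {g : G} (hg : g ∉ H)
    (he : ∃ h ∈ H, h * g ∈ sqSet φ) : H ⊓ Subgroup.centralizer {g} < H := by
  obtain ⟨k, hk, hkg⟩ := he
  refine lt_of_le_of_ne inf_le_left fun h => hg ?_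
  have h1 : k * g ∈ H := hH.mem_of_commute hkg fun h' hh' =>
    (hH.commute hh' hk).mul_right (mem_centralizer_iff_commute.1 (Subgroup.mem_inf.1 (h.ge hh')).2).symm
  exact (H.mul_mem_cancel_left hk).1 h1

variable [Finite G]

/-- If hg and kg both lie in the square set with h, k ∈ H, then so does (hk⁻¹)(kg), and hk⁻¹
commutes with kg, hence with g. The solutions h thus lie in a single coset of C_H(g). -/
theorem ncard_coset_le (hH : IsMaximalIn φ H) (g : G) :
    {h : G | h ∈ H ∧ h * g ∈ sqSet φ}.ncard ≤
      Nat.card (H ⊓ Subgroup.centralizer {g} : Subgroup G) := by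
  by_cases he : ∃ h ∈ H, h * g ∈ sqSet φ
  · obtain ⟨k, hk, hkg⟩ := he
    refine Set.ncard_le_ncard_of_injOn (t := ((H ⊓ Subgroup.centralizer {g} : Subgroup G) : Set G))
      (fun h => h * k⁻¹) ?_ (fun _ _ _ _ h => mul_right_cancel h)
    rintro h ⟨hh, hhg⟩
    have h1 : h * k⁻¹ ∈ H := mul_mem hh (inv_mem hk)
    refine Subgroup.mem_inf.2 ⟨h1, ?_⟩
    have h2 : Commute (h * k⁻¹) (k * g) := by
      rw [← mul_mem_sqSet_iff (hH.subset h1) hkg]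
      convert hhg using 1; group
    rw [mem_centralizer_iff_commute]
    have h3 := ((hH.commute h1 hk).inv_right.mul_right h2).symm
    rwa [inv_mul_cancel_left] at h3
  · push Not at he
    have : {h : G | h ∈ H ∧ h * g ∈ sqSet φ} = ∅ := by
      ext h
      simpa using he h
    rw [this, Set.ncard_empty]
    exact Nat.zero_le _

theorem two_mul_ncard_coset_le (hH : IsMaximalIn φ H) {g : G} (hg : g ∉ H) :
    2 * {h : G | h ∈ H ∧ h * g ∈ sqSet φ}.ncard ≤ Nat.card H := by
  by_cases he : ∃ h ∈ H, h * g ∈ sqSet φ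
  · have h1 := two_mul_card_le_of_lt (hH.inf_centralizer_lt hg he)
    have h2 := hH.ncard_coset_le g
    omega
  · push Not at he
    have : {h : G | h ∈ H ∧ h * g ∈ sqSet φ} = ∅ := by
      ext h
      simpa using he h
    rw [this, Set.ncard_empty]
    exact Nat.zero_le _

end IsMaximalIn

theorem sum_ncard_coset [Fintype G] (H : Subgroup G) (T : Set G) :
    ∑ g : G, {h : G | h ∈ H ∧ h * g ∈ T}.ncard = Nat.card H * T.ncard := by
  classical
  have h1 : ∀ g : G, {h : G | h ∈ H ∧ h * g ∈ T}.ncard =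
      ∑ h : G, if h ∈ H ∧ h * g ∈ T then 1 else 0 := by
    intro g
    rw [Finset.sum_boole, Nat.cast_id, ← Set.ncard_coe_finset]
    congr 1
    ext h
    simp
  have h2 : ∀ h : G, (∑ g : G, if h ∈ H ∧ h * g ∈ T then 1 else 0) =
      if h ∈ H then T.ncard else 0 := by
    intro h
    split_ifs with hh
    · simp only [hh, true_and]
      rw [Finset.sum_boole, Nat.cast_id, ← Set.ncard_coe_finset]
      rw [← Set.ncard_preimage_of_injective_subset_range (f := fun g => h * g) (s := T)
        (mul_right_injective h) (fun t _ => ⟨h⁻¹ * t, by simp⟩)]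
      congr 1
      ext g
      simp
    · simp [hh]
  rw [Finset.sum_congr rfl (fun g _ => h1 g), Finset.sum_comm,
    Finset.sum_congr rfl (fun h _ => h2 h), Finset.sum_ite, Finset.sum_const_zero, add_zero,
    Finset.sum_const, smul_eq_mul, ← Set.ncard_coe_finset]
  congr 1
  have e : Nat.card H = (H : Set G).ncard := rfl
  rw [e]
  congr 1
  ext g
  simp

theorem sum_indicator_subgroup [Fintype G] (H : Subgroup G) (c : ℕ)
    [DecidablePred (· ∈ H)] : ∑ g : G, (if g ∈ H then c else 0) = Nat.card H * c := by
  rw [Finset.sum_ite, Finset.sum_const_zero, add_zero, Finset.sum_const, smul_eq_mul]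
  congr 1
  rw [Nat.card_eq_fintype_card, Fintype.card_subtype]

theorem sum_card_inf_centralizer [Fintype G] (H : Subgroup G) [DecidablePred (· ∈ H)] :
    ∑ g : G, Nat.card (H ⊓ Subgroup.centralizer {g} : Subgroup G) =
      ∑ a : G, if a ∈ H then Nat.card (Subgroup.centralizer {a}) else 0 := by
  classical
  have h1 : ∀ g : G, Nat.card (H ⊓ Subgroup.centralizer {g} : Subgroup G) =
      ∑ a : G, if a ∈ H ∧ Commute g a then 1 else 0 := by
    intro g
    rw [Finset.sum_boole, Nat.cast_id, Nat.card_eq_fintype_card, Fintype.card_subtype]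
    congr 1
    ext a
    simp [Subgroup.mem_inf, mem_centralizer_iff_commute]
  have h2 : ∀ a : G, (∑ g : G, if a ∈ H ∧ Commute g a then 1 else 0) =
      if a ∈ H then Nat.card (Subgroup.centralizer {a}) else 0 := by
    intro a
    split_ifs with ha
    · simp only [ha, true_and]
      rw [Finset.sum_boole, Nat.cast_id, Nat.card_eq_fintype_card, Fintype.card_subtype]
      congr 1
      ext g
      simp [mem_centralizer_iff_commute, Commute.symm_iff (a := g)]
    · simp [ha]
  rw [Finset.sum_congr rfl (fun g _ => h1 g), Finset.sum_comm,
    Finset.sum_congr rfl (fun h _ => h2 h)]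

namespace IsMaximalIn

/-- The average order of the centralizer of an element of `H` exceeds `|G| / 2`. -/
theorem card_mul_card_lt_sum [Fintype G] [DecidablePred (· ∈ H)]
    (hφ : Nat.card G < 2 * (sqSet φ).ncard) (hH : IsMaximalIn φ H) :
    Nat.card H * Nat.card G <
      2 * ∑ a : G, if a ∈ H then Nat.card (Subgroup.centralizer {a}) else 0 := by
  rw [← sum_card_inf_centralizer]
  have h1 := Finset.sum_le_sum (fun g (_ : g ∈ Finset.univ) => hH.ncard_coset_le g)
  rw [sum_ncard_coset] at h1
  have h2 : Nat.card H * Nat.card G < Nat.card H * (2 * (sqSet φ).ncard) :=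
    Nat.mul_lt_mul_of_pos_left hφ Nat.card_pos
  rw [mul_left_comm] at h2
  omega

variable [Finite G]

/-- Outside H each coset is at most half filled. A coset Hg that misses the set entirely would
compensate for the full coset H, leaving at most half of G in total. -/
theorem exists_mul_mem (hφ : Nat.card G < 2 * (sqSet φ).ncard) (hH : IsMaximalIn φ H) (g : G) :
    ∃ h ∈ H, h * g ∈ sqSet φ := by
  classical
  have := Fintype.ofFinite G
  by_contra hne
  push Not at hne
  have hgH : g ∉ H := fun hg => hne g⁻¹ (inv_mem hg) (by simpa using one_mem_sqSet)
  have key : ∀ k : G, 2 * {h : G | h ∈ H ∧ h * k ∈ sqSet φ}.ncard +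
      (if k * g⁻¹ ∈ H then Nat.card H else 0) ≤
        Nat.card H + (if k ∈ H then Nat.card H else 0) := by
    intro k
    by_cases hkg : k * g⁻¹ ∈ H
    · have h0 : {h : G | h ∈ H ∧ h * k ∈ sqSet φ} = ∅ := by
        ext h
        simp only [Set.mem_ofPred_eq, Set.mem_empty_iff_false, iff_false, not_and]
        intro hh hk
        refine hne (h * (k * g⁻¹)) (mul_mem hh hkg) ?_
        convert hk using 1; group
      rw [h0, Set.ncard_empty, if_pos hkg]
      omega
    · rw [if_neg hkg]
      by_cases hk : k ∈ H
      · rw [if_pos hk]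
        have : {h : G | h ∈ H ∧ h * k ∈ sqSet φ}.ncard ≤ (H : Set G).ncard :=
          Set.ncard_le_ncard fun h hh => hh.1
        have e : (H : Set G).ncard = Nat.card H := rfl
        omega
      · have := hH.two_mul_ncard_coset_le hk
        omega
  have h1 := Finset.sum_le_sum (fun k (_ : k ∈ Finset.univ) => key k)
  rw [Finset.sum_add_distrib, Finset.sum_add_distrib, ← Finset.mul_sum, sum_ncard_coset,
    sum_indicator_subgroup, Finset.sum_const, Finset.card_univ, smul_eq_mul,
    Equiv.sum_comp (Equiv.mulRight g⁻¹) (fun k => if k ∈ H then Nat.card H else 0) |> fun h =>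
      (show (∑ k : G, if k * g⁻¹ ∈ H then Nat.card H else 0) = _ from h),
    sum_indicator_subgroup, ← Nat.card_eq_fintype_card] at h1
  have h2 : Nat.card H * Nat.card G < Nat.card H * (2 * (sqSet φ).ncard) :=
    Nat.mul_lt_mul_of_pos_left hφ Nat.card_pos
  rw [mul_left_comm, mul_comm (Nat.card H)] at h2
  omega

/-- H is its own centralizer: move g into the square set by an element of H and use maximality. -/
theorem mem_of_forall_commute (hφ : Nat.card G < 2 * (sqSet φ).ncard) (hH : IsMaximalIn φ H)
    {g : G} (hg : ∀ h ∈ H, Commute h g) : g ∈ H := by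
  obtain ⟨k, hk, hkg⟩ := hH.exists_mul_mem hφ g
  have h1 : k * g ∈ H := hH.mem_of_commute hkg fun h hh => (hH.commute hh hk).mul_right (hg h hh)
  exact (H.mul_mem_cancel_left hk).1 h1

theorem center_le (hφ : Nat.card G < 2 * (sqSet φ).ncard) (hH : IsMaximalIn φ H) :
    Subgroup.center G ≤ H := fun _ hz =>
  hH.mem_of_forall_commute hφ fun _ _ => (commute_of_mem_center hz).symm

end IsMaximalIn
end MaximalSubgroup

/-! ### The second center and the subgroups Z ∪ xZ -/

section SecondCenter
variable {G : Type*} [Group G]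

/-- The second term of the upper central series. -/
def secondCenter (G : Type*) [Group G] : Subgroup G :=
  (Subgroup.center (G ⧸ Subgroup.center G)).comap (QuotientGroup.mk' (Subgroup.center G))

theorem mk_commute_iff {a g : G} :
    Commute (a : G ⧸ Subgroup.center G) (g : G ⧸ Subgroup.center G) ↔
      ⁅a, g⁆ ∈ Subgroup.center G := by
  rw [← commutatorElement_eq_one_iff_commute, ← QuotientGroup.eq_one_iff]
  rfl

theorem mem_secondCenter {a : G} :
    a ∈ secondCenter G ↔ ∀ g, ⁅a, g⁆ ∈ Subgroup.center G := by
  rw [secondCenter, Subgroup.mem_comap, Subgroup.mem_center_iff]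
  constructor
  · intro h g
    exact mk_commute_iff.1 (h g).symm
  · intro h g
    induction g using QuotientGroup.induction_on with
    | H g => exact (mk_commute_iff.2 (h g)).symm

theorem center_le_secondCenter : Subgroup.center G ≤ secondCenter G := fun a ha =>
  mem_secondCenter.2 fun g => by
    rw [commutator_eq_one_of_mem_center ha]; exact one_mem _

/-- The subgroup generated by the center and `x`. -/
def centerAdjoin (x : G) : Subgroup G :=
  (Subgroup.zpowers (x : G ⧸ Subgroup.center G)).comap (QuotientGroup.mk' (Subgroup.center G))

theorem center_le_centerAdjoin (x : G) : Subgroup.center G ≤ centerAdjoin x := fun z hz => by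
  rw [centerAdjoin, Subgroup.mem_comap, QuotientGroup.mk'_apply,
    (QuotientGroup.eq_one_iff z).2 hz]
  exact one_mem _

theorem self_mem_centerAdjoin (x : G) : x ∈ centerAdjoin x :=
  Subgroup.mem_zpowers (x : G ⧸ Subgroup.center G)

theorem mem_centerAdjoin {x g : G} (hx : x ^ 2 ∈ Subgroup.center G) :
    g ∈ centerAdjoin x ↔ g ∈ Subgroup.center G ∨ x * g ∈ Subgroup.center G := by
  have hx2 : (x : G ⧸ Subgroup.center G) ^ 2 = 1 := (QuotientGroup.eq_one_iff (x ^ 2)).2 hx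
  constructor
  · rintro ⟨n, hn⟩
    have hn' : (x : G ⧸ Subgroup.center G) ^ n = (g : G ⧸ Subgroup.center G) := hn
    rcases Int.even_or_odd' n with ⟨m, rfl | rfl⟩
    · left
      rw [← QuotientGroup.eq_one_iff, ← hn', zpow_mul]
      norm_cast
      rw [hx2, one_zpow]
    · right
      rw [← QuotientGroup.eq_one_iff, QuotientGroup.mk_mul, ← hn', zpow_add, zpow_one, zpow_mul]
      norm_cast
      rw [hx2, one_zpow, one_mul, ← pow_two, hx2]
  · rintro (h | h)
    · exact center_le_centerAdjoin x h
    · exact ((centerAdjoin x).mul_mem_cancel_left (self_mem_centerAdjoin x)).1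
        (center_le_centerAdjoin x h)

theorem two_mul_card_center_le [Finite G] {x : G} (hx : x ∉ Subgroup.center G) :
    2 * Nat.card (Subgroup.center G) ≤ Nat.card (centerAdjoin x) :=
  two_mul_card_le_of_lt (lt_of_le_of_ne (center_le_centerAdjoin x)
    fun h => hx (h ▸ self_mem_centerAdjoin x))

theorem centerAdjoin_le {H : Subgroup G} {x : G} (hZ : Subgroup.center G ≤ H) (hx : x ∈ H)
    (hx2 : x ^ 2 ∈ Subgroup.center G) : centerAdjoin x ≤ H := by
  intro g hg
  rcases (mem_centerAdjoin hx2).1 hg with h | h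
  · exact hZ h
  · exact (H.mul_mem_cancel_left hx).1 (hZ h)

theorem four_mul_card_center_le [Finite G] {H : Subgroup G} {x y : G}
    (hZ : Subgroup.center G ≤ H) (hx : x ∈ H) (hy : y ∈ H) (hx2 : x ^ 2 ∈ Subgroup.center G)
    (hxz : x ∉ Subgroup.center G) (hyz : y ∉ Subgroup.center G)
    (hxy : x * y ∉ Subgroup.center G) : 4 * Nat.card (Subgroup.center G) ≤ Nat.card H := by
  have h1 := two_mul_card_center_le hxz
  have h2 := two_mul_card_le_of_lt (lt_of_le_of_ne (centerAdjoin_le hZ hx hx2) fun h => by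
    rcases (mem_centerAdjoin hx2).1 (h ▸ hy) with h | h
    · exact hyz h
    · exact hxy h)
  omega

end SecondCenter

/-! ### From a large maximal subgroup to class 2 -/

section
variable {G : Type*} [Group G] [Finite G] {φ : G →* G} {H : Subgroup G} {x y : G}

theorem card_centralizer_le (a : G) : Nat.card (Subgroup.centralizer {a}) ≤ Nat.card G :=
  Subgroup.card_le_card_group _

theorem two_mul_card_centralizer_le {a : G} (ha : a ∉ Subgroup.center G) :
    2 * Nat.card (Subgroup.centralizer {a}) ≤ Nat.card G :=
  two_mul_card_le_of_ne_top (centralizer_ne_top ha)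

/-- Elements of H outside the second center have centralizers too small for the average of |C(a)|
over H to exceed |G|/2. -/
theorem le_secondCenter_of_four_le (hφ : Nat.card G < 2 * (sqSet φ).ncard)
    (hc : ∀ g, φ g ∈ Subgroup.center G) (hH : IsMaximalIn φ H)
    (h4 : 4 * Nat.card (Subgroup.center G) ≤ Nat.card H) : H ≤ secondCenter G := by
  classical
  have := Fintype.ofFinite G
  have hsq : ∀ a ∈ H, a ^ 2 ∈ Subgroup.center G := fun a ha => sq_mem_center hc (hH.subset ha)
  have hZ := hH.center_le hφ
  have hsum := hH.card_mul_card_lt_sum hφ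
  have hpos : 0 < Nat.card G := Nat.card_pos
  by_contra hnle
  set L := H ⊓ secondCenter G with hL
  have hLH : L < H := lt_of_le_of_ne inf_le_left fun h => hnle (h ▸ inf_le_right)
  have hZL : Subgroup.center G ≤ L := le_inf hZ center_le_secondCenter
  have hn : ∀ a ∈ H, a ∉ L → ¬ ∀ g, ⁅a, g⁆ ∈ Subgroup.center G := fun a ha haL h =>
    haL ⟨ha, mem_secondCenter.2 h⟩
  have hHL := two_mul_card_le_of_lt hLH
  by_cases hLZ : L ≤ Subgroup.center G
  -- Here every non-central element of H has index at least 3, so the average is at most (1/3)(1 +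
  -- 2|Z|/|H|)·|G|, and |H| ≥ 4|Z| makes this at most |G|/2.
  · have key : ∀ a : G, 3 * (if a ∈ H then Nat.card (Subgroup.centralizer {a}) else 0) ≤
        (if a ∈ H then Nat.card G else 0) +
          (if a ∈ Subgroup.center G then 2 * Nat.card G else 0) := by
      intro a
      by_cases ha : a ∈ H
      · rw [if_pos ha, if_pos ha]
        by_cases haz : a ∈ Subgroup.center G
        · rw [if_pos haz]
          have := card_centralizer_le a
          omega
        · have := three_mul_card_centralizer_le (hsq a ha) (hn a ha fun h => haz (hLZ h))
          omega
      · simp [ha]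
    have h1 := Finset.sum_le_sum (fun a (_ : a ∈ Finset.univ) => key a)
    rw [Finset.sum_add_distrib, ← Finset.mul_sum, sum_indicator_subgroup,
      sum_indicator_subgroup] at h1
    have h2 := Nat.mul_le_mul_right (Nat.card G) h4
    have e1 : Nat.card (Subgroup.center G) * (2 * Nat.card G) =
      2 * (Nat.card (Subgroup.center G) * Nat.card G) := by ring
    have e2 : 4 * Nat.card (Subgroup.center G) * Nat.card G =
      4 * (Nat.card (Subgroup.center G) * Nat.card G) := by ring
    rw [e1] at h1
    rw [e2] at h2
    omega
  · obtain ⟨f, hfL, hfz⟩ := SetLike.not_le_iff_exists.1 hLZ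
    have hLZ2 := two_mul_card_le_of_lt (lt_of_le_of_ne hZL fun h => hLZ h.ge)
    set F : G → ℕ := fun a =>
      if a ∈ H ∧ a ∉ L then Nat.card (Subgroup.centralizer {a}) else 0 with hF
    -- Pairing a with af gives an average of at most |G|/4 off L. With |G|/2 on L \ Z and |G| on Z,
    -- the lower bound for the sum becomes |H| < |L| + 2|Z|, against 2|Z| ≤ |L| ≤ |H|/2.
    have pair : ∀ a : G, 2 * (F a + F (a * f)) + (if a ∈ L then Nat.card G else 0) ≤
        if a ∈ H then Nat.card G else 0 := by
      intro a
      have e1 : a * f ∈ H ↔ a ∈ H := H.mul_mem_cancel_right hfL.1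
      have e2 : a * f ∈ L ↔ a ∈ L := L.mul_mem_cancel_right hfL
      simp only [hF, e1, e2]
      by_cases ha : a ∈ H
      · by_cases haL : a ∈ L
        · simp [ha, haL]
        · simp only [ha, haL, not_false_eq_true, and_self, if_true, if_false, add_zero]
          exact two_mul_card_centralizer_add_le (hsq a ha) (hsq f hfL.1) (hH.commute ha hfL.1)
            hfz (mem_secondCenter.1 hfL.2) (hn a ha haL)
      · have haL : a ∉ L := fun h => ha h.1
        simp [ha, haL]
    have key : ∀ a : G, 2 * (if a ∈ H then Nat.card (Subgroup.centralizer {a}) else 0) ≤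
        2 * F a + (if a ∈ L then Nat.card G else 0) +
          (if a ∈ Subgroup.center G then Nat.card G else 0) := by
      intro a
      by_cases ha : a ∈ H
      · by_cases haL : a ∈ L
        · by_cases haz : a ∈ Subgroup.center G
          · have := card_centralizer_le a
            simp only [ha, haL, haz, hF, if_true]
            omega
          · have := two_mul_card_centralizer_le haz
            simp only [ha, haL, haz, hF, if_true, if_false]
            omega
        · simp [hF, ha, haL]
      · simp [ha]
    have h1 := Finset.sum_le_sum (fun a (_ : a ∈ Finset.univ) => pair a)
    have h2 := Finset.sum_le_sum (fun a (_ : a ∈ Finset.univ) => key a)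
    have e3 : ∑ a : G, F (a * f) = ∑ a : G, F a := Equiv.sum_comp (Equiv.mulRight f) F
    rw [Finset.sum_add_distrib, ← Finset.mul_sum, Finset.sum_add_distrib, e3,
      sum_indicator_subgroup, sum_indicator_subgroup] at h1
    rw [Finset.sum_add_distrib, Finset.sum_add_distrib, ← Finset.mul_sum, ← Finset.mul_sum,
      sum_indicator_subgroup, sum_indicator_subgroup] at h2
    have h3 : Nat.card H * Nat.card G + 0 <
        Nat.card L * Nat.card G + 2 * (Nat.card (Subgroup.center G) * Nat.card G) := by
      omega
    have h5 : Nat.card L * Nat.card G + 2 * (Nat.card (Subgroup.center G) * Nat.card G) ≤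
        Nat.card H * Nat.card G := by
      have : Nat.card L + 2 * Nat.card (Subgroup.center G) ≤ Nat.card H := by omega
      calc _ = (Nat.card L + 2 * Nat.card (Subgroup.center G)) * Nat.card G := by ring
        _ ≤ _ := Nat.mul_le_mul_right _ this
    omega

/-- Let N be the non-central part of the square set. By `hstar` no product of two elements of N lies
in N, and N has more than |G|/2 − |Z| elements; this makes the complement of N a subgroup K of index
2. For y ∈ N, conjugation by y sends k ∈ K to φ(k)k⁻¹, so inversion is multiplicative on K. -/
theorem abelian_index_two_of_commuting_products_central (hφ : Nat.card G < 2 * (sqSet φ).ncard)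
    (hc : ∀ g, φ g ∈ Subgroup.center G)
    (hstar : ∀ x ∈ sqSet φ, ∀ y ∈ sqSet φ, Commute x y → x ∉ Subgroup.center G →
      y ∉ Subgroup.center G → x * y ∈ Subgroup.center G)
    (hab : Subgroup.center G ≠ ⊤) :
    ∃ K : Subgroup G, K.index = 2 ∧ ∀ g ∈ K, ∀ h ∈ K, g * h = h * g := by
  obtain ⟨H, hH, -⟩ := exists_isMaximalIn (φ := φ) (S := ∅) (Set.empty_subset _)
    (by simp)
  have hZT : ∀ z ∈ Subgroup.center G, z ∈ sqSet φ := fun z hz => hH.subset (hH.center_le hφ hz)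
  set N : Set G := sqSet φ \ Subgroup.center G with hN
  have hNN : ∀ a ∈ N, ∀ b ∈ N, a * b ∉ N := by
    intro a ha b hb hab
    exact hab.2 (hstar a ha.1 b hb.1 ((mul_mem_sqSet_iff ha.1 hb.1).1 hab.1) ha.2 hb.2)
  have hNinv : ∀ a ∈ N, a⁻¹ ∈ N := fun a ha =>
    ⟨inv_mem_sqSet ha.1, fun h => ha.2 ((inv_mem_iff (H := Subgroup.center G)).1 h)⟩
  have hZN : ∀ z ∈ Subgroup.center G, ∀ a, z * a ∈ N ↔ a ∈ N := by
    have aux : ∀ z ∈ Subgroup.center G, ∀ a ∈ N, z * a ∈ N := fun z hz a ha =>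
      ⟨(mul_mem_sqSet_iff (hZT z hz) ha.1).2 (commute_of_mem_center hz),
        fun h => ha.2 ((Subgroup.mul_mem_cancel_left _ hz).1 h)⟩
    intro z hz a
    refine ⟨fun h => ?_, aux z hz a⟩
    simpa using aux _ (inv_mem hz) _ h
  obtain ⟨y, hy⟩ : N.Nonempty := by
    by_contra hne
    rw [Set.not_nonempty_iff_eq_empty, hN, Set.sdiff_eq_empty] at hne
    exact hab (eq_top_of_two_mul_ncard_gt hne hφ)
  have hTN : (sqSet φ).ncard ≤ N.ncard + Nat.card (Subgroup.center G) := by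
    have e : Nat.card (Subgroup.center G) = (Subgroup.center G : Set G).ncard := rfl
    rw [e]
    refine le_trans (Set.ncard_le_ncard ?_) (Set.ncard_union_le _ _)
    intro t ht
    by_cases h : t ∈ Subgroup.center G
    · exact Or.inr h
    · exact Or.inl ⟨ht, h⟩
  -- If d avoided both N and aN, so would the whole coset of Z ∪ aZ through d, with at least 2|Z|
  -- elements. N and aN are disjoint and would together leave fewer than 2|Z| elements.
  have hdiv : ∀ a ∈ N, ∀ k, k ∉ N → a⁻¹ * k ∈ N := by
    intro a ha d hd
    by_contra had
    have ha2 : a ^ 2 ∈ Subgroup.center G := sq_mem_center hc ha.1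
    set aN : Set G := {g | a⁻¹ * g ∈ N} with haN
    have e1 : aN.ncard = N.ncard := Set.ncard_preimage_of_injective_subset_range
      (f := fun g => a⁻¹ * g) (mul_right_injective _) (fun s _ => ⟨a * s, by simp⟩)
    set D : Set G := {g | g * d⁻¹ ∈ centerAdjoin a} with hD
    have e2 : D.ncard = Nat.card (centerAdjoin a) :=
      Set.ncard_preimage_of_injective_subset_range (s := (centerAdjoin a : Set G))
      (f := fun g => g * d⁻¹) (mul_left_injective _) (fun s _ => ⟨s * d, by simp⟩)
    have d1 : Disjoint N aN := by
      rw [Set.disjoint_left]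
      intro g hg hg'
      exact hNN _ (hNinv a ha) g hg hg'
    have hDN : ∀ g ∈ D, g ∉ N ∧ g ∉ aN := by
      intro g hg
      rcases (mem_centerAdjoin ha2).1 hg with h | h
      · have e : g = (g * d⁻¹) * d := by group
        have e' : a⁻¹ * g = (g * d⁻¹) * (a⁻¹ * d) := by
          rw [← mul_assoc, (commute_of_mem_center h).eq]; group
        refine ⟨fun hgN => hd ?_, fun hgN => had ?_⟩
        · rwa [e, hZN _ h] at hgN
        · rw [haN, Set.mem_ofPred_eq, e', hZN _ h] at hgN
          exact hgN
      · have e : g = (a * (g * d⁻¹)) * (a⁻¹ * d) := by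
          rw [← mul_assoc, (commute_of_mem_center h (g := a⁻¹)).eq]; group
        have e' : a⁻¹ * g = ((a ^ 2)⁻¹ * (a * (g * d⁻¹))) * d := by
          rw [pow_two]; group
        refine ⟨fun hgN => had ?_, fun hgN => hd ?_⟩
        · rwa [e, hZN _ h] at hgN
        · rw [haN, Set.mem_ofPred_eq, e', hZN _ (mul_mem (inv_mem ha2) h)] at hgN
          exact hgN
    have d2 : Disjoint (N ∪ aN) D := by
      rw [Set.disjoint_left]
      rintro g (hg | hg) hgD
      · exact (hDN g hgD).1 hg
      · exact (hDN g hgD).2 hg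
    have h1 : (N ∪ aN ∪ D).ncard ≤ Nat.card G := Set.ncard_le_card _
    rw [Set.ncard_union_eq d2, Set.ncard_union_eq d1, e1, e2] at h1
    have h2 := two_mul_card_center_le ha.2
    omega
  let K : Subgroup G :=
    { carrier := Nᶜ
      one_mem' := fun h => h.2 (one_mem _)
      inv_mem' := fun {k} hk h => hk (by simpa using hNinv _ h)
      mul_mem' := by
        intro k l hk hl
        have hk' : k⁻¹ ∉ N := fun h => hk (by simpa using hNinv _ h)
        have h1 := hNN _ (hNinv _ (hdiv y hy _ hk')) _ (hdiv y hy l hl)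
        intro h
        apply h1
        convert h using 1
        group }
  have memK : ∀ g, g ∈ K ↔ g ∉ N := fun g => Iff.rfl
  refine ⟨K, ?_, ?_⟩
  · rw [Subgroup.index_eq_two_iff]
    refine ⟨y, fun b => ?_⟩
    by_cases hb : b ∈ K
    · refine Or.inr ⟨hb, fun h => ?_⟩
      exact (memK y).1 ((K.mul_mem_cancel_left hb).1 h) hy
    · refine Or.inl ⟨?_, hb⟩
      rw [memK, not_not] at hb
      exact (memK _).2 (hNN b hb y hy)
  · have hconj : ∀ k ∈ K, y⁻¹ * k * y = φ k * k⁻¹ := by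
      intro k hk
      have h1 : y * k ∈ N := by
        have := hdiv _ (hNinv y hy) k hk
        rwa [inv_inv] at this
      have h2 := mem_sqSet.1 h1.1
      rw [map_mul, ← mem_sqSet.1 hy.1] at h2
      have h3 : (y * k) ^ 2 = y * (k * y * k) := by simp [pow_two, mul_assoc]
      rw [h3, pow_two, mul_assoc y y, mul_right_inj] at h2
      rw [eq_mul_inv_iff_mul_eq, mul_assoc, mul_assoc, inv_mul_eq_iff_eq_mul, ← mul_assoc]
      exact h2
    intro g hg h hh
    have h1 := hconj _ (mul_mem hg hh)
    have h2 : y⁻¹ * (g * h) * y = (y⁻¹ * g * y) * (y⁻¹ * h * y) := by group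
    rw [h2, hconj g hg, hconj h hh, map_mul] at h1
    have h3 : φ g * g⁻¹ * (φ h * h⁻¹) = φ g * φ h * (g⁻¹ * h⁻¹) := by
      rw [mul_assoc, ← mul_assoc g⁻¹, ← (commute_of_mem_center (hc h) (g := g⁻¹)).eq]
      group
    rw [h3, mul_right_inj, ← mul_inv_rev, inv_inj] at h1
    exact h1.symm

/-- A non-central x ∈ H commuting with some y in the square set outside the second center would lie
with y in a maximal subgroup of order at least 4|Z|, contrary to `le_secondCenter_of_four_le`.
Cosets Hg outside the second center are thus at most a quarter filled. -/
theorem secondCenter_eq_top_or_abelian_index_two (hφ : Nat.card G < 2 * (sqSet φ).ncard)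
    (hc : ∀ g, φ g ∈ Subgroup.center G) (hH : IsMaximalIn φ H)
    (h4 : 4 * Nat.card (Subgroup.center G) ≤ Nat.card H) :
    secondCenter G = ⊤ ∨
      ∃ K : Subgroup G, K.index = 2 ∧ ∀ g ∈ K, ∀ h ∈ K, g * h = h * g := by
  classical
  have := Fintype.ofFinite G
  have hHZ := le_secondCenter_of_four_le hφ hc hH h4
  by_cases htop : secondCenter G = ⊤
  · exact Or.inl htop
  right
  have hcent : ∀ y ∈ sqSet φ, y ∉ secondCenter G →
      H ⊓ Subgroup.centralizer {y} ≤ Subgroup.center G := by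
    intro y hy hyZ x hx
    by_contra hxz
    have hxy := (mem_centralizer_iff_commute.1 hx.2).symm
    have hxT := hH.subset hx.1
    have hyz : y ∉ Subgroup.center G := fun h => hyZ (center_le_secondCenter h)
    have hxyz : x * y ∉ Subgroup.center G := fun h => hyZ
      (((secondCenter G).mul_mem_cancel_left (hHZ hx.1)).1 (center_le_secondCenter h))
    obtain ⟨M, hM, hsub⟩ := exists_isMaximalIn (φ := φ) (S := {x, y})
      (by rintro t (rfl | rfl) <;> assumption)
      (by
        rintro a (rfl | rfl) b (rfl | rfl)
        · exact Commute.refl _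
        · exact hxy
        · exact hxy.symm
        · exact Commute.refl _)
    have hxM : x ∈ M := hsub (Or.inl rfl)
    have hyM : y ∈ M := hsub (Or.inr rfl)
    exact hyZ (le_secondCenter_of_four_le hφ hc hM (four_mul_card_center_le (hM.center_le hφ)
      hxM hyM (sq_mem_center hc hxT) hxz hyz hxyz) hyM)
  have key : ∀ g : G, 4 * {h : G | h ∈ H ∧ h * g ∈ sqSet φ}.ncard ≤ Nat.card H +
      (if g ∈ secondCenter G then Nat.card H else 0) +
      (if g ∈ H then 2 * Nat.card H else 0) := by
    intro g
    by_cases hg : g ∈ H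
    · rw [if_pos hg, if_pos (hHZ hg)]
      have : {h : G | h ∈ H ∧ h * g ∈ sqSet φ}.ncard ≤ (H : Set G).ncard :=
        Set.ncard_le_ncard fun h hh => hh.1
      have e : (H : Set G).ncard = Nat.card H := rfl
      omega
    · rw [if_neg hg]
      by_cases hgZ : g ∈ secondCenter G
      · rw [if_pos hgZ]
        have := hH.two_mul_ncard_coset_le hg
        omega
      · rw [if_neg hgZ]
        obtain ⟨k, hk, hkg⟩ := hH.exists_mul_mem hφ g
        have h1 := hcent (k * g) hkg fun h =>
          hgZ (((secondCenter G).mul_mem_cancel_left (hHZ hk)).1 h)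
        have h2 : H ⊓ Subgroup.centralizer {g} ≤ Subgroup.center G := by
          intro x hx
          refine h1 (Subgroup.mem_inf.2 ⟨hx.1, ?_⟩)
          rw [mem_centralizer_iff_commute]
          exact (hH.commute hk hx.1).mul_left (mem_centralizer_iff_commute.1 hx.2)
        have h3 := Nat.le_of_dvd Nat.card_pos (Subgroup.card_dvd_of_le h2)
        have h5 := hH.ncard_coset_le g
        omega
  have h1 := Finset.sum_le_sum (fun k (_ : k ∈ Finset.univ) => key k)
  rw [Finset.sum_add_distrib, Finset.sum_add_distrib, ← Finset.mul_sum, sum_ncard_coset,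
    sum_indicator_subgroup, sum_indicator_subgroup, Finset.sum_const, Finset.card_univ,
    smul_eq_mul, ← Nat.card_eq_fintype_card] at h1
  have h2 : 4 * (sqSet φ).ncard ≤
      Nat.card G + Nat.card (secondCenter G) + 2 * Nat.card H := by
    refine Nat.le_of_mul_le_mul_left (c := Nat.card H) ?_ Nat.card_pos
    calc _ = 4 * (Nat.card H * (sqSet φ).ncard) := by ring
      _ ≤ _ := h1
      _ = _ := by ring
  have h3 := two_mul_card_le_of_ne_top htop
  -- The count gives |G| < |Z₂| + 2|H|, where Z₂ is the second center. If H were proper in Z₂ the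
  -- right side would be at most 2|Z₂| ≤ |G|.
  have hHZ' : H = secondCenter G := by
    by_contra hne
    have := two_mul_card_le_of_lt (lt_of_le_of_ne hHZ hne)
    omega
  rw [← hHZ'] at h2 h3 htop
  refine ⟨H, ?_, fun g hg h hh => hH.commute hg hh⟩
  have h5 := H.card_mul_index
  have h6 : H.index ≠ 1 := fun h => htop (Subgroup.index_eq_one.1 h)
  have h7 : H.index ≠ 0 := Subgroup.index_ne_zero_of_finite
  have h8 : H.index < 3 := by
    by_contra hge
    have := mul_card_le_of_index_ge (H := H) (n := 3) (by omega)
    omega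
  omega

end

/-! ### Class 2: commutator maps on a maximal subgroup -/

section ClassTwo
variable {G : Type*} [Group G]

theorem mem_zpowers_of_sq_eq_one {u w : G} (hu : u ^ 2 = 1) :
    w ∈ Subgroup.zpowers u ↔ w = 1 ∨ w = u := by
  constructor
  · rintro ⟨n, rfl⟩
    rcases Int.even_or_odd' n with ⟨m, rfl | rfl⟩
    · left
      simp only [zpow_mul]
      norm_cast
      rw [hu, one_zpow]
    · right
      simp only [zpow_add, zpow_one, zpow_mul]
      norm_cast
      rw [hu, one_zpow, one_mul]
  · rintro (rfl | rfl)
    · exact one_mem _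
    · exact Subgroup.mem_zpowers _

theorem inv_eq_self_of_sq {u : G} (hu : u ^ 2 = 1) : u⁻¹ = u :=
  inv_eq_of_mul_eq_one_left (by rw [← pow_two, hu])

theorem sq_mul_eq {x y : G} (h : ⁅y, x⁆ ∈ Subgroup.center G) :
    (x * y) ^ 2 = ⁅y, x⁆ * (x ^ 2 * y ^ 2) := by
  have h1 : (x * y) ^ 2 = x * ⁅y, x⁆ * x * y * y := by
    simp only [pow_two, commutatorElement_def]; group
  rw [h1, ← (commute_of_mem_center h (g := x)).eq]
  simp only [pow_two, mul_assoc]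

theorem card_le_two_mul_of_cover [Finite G] {A B : Subgroup G} (x : G)
    (h : ∀ b ∈ B, b ∈ A ∨ x * b ∈ A) : Nat.card B ≤ 2 * Nat.card A := by
  have h1 : {b | x * b ∈ A}.ncard = (A : Set G).ncard :=
    Set.ncard_preimage_of_injective_subset_range (s := (A : Set G))
      (f := fun b => x * b) (mul_right_injective _) (fun s _ => ⟨x⁻¹ * s, by simp⟩)
  have h2 : (B : Set G).ncard ≤ ((A : Set G) ∪ {b | x * b ∈ A}).ncard :=
    Set.ncard_le_ncard fun b hb => h b hb
  have h3 := Set.ncard_union_le (A : Set G) {b | x * b ∈ A}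
  have e1 : (A : Set G).ncard = Nat.card A := rfl
  have e2 : (B : Set G).ncard = Nat.card B := rfl
  omega

theorem commutator_eq_of_mul_mem_center {a x : G} (h : a * x ∈ Subgroup.center G)
    (ha : a ^ 2 ∈ Subgroup.center G) (g : G) : ⁅x, g⁆ = ⁅a, g⁆ := by
  have hz : a⁻¹ * a⁻¹ * (a * x) ∈ Subgroup.center G := by
    refine mul_mem ?_ h
    rw [← pow_two, inv_pow]
    exact inv_mem ha
  have hx : x = a * (a⁻¹ * a⁻¹ * (a * x)) := by group
  rw [hx, commutator_mul_left, commutator_eq_one_of_mem_center hz, mul_one]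
  rw [commutator_eq_one_of_mem_center hz]
  exact one_mem _

theorem sq_mem_center_of_sqSet [Finite G] {φ : G →* G} (hcl : ∀ a g : G, ⁅a, g⁆ ∈ Subgroup.center G)
    (hφ : Nat.card G < 2 * (sqSet φ).ncard) (hc : ∀ g, φ g ∈ Subgroup.center G) (g : G) :
    g ^ 2 ∈ Subgroup.center G := by
  let K : Subgroup G :=
    { carrier := {g | g ^ 2 ∈ Subgroup.center G}
      one_mem' := by simp [one_mem]
      inv_mem' := fun {x} hx => by
        change x⁻¹ ^ 2 ∈ Subgroup.center G
        rw [inv_pow]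
        exact inv_mem hx
      mul_mem' := fun {x y} hx hy => by
        change (x * y) ^ 2 ∈ Subgroup.center G
        rw [sq_mul_eq (hcl _ _)]
        exact mul_mem (hcl _ _) (mul_mem hx hy) }
  have hK : K = ⊤ := eq_top_of_two_mul_ncard_gt (fun x hx => sq_mem_center hc hx) hφ
  exact (hK ▸ Subgroup.mem_top g : g ∈ K)

theorem isElementaryAbelianTwo_quotient (hcl : ∀ a g : G, ⁅a, g⁆ ∈ Subgroup.center G)
    (hsq : ∀ g : G, g ^ 2 ∈ Subgroup.center G) :
    IsElementaryAbelianTwo (G ⧸ Subgroup.center G) := by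
  constructor
  · intro q r
    induction q using QuotientGroup.induction_on with
    | H g =>
      induction r using QuotientGroup.induction_on with
      | H h => exact mk_commute_iff.2 (hcl g h)
  · intro q
    induction q using QuotientGroup.induction_on with
    | H g => exact (QuotientGroup.eq_one_iff (g ^ 2)).2 (hsq g)

theorem centralizer_index_le_two_of_forall_mem_zpowers [Finite G]
    (hcl : ∀ a g : G, ⁅a, g⁆ ∈ Subgroup.center G) {a c : G} (hc : c ^ 2 = 1)
    (h : ∀ g, ⁅a, g⁆ ∈ Subgroup.zpowers c) : (Subgroup.centralizer {a}).index ≤ 2 := by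
  rw [← ker_commHom (hcl a), Subgroup.index_ker]
  have h1 : (commHom a (hcl a)).range ≤ Subgroup.zpowers c := by
    rintro _ ⟨g, rfl⟩
    exact h g
  refine (Nat.le_of_dvd Nat.card_pos (Subgroup.card_dvd_of_le h1)).trans ?_
  rw [Nat.card_zpowers]
  exact orderOf_le_of_pow_eq_one (by norm_num) hc

theorem commutator_trichotomy [Finite G] (hcl : ∀ a g : G, ⁅a, g⁆ ∈ Subgroup.center G) {a : G}
    (ha : (Subgroup.centralizer {a}).index ≤ 2) (g h : G) :
    ⁅a, g⁆ = 1 ∨ ⁅a, h⁆ = 1 ∨ ⁅a, g⁆ = ⁅a, h⁆ := by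
  by_cases hg : ⁅a, g⁆ = 1
  · exact Or.inl hg
  by_cases hh : ⁅a, h⁆ = 1
  · exact Or.inr (Or.inl hh)
  right; right
  have hgC : g ∉ Subgroup.centralizer {a} := fun h' =>
    hg (commutatorElement_eq_one_iff_commute.2 (mem_centralizer_iff_commute.1 h'))
  have hhC : h ∉ Subgroup.centralizer {a} := fun h' =>
    hh (commutatorElement_eq_one_iff_commute.2 (mem_centralizer_iff_commute.1 h'))
  have h0 : (Subgroup.centralizer {a}).index ≠ 0 := Subgroup.index_ne_zero_of_finite
  have h1 : (Subgroup.centralizer {a}).index ≠ 1 := fun h' =>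
    hgC (Subgroup.index_eq_one.1 h' ▸ Subgroup.mem_top g)
  have h2 : (Subgroup.centralizer {a}).index = 2 := by omega
  have h3 : g⁻¹ * h ∈ Subgroup.centralizer {a} := by
    rw [Subgroup.mul_mem_iff_of_index_two h2, inv_mem_iff]
    tauto
  have h4 : ⁅a, g * (g⁻¹ * h)⁆ = ⁅a, g⁆ := by
    rw [commutator_mul_right (hcl _ _), commutatorElement_eq_one_iff_commute.2
      (mem_centralizer_iff_commute.1 h3), mul_one]
  rw [← h4, mul_inv_cancel_left]

theorem centralizer_index_ge_four [Finite G] (hcl : ∀ a g : G, ⁅a, g⁆ ∈ Subgroup.center G)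
    (hsq : ∀ g : G, g ^ 2 ∈ Subgroup.center G) {a : G}
    (ha : ¬ (Subgroup.centralizer {a}).index ≤ 2) :
    4 * Nat.card (Subgroup.centralizer {a}) ≤ Nat.card G := by
  have := centralizer_index_ne_three (hsq a) (hcl a)
  exact mul_card_le_of_index_ge (by omega)

theorem centralizer_eq_of_mul_mem_center {a x : G} (h : a * x ∈ Subgroup.center G)
    (ha : a ^ 2 ∈ Subgroup.center G) :
    Subgroup.centralizer {x} = Subgroup.centralizer {a} := by
  ext g
  rw [mem_centralizer_iff_commute, mem_centralizer_iff_commute,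
    ← commutatorElement_eq_one_iff_commute, ← commutatorElement_eq_one_iff_commute,
    commutator_eq_of_mul_mem_center h ha]

theorem commutator_eq_of_forall {D : Subgroup G} (h1 : ∀ g h : G, ⁅g, h⁆ ∈ D)
    (h2 : D ≤ commutator G) : commutator G = D := by
  refine le_antisymm ?_ h2
  rw [commutator_def, Subgroup.commutator_le]
  exact fun g _ h _ => h1 g h

theorem commutatorElement_mem_commutator (g h : G) : ⁅g, h⁆ ∈ commutator G :=
  Subgroup.commutator_mem_commutator (Subgroup.mem_top g) (Subgroup.mem_top h)

variable [Finite G] {φ : G →* G} {H : Subgroup G}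

/-- Index above 2 means at least 4. If aZ and bZ were different cosets of such elements, their
deficit of |G|/4 each against |G|/2 would cancel the surplus |G|/2 on Z, and the average over H
could not exceed |G|/2. -/
theorem mul_mem_center_of_large_index (hcl : ∀ a g : G, ⁅a, g⁆ ∈ Subgroup.center G)
    (hφ : Nat.card G < 2 * (sqSet φ).ncard) (hc : ∀ g, φ g ∈ Subgroup.center G)
    (hH : IsMaximalIn φ H) {a b : G} (ha : a ∈ H) (hb : b ∈ H)
    (hai : ¬ (Subgroup.centralizer {a}).index ≤ 2)
    (hbi : ¬ (Subgroup.centralizer {b}).index ≤ 2) : a * b ∈ Subgroup.center G := by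
  classical
  have := Fintype.ofFinite G
  have hsq := sq_mem_center_of_sqSet hcl hφ hc
  have hZ := hH.center_le hφ
  have hsum := hH.card_mul_card_lt_sum hφ
  by_contra hab
  have hZi : ∀ z ∈ Subgroup.center G, (Subgroup.centralizer {z}).index ≤ 2 := by
    intro z hz
    rw [Subgroup.centralizer_eq_top_iff_subset.2 (Set.singleton_subset_iff.2 hz),
      Subgroup.index_top]
    norm_num
  have large : ∀ c ∈ H, ¬ (Subgroup.centralizer {c}).index ≤ 2 → ∀ x, c * x ∈ Subgroup.center G →
      x ∈ H ∧ x ∉ Subgroup.center G ∧ 4 * Nat.card (Subgroup.centralizer {x}) ≤ Nat.card G := by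
    intro c hcH hci x hx
    have e := centralizer_eq_of_mul_mem_center hx (hsq c)
    refine ⟨(H.mul_mem_cancel_left hcH).1 (hZ hx), fun hxz => hci ?_, ?_⟩
    · rw [← e]; exact hZi x hxz
    · rw [e]; exact centralizer_index_ge_four hcl hsq hci
  have key : ∀ x : G, 4 * (if x ∈ H then Nat.card (Subgroup.centralizer {x}) else 0) +
      (if a * x ∈ Subgroup.center G then Nat.card G else 0) +
      (if b * x ∈ Subgroup.center G then Nat.card G else 0) ≤
        (if x ∈ H then 2 * Nat.card G else 0) +
          (if x ∈ Subgroup.center G then 2 * Nat.card G else 0) := by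
    intro x
    by_cases hax : a * x ∈ Subgroup.center G
    · obtain ⟨hxH, hxz, hx4⟩ := large a ha hai x hax
      have hbx : b * x ∉ Subgroup.center G := by
        intro hbx
        have h1 := mul_mem hax (inv_mem hbx)
        have h2 : a * x * (b * x)⁻¹ * b ^ 2 = a * b := by rw [pow_two]; group
        exact hab (h2 ▸ mul_mem h1 (hsq b))
      simp only [hax, hbx, hxH, hxz, if_true, if_false]
      omega
    · by_cases hbx : b * x ∈ Subgroup.center G
      · obtain ⟨hxH, hxz, hx4⟩ := large b hb hbi x hbx
        simp only [hax, hbx, hxH, hxz, if_true, if_false]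
        omega
      · simp only [hax, hbx, if_false]
        by_cases hxH : x ∈ H
        · by_cases hxz : x ∈ Subgroup.center G
          · have := card_centralizer_le x
            simp only [hxH, hxz, if_true]
            omega
          · have := two_mul_card_centralizer_le hxz
            simp only [hxH, hxz, if_true, if_false]
            omega
        · simp [hxH]
  have h1 := Finset.sum_le_sum (fun k (_ : k ∈ Finset.univ) => key k)
  have e : ∀ c : G, (∑ x : G, if c * x ∈ Subgroup.center G then Nat.card G else 0) =
      Nat.card (Subgroup.center G) * Nat.card G := fun c =>
    (Equiv.sum_comp (Equiv.mulLeft c)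
      (fun x => if x ∈ Subgroup.center G then Nat.card G else 0)).trans
        (sum_indicator_subgroup _ _)
  rw [Finset.sum_add_distrib, Finset.sum_add_distrib, Finset.sum_add_distrib, ← Finset.mul_sum,
    e, e, sum_indicator_subgroup, sum_indicator_subgroup, mul_left_comm _ 2, mul_left_comm _ 2]
    at h1
  omega

/-- For x, y in the square set choose k ∈ H with kxy in it. Then (kxy)² = k²x²y², and expanding the
left side gives [y,x] = [k,xy] ∈ D. As the square set is more than half of G, each argument extends
to all of G. -/
theorem commutator_mem_of_forall_mem (hcl : ∀ a g : G, ⁅a, g⁆ ∈ Subgroup.center G)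
    (hφ : Nat.card G < 2 * (sqSet φ).ncard) (hH : IsMaximalIn φ H) {D : Subgroup G}
    (hD : ∀ a ∈ H, ∀ g, ⁅a, g⁆ ∈ D) (g h : G) : ⁅g, h⁆ ∈ D := by
  have h1 : ∀ x ∈ sqSet φ, ∀ y ∈ sqSet φ, ⁅y, x⁆ ∈ D := by
    intro x hx y hy
    obtain ⟨k, hk, hkT⟩ := hH.exists_mul_mem hφ (x * y)
    have e1 := mem_sqSet.1 hkT
    rw [map_mul, map_mul, ← mem_sqSet.1 hx, ← mem_sqSet.1 hy, ← mem_sqSet.1 (hH.subset hk),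
      sq_mul_eq (hcl _ _), sq_mul_eq (hcl _ _), ← mul_assoc (k ^ 2),
      ← (commute_of_mem_center (hcl y x) (g := k ^ 2)).eq, mul_assoc, ← mul_assoc,
      mul_eq_right, mul_eq_one_iff_inv_eq, commutatorElement_inv] at e1
    rw [← e1]
    exact hD k hk _
  have h2 : ∀ y ∈ sqSet φ, ∀ g, ⁅y, g⁆ ∈ D := by
    intro y hy g
    have : D.comap (commHom y (hcl y)) = ⊤ :=
      eq_top_of_two_mul_ncard_gt (S := sqSet φ) (fun x hx => h1 x hx y hy) hφ
    exact (this ▸ Subgroup.mem_top g : g ∈ D.comap (commHom y (hcl y)))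
  have : D.comap (commHom g (hcl g)) = ⊤ :=
    eq_top_of_two_mul_ncard_gt (S := sqSet φ) (fun x hx => by
      change ⁅g, x⁆ ∈ D
      rw [← commutatorElement_inv]
      exact inv_mem (h2 x hx g)) hφ
  exact (this ▸ Subgroup.mem_top h : h ∈ D.comap (commHom g (hcl g)))

/-- Each a ∈ H has at most one non-trivial commutator value. If all these values agree, that value
generates G'. If two differ, all non-central elements of H share one centralizer, which is then H
itself. -/
theorem abelian_index_two_or_commutator_of_small_index
    (hcl : ∀ a g : G, ⁅a, g⁆ ∈ Subgroup.center G)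
    (hφ : Nat.card G < 2 * (sqSet φ).ncard) (hc : ∀ g, φ g ∈ Subgroup.center G)
    (hab : Subgroup.center G ≠ ⊤)
    (hH : IsMaximalIn φ H) (hsmall : ∀ a ∈ H, (Subgroup.centralizer {a}).index ≤ 2) :
    (∃ K : Subgroup G, K.index = 2 ∧ ∀ g ∈ K, ∀ h ∈ K, g * h = h * g) ∨
      ∃ z : G, orderOf z = 2 ∧ commutator G = Subgroup.zpowers z := by
  have hsq := sq_mem_center_of_sqSet hcl hφ hc
  have hidx : ∀ a ∈ H, a ∉ Subgroup.center G → (Subgroup.centralizer {a}).index = 2 := by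
    intro a ha haz
    have h1 := centralizer_index_ne_one haz
    have h0 : (Subgroup.centralizer {a}).index ≠ 0 := Subgroup.index_ne_zero_of_finite
    have := hsmall a ha
    omega
  by_cases hex : ∃ a ∈ H, ∃ b ∈ H, ∃ g h : G, ⁅a, g⁆ ≠ 1 ∧ ⁅b, h⁆ ≠ 1 ∧ ⁅a, g⁆ ≠ ⁅b, h⁆
  · left
    obtain ⟨a, ha, b, hb, g, h, hag, hbh, hne⟩ := hex
    have noncentral : ∀ {a g : G}, ⁅a, g⁆ ≠ 1 → a ∉ Subgroup.center G := fun hag hz =>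
      hag (commutator_eq_one_of_mem_center hz)
    have same : ∀ {a b g h : G}, a ∈ H → b ∈ H → ⁅a, g⁆ ≠ 1 → ⁅b, h⁆ ≠ 1 → ⁅a, g⁆ ≠ ⁅b, h⁆ →
        Subgroup.centralizer {a} = Subgroup.centralizer {b} := by
      intro a b g h ha hb hag hbh hne
      by_contra hC
      have ia := hidx a ha (noncentral hag)
      have ib := hidx b hb (noncentral hbh)
      have hcard : Nat.card (Subgroup.centralizer {a}) = Nat.card (Subgroup.centralizer {b}) := by
        have e1 := (Subgroup.centralizer {a}).card_mul_index
        have e2 := (Subgroup.centralizer {b}).card_mul_index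
        rw [ia] at e1
        rw [ib] at e2
        omega
      obtain ⟨g₁, h₁a, h₁b⟩ : ∃ g ∈ Subgroup.centralizer {a}, g ∉ Subgroup.centralizer {b} := by
        by_contra hcon
        push Not at hcon
        exact hC (Subgroup.eq_of_le_of_card_ge hcon hcard.ge)
      obtain ⟨g₂, h₂b, h₂a⟩ : ∃ g ∈ Subgroup.centralizer {b}, g ∉ Subgroup.centralizer {a} := by
        by_contra hcon
        push Not at hcon
        exact hC (Subgroup.eq_of_le_of_card_ge hcon hcard.le).symm
      rw [mem_centralizer_iff_commute, ← commutatorElement_eq_one_iff_commute] at h₁a h₁b h₂a h₂b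
      -- At g₁ and g₂ the product ab takes the values of b alone and of a alone. Since C(ab) also
      -- has index at most 2, these non-trivial values must agree.
      have t := commutator_trichotomy hcl (hsmall _ (mul_mem ha hb)) g₁ g₂
      rw [commutator_mul_left (hcl _ _), commutator_mul_left (hcl _ _), h₁a, h₂b, one_mul,
        mul_one] at t
      have t1 := commutator_trichotomy hcl (hsmall _ ha) g g₂
      have t2 := commutator_trichotomy hcl (hsmall _ hb) h g₁
      rcases t with t | t | t
      · exact h₁b t
      · exact h₂a t
      · apply hne
        rw [t1.resolve_left hag |>.resolve_left h₂a, t2.resolve_left hbh |>.resolve_left h₁b, t]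
    have hall : ∀ d ∈ H, d ∉ Subgroup.center G →
        Subgroup.centralizer {d} = Subgroup.centralizer {a} := by
      intro d hd hdz
      obtain ⟨k, hk⟩ : ∃ k : G, ⁅d, k⁆ ≠ 1 := by
        by_contra hcon
        push Not at hcon
        exact hdz (Subgroup.mem_center_iff.2 fun k =>
          (commutatorElement_eq_one_iff_commute.1 (hcon k)).symm)
      by_cases h1 : ⁅d, k⁆ = ⁅a, g⁆
      · have := same hd hb hk hbh (h1 ▸ hne)
        rw [this, same ha hb hag hbh hne]
      · exact same hd ha hk hag h1
    have hHC : H = Subgroup.centralizer {a} := by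
      refine le_antisymm (fun x hx => mem_centralizer_iff_commute.2 (hH.commute ha hx)) ?_
      intro x hx
      refine hH.mem_of_forall_commute hφ fun d hd => ?_
      by_cases hdz : d ∈ Subgroup.center G
      · exact commute_of_mem_center hdz
      · rw [← hall d hd hdz] at hx
        exact mem_centralizer_iff_commute.1 hx
    exact ⟨H, by rw [hHC]; exact hidx a ha (noncentral hag), fun g hg h hh => hH.commute hg hh⟩
  · right
    push Not at hex
    obtain ⟨a, ha, g, hag⟩ : ∃ a ∈ H, ∃ g : G, ⁅a, g⁆ ≠ 1 := by
      by_contra hcon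
      push Not at hcon
      have hHc : H ≤ Subgroup.center G := fun a ha => Subgroup.mem_center_iff.2 fun k =>
        (commutatorElement_eq_one_iff_commute.1 (hcon a ha k)).symm
      apply hab
      rw [eq_top_iff]
      intro k _
      exact hHc (hH.mem_of_forall_commute hφ fun d hd => commute_of_mem_center (hHc hd))
    have hz2 := commutator_sq_eq_one (hsq a) (hcl a g)
    refine ⟨⁅a, g⁆, orderOf_eq_prime hz2 hag, commutator_eq_of_forall ?_ ?_⟩
    · refine commutator_mem_of_forall_mem hcl hφ hH ?_
      intro b hb h
      by_cases hbh : ⁅b, h⁆ = 1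
      · rw [hbh]; exact one_mem _
      · rw [← hex a ha b hb g h hag hbh]
        exact Subgroup.mem_zpowers _
    · rw [Subgroup.zpowers_le]
      exact commutatorElement_mem_commutator _ _

end ClassTwo

/-! ### Structure (ii) from an element with large centralizer index -/

section
variable {G : Type*} [Group G]

theorem commElt_eq_one_iff {x y : G} : commElt x y = 1 ↔ Commute x y := by
  have : commElt x y = ⁅x⁻¹, y⁻¹⁆ := by simp [commElt, commutatorElement_def]
  rw [this, commutatorElement_eq_one_iff_commute]
  exact ⟨fun h => by simpa using h.inv_inv, fun h => h.inv_inv⟩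

theorem commElt_eq_commutatorElement {x y : G} (h : ⁅x, y⁆ ∈ Subgroup.center G) :
    commElt x y = ⁅x, y⁆ := by
  have h1 : commElt x y = (y * x)⁻¹ * (⁅x, y⁆ * (y * x)) := by
    simp only [commElt, commutatorElement_def]; group
  rw [h1, (commute_of_mem_center h).eq, inv_mul_cancel_left]

theorem generateModCenter_iff {k : ℕ} {x a : Fin k → G} :
    GenerateModCenter x a ↔
      Subgroup.closure (Set.range x ∪ Set.range a) ⊔ Subgroup.center G = ⊤ := by
  have h1 : Subgroup.closure (Set.range (fun i => (x i : G ⧸ Subgroup.center G)) ∪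
      Set.range (fun i => (a i : G ⧸ Subgroup.center G))) =
      (Subgroup.closure (Set.range x ∪ Set.range a)).map
        (QuotientGroup.mk' (Subgroup.center G)) := by
    rw [MonoidHom.map_closure, Set.image_union, ← Set.range_comp, ← Set.range_comp]
    rfl
  rw [GenerateModCenter, h1]
  constructor
  · intro h
    have h2 := congrArg (Subgroup.comap (QuotientGroup.mk' (Subgroup.center G))) h
    rwa [Subgroup.comap_map_eq, QuotientGroup.ker_mk', Subgroup.comap_top] at h2
  · intro h
    have h2 := congrArg (Subgroup.map (QuotientGroup.mk' (Subgroup.center G))) h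
    have h3 : (Subgroup.center G).map (QuotientGroup.mk' (Subgroup.center G)) = ⊥ :=
      (Subgroup.map_eq_bot_iff _).2 (by rw [QuotientGroup.ker_mk'])
    rw [Subgroup.map_sup, h3, sup_bot_eq, ← MonoidHom.range_eq_map, QuotientGroup.range_mk'] at h2
    exact h2

/-- Used with p = [d,g₁], q = [d,g₂]; the four trichotomies belong to d, fd, f'd and bd, whose value
pairs are (p,q), (p,uq), (vp,q), (vp,uq). They cannot all have centralizers of index at most 2. -/
theorem pattern_absurd {u v p q : G} (hu : u ^ 2 = 1) (hv : v ^ 2 = 1) (hu1 : u ≠ 1)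
    (hv1 : v ≠ 1) (huv : u ≠ v) (t1 : p = 1 ∨ q = 1 ∨ p = q)
    (t2 : p = 1 ∨ u * q = 1 ∨ p = u * q) (t3 : v * p = 1 ∨ q = 1 ∨ v * p = q)
    (t4 : v * p = 1 ∨ u * q = 1 ∨ v * p = u * q) : False := by
  have hq : u * q = 1 → q = u := fun h => by
    rw [← inv_eq_self_of_sq hu]; exact eq_inv_of_mul_eq_one_right h
  have hp : v * p = 1 → p = v := fun h => by
    rw [← inv_eq_self_of_sq hv]; exact eq_inv_of_mul_eq_one_right h
  replace t2 : p = 1 ∨ q = u ∨ p = u * q := t2.imp_right (Or.imp_left hq)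
  replace t3 : p = v ∨ q = 1 ∨ v * p = q := t3.imp_left hp
  replace t4 : p = v ∨ q = u ∨ v * p = u * q := t4.imp hp (Or.imp_left hq)
  have key1 : p = 1 → False := by
    rintro rfl
    rcases t3 with h | rfl | h
    · exact hv1 h.symm
    · rcases t4 with h | h | h
      · exact hv1 h.symm
      · exact hu1 h.symm
      · exact huv (by simpa using h.symm)
    · rw [mul_one] at h
      subst h
      rcases t4 with h | h | h
      · exact hv1 h.symm
      · exact huv h.symm
      · rw [mul_one] at h
        exact hu1 (by simpa using h.symm)
  have key2 : q = 1 → False := by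
    rintro rfl
    rcases t2 with h | h | h
    · exact key1 h
    · exact hu1 h.symm
    · rw [mul_one] at h
      subst h
      rcases t4 with h | h | h
      · exact huv h
      · exact hu1 h.symm
      · rw [mul_one] at h
        exact hv1 (by simpa using h)
  rcases t1 with h | h | rfl
  · exact key1 h
  · exact key2 h
  · rcases t2 with h | rfl | h
    · exact key1 h
    · rcases t3 with h | h | h
      · exact huv h
      · exact hu1 h
      · exact hv1 (by simpa using h)
    · exact hu1 (by simpa using h.symm)

/-- Any g is brought into C(f) ∩ C(f') by factors from {1, X} and {1, Y}, and `hcov` identifies what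
remains. The order 16 comes from the chain Z < Z ∪ fZ < C(f) ∩ C(f') < C(f) < G, each step of index
2. -/
theorem structureTwo_of_relations [Finite G] (hcl : ∀ a g : G, ⁅a, g⁆ ∈ Subgroup.center G)
    (hsq : ∀ g : G, g ^ 2 ∈ Subgroup.center G) {f f' X Y u v : G} (hu1 : u ≠ 1) (hv1 : v ≠ 1)
    (huv : u ≠ v) (hff : Commute f f') (hXY : Commute X Y) (hfX : ⁅f, X⁆ = u) (hfY : ⁅f, Y⁆ = 1)
    (hfX' : ⁅f', X⁆ = 1) (hfY' : ⁅f', Y⁆ = v) (hf : ∀ g, ⁅f, g⁆ = 1 ∨ ⁅f, g⁆ = u)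
    (hf' : ∀ g, ⁅f', g⁆ = 1 ∨ ⁅f', g⁆ = v)
    (hcov : ∀ g, Commute f g → Commute f' g → g ∈ Subgroup.center G ∨ f * g ∈ Subgroup.center G ∨
      f' * g ∈ Subgroup.center G ∨ f * (f' * g) ∈ Subgroup.center G)
    (hD : ∀ g h : G, ⁅g, h⁆ ∈ Subgroup.zpowers u ⊔ Subgroup.zpowers v) : StructureTwo G := by
  have hu2 : u ^ 2 = 1 := hfX ▸ commutator_sq_eq_one (hsq _) (hcl _ _)
  have hv2 : v ^ 2 = 1 := hfY' ▸ commutator_sq_eq_one (hsq _) (hcl _ _)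
  have huc : u ∈ Subgroup.center G := hfX ▸ hcl _ _
  have step1 : ∀ g, ∃ s ∈ ({1, X} : Set G), Commute f (s * g) ∧ ⁅f', s * g⁆ = ⁅f', g⁆ := by
    intro g
    rcases hf g with h | h
    · exact ⟨1, Or.inl rfl, by simpa using commutatorElement_eq_one_iff_commute.1 h, by simp⟩
    · refine ⟨X, Or.inr rfl, ?_, ?_⟩
      · rw [← commutatorElement_eq_one_iff_commute, commutator_mul_right (hcl _ _), hfX, h,
          ← pow_two, hu2]
      · rw [commutator_mul_right (hcl _ _), hfX', one_mul]
  have step2 : ∀ g, Commute f g →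
      ∃ s ∈ ({1, Y} : Set G), Commute f (s * g) ∧ Commute f' (s * g) := by
    intro g hg
    rcases hf' g with h | h
    · exact ⟨1, Or.inl rfl, by simpa using hg,
        by simpa using commutatorElement_eq_one_iff_commute.1 h⟩
    · refine ⟨Y, Or.inr rfl, ?_, ?_⟩
      · exact (commutatorElement_eq_one_iff_commute.1 hfY).mul_right hg
      · rw [← commutatorElement_eq_one_iff_commute, commutator_mul_right (hcl _ _), hfY', h,
          ← pow_two, hv2]
  set x : Fin 2 → G := ![X, Y] with hx
  set a : Fin 2 → G := ![f, f'] with ha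
  set E := Subgroup.closure (Set.range x ∪ Set.range a) ⊔ Subgroup.center G with hE
  have memE : ∀ s ∈ Set.range x ∪ Set.range a, s ∈ E := fun s hs =>
    Subgroup.mem_sup_left (Subgroup.subset_closure hs)
  have hXE : X ∈ E := memE _ (Or.inl ⟨0, rfl⟩)
  have hYE : Y ∈ E := memE _ (Or.inl ⟨1, rfl⟩)
  have hfE : f ∈ E := memE _ (Or.inr ⟨0, rfl⟩)
  have hfE' : f' ∈ E := memE _ (Or.inr ⟨1, rfl⟩)
  have hZE : Subgroup.center G ≤ E := le_sup_right
  have hEtop : E = ⊤ := by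
    rw [eq_top_iff]
    intro g _
    obtain ⟨s, hs, hs1, -⟩ := step1 g
    obtain ⟨t, ht, ht1, ht2⟩ := step2 _ hs1
    have hsE : s ∈ E := by
      rcases hs with rfl | rfl
      · exact one_mem _
      · exact hXE
    have htE : t ∈ E := by
      rcases ht with rfl | rfl
      · exact one_mem _
      · exact hYE
    rw [← E.mul_mem_cancel_left hsE, ← E.mul_mem_cancel_left htE]
    rcases hcov _ ht1 ht2 with h | h | h | h
    · exact hZE h
    · exact (E.mul_mem_cancel_left hfE).1 (hZE h)
    · exact (E.mul_mem_cancel_left hfE').1 (hZE h)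
    · exact (E.mul_mem_cancel_left hfE').1 ((E.mul_mem_cancel_left hfE).1 (hZE h))
  have hfY0 := commutatorElement_eq_one_iff_commute.1 hfY
  have hfX0 := commutatorElement_eq_one_iff_commute.1 hfX'
  have hcard : Nat.card G = 16 * Nat.card (Subgroup.center G) := by
    have hfz : f ∉ Subgroup.center G := fun h => hu1 (by
      rw [← hfX, commutator_eq_one_of_mem_center h])
    have hfz' : f' ∉ Subgroup.center G := fun h => hv1 (by
      rw [← hfY', commutator_eq_one_of_mem_center h])
    set B := Subgroup.centralizer {f} ⊓ Subgroup.centralizer {f'} with hB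
    have memB : ∀ g, g ∈ B ↔ Commute f g ∧ Commute f' g := fun g => by
      rw [hB, Subgroup.mem_inf, mem_centralizer_iff_commute, mem_centralizer_iff_commute]
    have hfB : f ∈ B := (memB f).2 ⟨Commute.refl _, hff.symm⟩
    have hfB' : f' ∈ B := (memB f').2 ⟨hff, Commute.refl _⟩
    have hZB : Subgroup.center G ≤ B := fun z hz =>
      (memB z).2 ⟨(commute_of_mem_center hz).symm, (commute_of_mem_center hz).symm⟩
    have hBlt : B < Subgroup.centralizer {f} := by
      refine lt_of_le_of_ne inf_le_left fun h => hv1 ?_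
      have hY : Y ∈ B := h ▸ mem_centralizer_iff_commute.2 hfY0
      rw [← hfY']
      exact commutatorElement_eq_one_iff_commute.2 ((memB Y).1 hY).2
    have hffz : f * f' ∉ Subgroup.center G := fun h => hu1 (by
      rw [← commutator_eq_one_of_mem_center h (g := X), commutator_mul_left (hcl _ _), hfX', hfX,
        mul_one])
    have l1 := two_mul_card_le_of_ne_top (centralizer_ne_top hfz)
    have l2 := two_mul_card_le_of_lt hBlt
    have l3 := four_mul_card_center_le hZB hfB hfB' (hsq f) hfz hfz' hffz
    have u1 : Nat.card (⊤ : Subgroup G) ≤ 2 * Nat.card (Subgroup.centralizer {f}) :=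
      card_le_two_mul_of_cover X fun g _ => by
        rw [mem_centralizer_iff_commute, mem_centralizer_iff_commute]
        obtain ⟨s, rfl | rfl, hs1, -⟩ := step1 g
        · exact Or.inl (by simpa using hs1)
        · exact Or.inr hs1
    have u2 : Nat.card (Subgroup.centralizer {f}) ≤ 2 * Nat.card B :=
      card_le_two_mul_of_cover Y fun g hg => by
        obtain ⟨s, rfl | rfl, hs1, hs2⟩ := step2 g (mem_centralizer_iff_commute.1 hg)
        · exact Or.inl ((memB g).2 ⟨by simpa using hs1, by simpa using hs2⟩)
        · exact Or.inr ((memB _).2 ⟨hs1, hs2⟩)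
    have u3 : Nat.card B ≤ 2 * Nat.card (centerAdjoin f) :=
      card_le_two_mul_of_cover f' fun g hg => by
        rw [mem_centerAdjoin (hsq f), mem_centerAdjoin (hsq f)]
        have := hcov g ((memB g).1 hg).1 ((memB g).1 hg).2
        tauto
    have u4 : Nat.card (centerAdjoin f) ≤ 2 * Nat.card (Subgroup.center G) :=
      card_le_two_mul_of_cover f fun g hg => (mem_centerAdjoin (hsq f)).1 hg
    rw [Subgroup.card_top] at u1
    omega
  refine ⟨![u, v], ?_, commute_of_mem_center huc, ?_, ?_, isElementaryAbelianTwo_quotient hcl hsq,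
    ?_, x, a, generateModCenter_iff.2 hEtop, ?_, ?_⟩
  · intro i
    fin_cases i
    · exact orderOf_eq_prime hu2 hu1
    · exact orderOf_eq_prime hv2 hv1
  · change Subgroup.zpowers u ⊓ Subgroup.zpowers v = ⊥
    rw [eq_bot_iff]
    intro w hw
    rw [Subgroup.mem_inf, mem_zpowers_of_sq_eq_one hu2, mem_zpowers_of_sq_eq_one hv2] at hw
    rw [Subgroup.mem_bot]
    rcases hw with ⟨rfl | rfl, h⟩
    · rfl
    · exact h.resolve_right huv
  · refine commutator_eq_of_forall hD (sup_le ?_ ?_)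
    · rw [Subgroup.zpowers_le]
      exact hfX ▸ commutatorElement_mem_commutator _ _
    · rw [Subgroup.zpowers_le]
      exact hfY' ▸ commutatorElement_mem_commutator _ _
  · have h := Subgroup.card_eq_card_quotient_mul_card_subgroup (Subgroup.center G)
    rw [hcard] at h
    exact (Nat.eq_of_mul_eq_mul_right Nat.card_pos h).symm
  · intro i j hij
    simp only [commElt_eq_one_iff]
    fin_cases i <;> fin_cases j
    · exact absurd rfl hij
    · exact ⟨hXY, hff, hfY0⟩
    · exact ⟨hXY.symm, hff.symm, hfX0⟩
    · exact absurd rfl hij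
  · intro i
    rw [commElt_eq_commutatorElement (hcl _ _)]
    fin_cases i
    · exact hfX
    · exact hfY'

/-- [f,·] is constant off its kernel, so if that kernel lies in the kernel of [f',·], both maps
factor through a quotient of order at most 2, and so does their product [b,·]. -/
theorem small_index_of_kernel_le [Finite G] (hcl : ∀ a g : G, ⁅a, g⁆ ∈ Subgroup.center G)
    (hsq : ∀ g : G, g ^ 2 ∈ Subgroup.center G) {b f f' : G}
    (hb : ∀ g : G, ⁅b, g⁆ = ⁅f', g⁆ * ⁅f, g⁆) (hfz : f ∉ Subgroup.center G)
    (hfi : (Subgroup.centralizer {f}).index ≤ 2) (hle : ∀ g : G, ⁅f, g⁆ = 1 → ⁅f', g⁆ = 1) :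
    (Subgroup.centralizer {b}).index ≤ 2 := by
  obtain ⟨k, hk⟩ : ∃ k : G, ⁅f, k⁆ ≠ 1 := by
    by_contra hcon
    push Not at hcon
    exact hfz (Subgroup.mem_center_iff.2 fun k =>
      (commutatorElement_eq_one_iff_commute.1 (hcon k)).symm)
  refine centralizer_index_le_two_of_forall_mem_zpowers hcl (c := ⁅b, k⁆)
    (commutator_sq_eq_one (hsq _) (hcl _ _)) fun g => ?_
  by_cases hg : ⁅f, g⁆ = 1
  · rw [hb g, hg, hle g hg, one_mul]
    exact one_mem _
  · have h1 := (commutator_trichotomy hcl hfi g k).resolve_left hg |>.resolve_left hk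
    have split : ∀ c : G, ⁅c, k⁆ = ⁅c, g⁆ * ⁅c, g⁻¹ * k⁆ := fun c => by
      rw [← commutator_mul_right (hcl _ _), mul_inv_cancel_left]
    have h2 : ⁅f, g⁻¹ * k⁆ = 1 := by
      have := split f
      rw [h1] at this
      simpa using this.symm
    have h3 : ⁅f', k⁆ = ⁅f', g⁆ := by rw [split f', hle _ h2, mul_one]
    rw [hb g, h1, ← h3, ← hb k]
    exact Subgroup.mem_zpowers _

/-- By `mul_mem_center_of_large_index`, bZ is the only coset in H of large index. Writing b as f'f
modulo Z with f, f' of small index, neither kernel of [f,·], [f',·] contains the other; this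
supplies g₁ and g₂ separating them, and H = Z ∪ fZ ∪ f'Z ∪ bZ. -/
theorem structureTwo_of_large_index [Finite G] {φ : G →* G} {H : Subgroup G}
    (hcl : ∀ a g : G, ⁅a, g⁆ ∈ Subgroup.center G)
    (hφ : Nat.card G < 2 * (sqSet φ).ncard) (hc : ∀ g, φ g ∈ Subgroup.center G)
    (hH : IsMaximalIn φ H) {x y b : G} (hx : x ∈ H) (hy : y ∈ H)
    (hxz : x ∉ Subgroup.center G) (hyz : y ∉ Subgroup.center G)
    (hxy : x * y ∉ Subgroup.center G) (hb : b ∈ H)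
    (hbi : ¬ (Subgroup.centralizer {b}).index ≤ 2) : StructureTwo G := by
  have hsq := sq_mem_center_of_sqSet hcl hφ hc
  have hc2 : ∀ a g : G, ⁅a, g⁆ ^ 2 = 1 := fun a g => commutator_sq_eq_one (hsq a) (hcl a g)
  have ofComm : ∀ {a g : G}, ⁅a, g⁆ = 1 → Commute a g := commutatorElement_eq_one_iff_commute.1
  have toComm : ∀ {a g : G}, Commute a g → ⁅a, g⁆ = 1 := commutatorElement_eq_one_iff_commute.2
  have hbb : ∀ g, b * (b * g) ∈ Subgroup.center G ↔ g ∈ Subgroup.center G := fun g => by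
    rw [← mul_assoc, ← pow_two]
    exact Subgroup.mul_mem_cancel_left _ (hsq b)
  have small : ∀ c ∈ H, b * c ∉ Subgroup.center G → (Subgroup.centralizer {c}).index ≤ 2 := by
    intro c hcH hbc
    by_contra hci
    exact hbc (mul_mem_center_of_large_index hcl hφ hc hH hb hcH hbi hci)
  obtain ⟨f, hf, hfz, hbf⟩ : ∃ f ∈ H, f ∉ Subgroup.center G ∧ b * f ∉ Subgroup.center G := by
    by_cases h1 : b * x ∈ Subgroup.center G
    · refine ⟨y, hy, hyz, fun h2 => hxy ?_⟩
      have h3 := mul_mem h1 h2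
      have e : b * x * (b * y) = b * (b * (x * y)) := by
        rw [(hH.commute hb hx).eq]
        simp only [mul_assoc]
        rw [← mul_assoc x b, ← (hH.commute hb hx).eq, mul_assoc, ← mul_assoc x b,
          ← (hH.commute hb hx).eq, mul_assoc]
      rwa [e, hbb] at h3
    · exact ⟨x, hx, hxz, h1⟩
  set f' := b * f with hf'
  have hfH' : f' ∈ H := mul_mem hb hf
  have hfi := small f hf hbf
  have hfi' := small f' hfH' (fun h => hfz ((hbb f).1 h))
  have hfb' : ∀ g, ⁅f', g⁆ = ⁅b, g⁆ * ⁅f, g⁆ := fun g => commutator_mul_left (hcl _ _)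
  have hbff : ∀ g, ⁅b, g⁆ = ⁅f', g⁆ * ⁅f, g⁆ := fun g => by
    rw [hfb', mul_assoc, ← pow_two, hc2, mul_one]
  have hbff' : ∀ g, ⁅b, g⁆ = ⁅f, g⁆ * ⁅f', g⁆ := fun g => by
    rw [hbff, (commute_of_mem_center (hcl f' g)).eq]
  obtain ⟨g₁, h₁, h₁'⟩ : ∃ g : G, ⁅f, g⁆ = 1 ∧ ⁅f', g⁆ ≠ 1 := by
    by_contra hcon
    push Not at hcon
    exact hbi (small_index_of_kernel_le hcl hsq hbff hfz hfi hcon)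
  obtain ⟨g₂, h₂', h₂⟩ : ∃ g : G, ⁅f', g⁆ = 1 ∧ ⁅f, g⁆ ≠ 1 := by
    by_contra hcon
    push Not at hcon
    exact hbi (small_index_of_kernel_le hcl hsq hbff' hbf hfi' hcon)
  set u := ⁅f, g₂⁆ with hu
  set v := ⁅f', g₁⁆ with hv
  have hfu : ∀ g, ⁅f, g⁆ = 1 ∨ ⁅f, g⁆ = u := fun g => by
    rcases commutator_trichotomy hcl hfi g g₂ with h | h | h
    · exact Or.inl h
    · exact absurd h h₂
    · exact Or.inr h
  have hfv : ∀ g, ⁅f', g⁆ = 1 ∨ ⁅f', g⁆ = v := fun g => by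
    rcases commutator_trichotomy hcl hfi' g g₁ with h | h | h
    · exact Or.inl h
    · exact absurd h h₁'
    · exact Or.inr h
  have huv : u ≠ v := by
    intro h
    refine hbi (centralizer_index_le_two_of_forall_mem_zpowers hcl (hc2 f g₂) fun g => ?_)
    rw [hbff]
    refine mul_mem ?_ ?_
    · exact (mem_zpowers_of_sq_eq_one (hc2 _ _)).2 ((hfv g).imp_right fun h' => h'.trans h.symm)
    · exact (mem_zpowers_of_sq_eq_one (hc2 _ _)).2 (hfu g)
  have hcov : ∀ d ∈ H, d ∈ Subgroup.center G ∨ f * d ∈ Subgroup.center G ∨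
      f' * d ∈ Subgroup.center G ∨ b * d ∈ Subgroup.center G := by
    intro d hd
    by_contra hcon
    push Not at hcon
    obtain ⟨n1, n2, n3, n4⟩ := hcon
    have s1 := small d hd n4
    have s2 := small (f * d) (mul_mem hf hd) (by rw [← mul_assoc]; exact n3)
    have s3 := small (f' * d) (mul_mem hfH' hd) (by
      rw [hf', mul_assoc, hbb]; exact n2)
    have s4 := small (b * d) (mul_mem hb hd) (by rw [hbb]; exact n1)
    have t1 := commutator_trichotomy hcl s1 g₁ g₂
    have t2 := commutator_trichotomy hcl s2 g₁ g₂
    have t3 := commutator_trichotomy hcl s3 g₁ g₂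
    have t4 := commutator_trichotomy hcl s4 g₁ g₂
    have mulL : ∀ a g : G, ⁅a * d, g⁆ = ⁅a, g⁆ * ⁅d, g⁆ := fun a g =>
      commutator_mul_left (hcl _ _)
    rw [mulL, mulL] at t2 t3 t4
    rw [h₁, one_mul] at t2
    rw [h₂', one_mul] at t3
    rw [hbff g₁, hbff g₂, h₁, h₂', one_mul, mul_one] at t4
    exact pattern_absurd (hc2 f g₂) (hc2 f' g₁) h₂ h₁' huv t1 t2 t3 t4
  set D := Subgroup.zpowers u ⊔ Subgroup.zpowers v with hD
  have huD : ∀ g, ⁅f, g⁆ ∈ D := fun g =>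
    Subgroup.mem_sup_left ((mem_zpowers_of_sq_eq_one (hc2 _ _)).2 (hfu g))
  have hvD : ∀ g, ⁅f', g⁆ ∈ D := fun g =>
    Subgroup.mem_sup_right ((mem_zpowers_of_sq_eq_one (hc2 _ _)).2 (hfv g))
  have hDall : ∀ g h : G, ⁅g, h⁆ ∈ D := by
    refine commutator_mem_of_forall_mem hcl hφ hH fun d hd g => ?_
    rcases hcov d hd with h | h | h | h
    · rw [commutator_eq_one_of_mem_center h]
      exact one_mem _
    · rw [commutator_eq_of_mul_mem_center h (hsq _)]
      exact huD g
    · rw [commutator_eq_of_mul_mem_center h (hsq _)]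
      exact hvD g
    · rw [commutator_eq_of_mul_mem_center h (hsq _), hbff]
      exact mul_mem (hvD g) (huD g)
  have hnorm : (Subgroup.zpowers u).Normal := by
    refine ⟨fun n hn g => ?_⟩
    have hnc : n ∈ Subgroup.center G :=
      (Subgroup.zpowers_le.2 (hcl f g₂) : Subgroup.zpowers u ≤ _) hn
    rwa [← (commute_of_mem_center hnc (g := g)).eq, mul_inv_cancel_right]
  obtain ⟨s, hs, t, ht, hst⟩ := Subgroup.mem_sup_of_normal_left.1 (hDall g₂ g₁)
  obtain ⟨e, heH, he2, he1⟩ : ∃ e ∈ H, ⁅e, g₂⁆ = s ∧ ⁅e, g₁⁆ = 1 := by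
    rcases (mem_zpowers_of_sq_eq_one (hc2 f g₂)).1 hs with rfl | rfl
    · exact ⟨1, one_mem _, by simp, by simp⟩
    · exact ⟨f, hf, rfl, h₁⟩
  obtain ⟨e', heH', he1', he2'⟩ : ∃ e ∈ H, ⁅e, g₁⁆ = t ∧ ⁅e, g₂⁆ = 1 := by
    rcases (mem_zpowers_of_sq_eq_one (hc2 f' g₁)).1 ht with rfl | rfl
    · exact ⟨1, one_mem _, by simp, by simp⟩
    · exact ⟨f', hfH', rfl, h₂'⟩
  -- The partners g₂ and g₁ need not commute. Multiplying them by elements of H cancels the two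
  -- components of [g₂,g₁] without changing their commutators with f and f'.
  have hst1 : ⁅g₂ * e', g₁ * e⁆ = 1 := by
    have q1 : ⁅g₂, e⁆ = s⁻¹ := by rw [← commutatorElement_inv, he2]
    have ht2 : t * t = 1 := by rw [← pow_two, ← he1', hc2]
    rw [commutator_mul_left (hcl _ _), commutator_mul_right (hcl _ _),
      commutator_mul_right (hcl _ _), toComm (hH.commute heH' heH), ← hst, q1, he1', mul_one]
    have htc : t ∈ Subgroup.center G := he1' ▸ hcl _ _
    rw [mul_assoc s t, (commute_of_mem_center htc).eq]
    rw [mul_inv_cancel_left, ht2]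
  refine structureTwo_of_relations hcl hsq h₂ h₁' huv (hH.commute hf hfH') (ofComm hst1)
    ?_ ?_ ?_ ?_ hfu hfv ?_ hDall
  · rw [commutator_mul_right (hcl _ _), toComm (hH.commute hf heH'), mul_one]
  · rw [commutator_mul_right (hcl _ _), toComm (hH.commute hf heH), mul_one, h₁]
  · rw [commutator_mul_right (hcl _ _), toComm (hH.commute hfH' heH'), mul_one, h₂']
  · rw [commutator_mul_right (hcl _ _), toComm (hH.commute hfH' heH), mul_one]
  · intro g hg hg'
    have hgH : g ∈ H := by
      refine hH.mem_of_forall_commute hφ fun d hd => ofComm ?_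
      rcases hcov d hd with h | h | h | h
      · exact commutator_eq_one_of_mem_center h
      · rw [commutator_eq_of_mul_mem_center h (hsq _), toComm hg]
      · rw [commutator_eq_of_mul_mem_center h (hsq _), toComm hg']
      · rw [commutator_eq_of_mul_mem_center h (hsq _), hbff, toComm hg, toComm hg', one_mul]
    rcases hcov g hgH with h | h | h | h
    · exact Or.inl h
    · exact Or.inr (Or.inl h)
    · exact Or.inr (Or.inr (Or.inl h))
    · refine Or.inr (Or.inr (Or.inr ?_))
      have e1 : f * (f' * g) = f ^ 2 * (b * g) := by
        rw [← mul_assoc, hf', (hH.commute hb hf).eq, pow_two]; group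
      rw [e1]
      exact mul_mem (hsq f) h

end

/-! ### The dichotomy assembled -/

section
variable {G : Type*} [Group G] [Finite G] {φ : G →* G}

theorem abelian_index_two_or_class_two (hφ : Nat.card G < 2 * (sqSet φ).ncard)
    (hc : ∀ g, φ g ∈ Subgroup.center G) (hab : Subgroup.center G ≠ ⊤) :
    (∃ K : Subgroup G, K.index = 2 ∧ ∀ g ∈ K, ∀ h ∈ K, g * h = h * g) ∨
      ((∀ a g : G, ⁅a, g⁆ ∈ Subgroup.center G) ∧ (∀ g : G, g ^ 2 ∈ Subgroup.center G) ∧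
        ((∃ z : G, orderOf z = 2 ∧ commutator G = Subgroup.zpowers z) ∨ StructureTwo G)) := by
  by_cases hstar : ∀ x ∈ sqSet φ, ∀ y ∈ sqSet φ, Commute x y → x ∉ Subgroup.center G →
      y ∉ Subgroup.center G → x * y ∈ Subgroup.center G
  · exact Or.inl (abelian_index_two_of_commuting_products_central hφ hc hstar hab)
  push Not at hstar
  obtain ⟨x, hx, y, hy, hcomm, hxz, hyz, hxy⟩ := hstar
  obtain ⟨H, hH, hS⟩ := exists_isMaximalIn (φ := φ) (S := {x, y})
    (by rintro _ (rfl | rfl) <;> assumption)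
    (by
      rintro _ (rfl | rfl) _ (rfl | rfl)
      · exact Commute.refl _
      · exact hcomm
      · exact hcomm.symm
      · exact Commute.refl _)
  have hxH : x ∈ H := hS (Or.inl rfl)
  have hyH : y ∈ H := hS (Or.inr rfl)
  have h4 := four_mul_card_center_le (hH.center_le hφ) hxH hyH (sq_mem_center hc hx) hxz hyz hxy
  rcases secondCenter_eq_top_or_abelian_index_two hφ hc hH h4 with htop | hK
  · have hcl : ∀ a g : G, ⁅a, g⁆ ∈ Subgroup.center G := fun a =>
      mem_secondCenter.1 (htop ▸ Subgroup.mem_top a)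
    by_cases hsmall : ∀ a ∈ H, (Subgroup.centralizer {a}).index ≤ 2
    · exact (abelian_index_two_or_commutator_of_small_index hcl hφ hc hab hH hsmall).imp_right
        fun h => ⟨hcl, sq_mem_center_of_sqSet hcl hφ hc, Or.inl h⟩
    · push Not at hsmall
      obtain ⟨b, hb, hbi⟩ := hsmall
      exact Or.inr ⟨hcl, sq_mem_center_of_sqSet hcl hφ hc, Or.inr
        (structureTwo_of_large_index hcl hφ hc hH hxH hyH hxz hyz hxy hb (not_le.2 hbi))⟩
  · exact Or.inl hK

theorem abelian_index_two_or_class_two_of_cubeSet {α : G ≃* G}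
    (hα : Nat.card G < 2 * (cubeSet α).ncard) (hab : Subgroup.center G ≠ ⊤) :
    (∃ K : Subgroup G, K.index = 2 ∧ ∀ g ∈ K, ∀ h ∈ K, g * h = h * g) ∨
      ((∀ a g : G, ⁅a, g⁆ ∈ Subgroup.center G) ∧ (∀ g : G, g ^ 2 ∈ Subgroup.center G) ∧
        ((∃ z : G, orderOf z = 2 ∧ commutator G = Subgroup.zpowers z) ∨ StructureTwo G)) := by
  rcases abelian_index_two_or_sq_central hα with h | h
  · exact Or.inl h
  · obtain ⟨φ, hc, hφ⟩ := exists_central_hom hα h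
    exact abelian_index_two_or_class_two (hφ ▸ hα) hc hab

end

/-! ### Structure (i): a symplectic basis -/

section
variable {G : Type*} [Group G] {z : G}

theorem commutator_eq_one_or_of_commutator (hz : z ^ 2 = 1)
    (hD : commutator G = Subgroup.zpowers z) (g h : G) : ⁅g, h⁆ = 1 ∨ ⁅g, h⁆ = z :=
  (mem_zpowers_of_sq_eq_one hz).1 (hD ▸ commutatorElement_mem_commutator g h)

/-- Gram–Schmidt for the commutator form: [x j, ·] is corrected by `a j` and [a j, ·] by `x j`,
neither of which disturbs the other pairs. -/
theorem exists_mul_commute_family (hcl : ∀ a g : G, ⁅a, g⁆ ∈ Subgroup.center G) (hz : z ^ 2 = 1)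
    (hD : ∀ g h : G, ⁅g, h⁆ = 1 ∨ ⁅g, h⁆ = z) {k : ℕ} {x a : Fin k → G}
    (hr : CommutatorRelations x a fun _ => z) {E : Subgroup G} (hx : ∀ i, x i ∈ E)
    (ha : ∀ i, a i ∈ E) (g : G) (s : Finset (Fin k)) :
    ∃ e ∈ E, ∀ i ∈ s, Commute (x i) (e * g) ∧ Commute (a i) (e * g) := by
  have toComm : ∀ {a g : G}, Commute a g → ⁅a, g⁆ = 1 := commutatorElement_eq_one_iff_commute.2
  have ofComm : ∀ {a g : G}, ⁅a, g⁆ = 1 → Commute a g := commutatorElement_eq_one_iff_commute.1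
  have mulR : ∀ a g h : G, ⁅a, g * h⁆ = ⁅a, g⁆ * ⁅a, h⁆ := fun a g h =>
    commutator_mul_right (hcl _ _)
  have hax : ∀ i, ⁅a i, x i⁆ = z := fun i => by
    rw [← commElt_eq_commutatorElement (hcl _ _)]; exact hr.2 i
  have hxa : ∀ i, ⁅x i, a i⁆ = z := fun i => by
    rw [← commutatorElement_inv, hax, inv_eq_self_of_sq hz]
  have hne : ∀ i j, i ≠ j → Commute (x i) (x j) ∧ Commute (a i) (a j) ∧ Commute (a i) (x j) :=
    fun i j hij => by simpa only [commElt_eq_one_iff] using hr.1 i j hij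
  induction s using Finset.induction_on with
  | empty => exact ⟨1, one_mem _, by simp⟩
  | insert j s hj ih =>
    obtain ⟨e, he, hes⟩ := ih
    have hjs : ∀ i ∈ s, i ≠ j := fun i hi h => hj (h ▸ hi)
    obtain ⟨e1, he1, h1, h1s⟩ : ∃ e ∈ E, Commute (x j) (e * g) ∧
        ∀ i ∈ s, Commute (x i) (e * g) ∧ Commute (a i) (e * g) := by
      rcases hD (x j) (e * g) with h | h
      · exact ⟨e, he, ofComm h, hes⟩
      · refine ⟨a j * e, mul_mem (ha j) he, ?_, fun i hi => ?_⟩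
        · exact ofComm (by rw [mul_assoc, mulR, hxa, h, ← pow_two, hz])
        · rw [mul_assoc]
          exact ⟨(hne j i (hjs i hi).symm).2.2.symm.mul_right (hes i hi).1,
            (hne i j (hjs i hi)).2.1.mul_right (hes i hi).2⟩
    rcases hD (a j) (e1 * g) with h | h
    · refine ⟨e1, he1, fun i hi => ?_⟩
      rcases Finset.mem_insert.1 hi with rfl | hi
      · exact ⟨h1, ofComm h⟩
      · exact h1s i hi
    · refine ⟨x j * e1, mul_mem (hx j) he1, fun i hi => ?_⟩
      rw [mul_assoc]
      rcases Finset.mem_insert.1 hi with rfl | hi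
      · exact ⟨(Commute.refl _).mul_right h1, ofComm (by rw [mulR, hax, h, ← pow_two, hz])⟩
      · exact ⟨(hne i j (hjs i hi)).1.mul_right (h1s i hi).1,
          (hne i j (hjs i hi)).2.2.mul_right (h1s i hi).2⟩

/-- An element outside the span, made orthogonal to it, is still non-central, so some h fails to
commute with it; h made orthogonal in turn completes a new pair. -/
theorem exists_commutatorRelations_succ (hcl : ∀ a g : G, ⁅a, g⁆ ∈ Subgroup.center G)
    (hz : z ^ 2 = 1) (hD : ∀ g h : G, ⁅g, h⁆ = 1 ∨ ⁅g, h⁆ = z) {k : ℕ} {x a : Fin k → G}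
    (hr : CommutatorRelations x a fun _ => z) (hgen : ¬ GenerateModCenter x a) :
    ∃ x' a' : Fin (k + 1) → G, CommutatorRelations x' a' fun _ => z := by
  set E := Subgroup.closure (Set.range x ∪ Set.range a) ⊔ Subgroup.center G with hE
  have hxE : ∀ i, x i ∈ E := fun i =>
    Subgroup.mem_sup_left (Subgroup.subset_closure (Or.inl ⟨i, rfl⟩))
  have haE : ∀ i, a i ∈ E := fun i =>
    Subgroup.mem_sup_left (Subgroup.subset_closure (Or.inr ⟨i, rfl⟩))
  have hZE : Subgroup.center G ≤ E := le_sup_right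
  have key := fun g => exists_mul_commute_family hcl hz hD hr hxE haE g Finset.univ
  rw [generateModCenter_iff, ← hE, Subgroup.eq_top_iff'] at hgen
  push Not at hgen
  obtain ⟨g, hg⟩ := hgen
  obtain ⟨e, he, hc⟩ := key g
  set c := e * g with hcdef
  have hcE : c ∉ E := fun h => hg ((E.mul_mem_cancel_left he).1 h)
  obtain ⟨h, hh⟩ : ∃ h : G, ⁅c, h⁆ ≠ 1 := by
    by_contra hcon
    push Not at hcon
    exact hcE (hZE (Subgroup.mem_center_iff.2 fun k =>
      (commutatorElement_eq_one_iff_commute.1 (hcon k)).symm))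
  obtain ⟨e', he', hd⟩ := key h
  have hEc : E ≤ Subgroup.centralizer {c} := by
    refine sup_le ((Subgroup.closure_le _).2 ?_) fun w hw =>
      mem_centralizer_iff_commute.2 (commute_of_mem_center hw).symm
    rintro _ (⟨i, rfl⟩ | ⟨i, rfl⟩)
    · exact mem_centralizer_iff_commute.2 (hc i (Finset.mem_univ _)).1.symm
    · exact mem_centralizer_iff_commute.2 (hc i (Finset.mem_univ _)).2.symm
  have hcd : ⁅c, e' * h⁆ = z := by
    rw [commutator_mul_right (hcl _ _), commutatorElement_eq_one_iff_commute.2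
      (mem_centralizer_iff_commute.1 (hEc he')), one_mul]
    exact (hD c h).resolve_left hh
  set d := e' * h with hddef
  refine ⟨Fin.cons d x, Fin.cons c a, fun i j => ?_, fun i => ?_⟩
  · simp only [commElt_eq_one_iff]
    refine Fin.cases ?_ (fun i => ?_) i <;> refine Fin.cases ?_ (fun j => ?_) j
    · exact fun h => absurd rfl h
    · intro _
      simp only [Fin.cons_zero, Fin.cons_succ]
      exact ⟨(hd j (Finset.mem_univ _)).1.symm, (hc j (Finset.mem_univ _)).2.symm,
        (hc j (Finset.mem_univ _)).1.symm⟩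
    · intro _
      simp only [Fin.cons_zero, Fin.cons_succ]
      exact ⟨(hd i (Finset.mem_univ _)).1, (hc i (Finset.mem_univ _)).2,
        (hd i (Finset.mem_univ _)).2⟩
    · intro hij
      simp only [Fin.cons_succ]
      have := hr.1 i j (fun h => hij (by rw [h]))
      simpa only [commElt_eq_one_iff] using this
  · refine Fin.cases ?_ (fun i => ?_) i
    · simp only [Fin.cons_zero]
      rw [commElt_eq_commutatorElement (hcl _ _), hcd]
    · simp only [Fin.cons_succ]
      exact hr.2 i

theorem structureOne_of_commutator [Finite G] (hcl : ∀ a g : G, ⁅a, g⁆ ∈ Subgroup.center G)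
    (hsq : ∀ g : G, g ^ 2 ∈ Subgroup.center G) (hz : orderOf z = 2)
    (hD : commutator G = Subgroup.zpowers z) : StructureOne G := by
  have hz2 : z ^ 2 = 1 := hz ▸ pow_orderOf_eq_one z
  have hz1 : z ≠ 1 := fun h => by rw [h, orderOf_one] at hz; omega
  refine ⟨z, hz, hD, isElementaryAbelianTwo_quotient hcl hsq, ?_⟩
  by_contra hcon
  push Not at hcon
  have hall : ∀ k : ℕ, ∃ x a : Fin k → G, CommutatorRelations x a fun _ => z := by
    intro k
    induction k with
    | zero => exact ⟨Fin.elim0, Fin.elim0, fun i => i.elim0, fun i => i.elim0⟩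
    | succ k ih =>
      obtain ⟨x, a, hr⟩ := ih
      exact exists_commutatorRelations_succ hcl hz2 (commutator_eq_one_or_of_commutator hz2 hD) hr
        fun hg => hcon k x a hg hr
  obtain ⟨x, a, hr⟩ := hall (Nat.card G + 1)
  -- The process stops because the `x i` are distinct: [a i, x i] = z ≠ 1, whereas [a i, x j] = 1
  -- for j ≠ i.
  have hinj : Function.Injective x := by
    intro i j hij
    by_contra hne
    have h1 := (hr.1 i j hne).2.2
    rw [← hij, hr.2 i] at h1
    exact hz1 h1
  have := Nat.card_le_card_of_injective x hinj
  rw [Nat.card_fin] at this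
  omega

end

/-! ### Passing to a subgroup S with SZ(G) = G -/

section
variable {G : Type*} [Group G] {S : Subgroup G}

theorem exists_mul_mem_center (hS : S ⊔ Subgroup.center G = ⊤) (g : G) :
    ∃ s ∈ S, ∃ w ∈ Subgroup.center G, g = s * w := by
  obtain ⟨s, hs, w, hw, h⟩ := Subgroup.mem_sup_of_normal_right.1 (hS ▸ Subgroup.mem_top g)
  exact ⟨s, hs, w, hw, h.symm⟩

theorem mem_center_of_sup_center (hS : S ⊔ Subgroup.center G = ⊤) {s : S} :
    s ∈ Subgroup.center S ↔ (s : G) ∈ Subgroup.center G := by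
  simp only [Subgroup.mem_center_iff]
  constructor
  · intro h g
    obtain ⟨t, ht, w, hw, rfl⟩ := exists_mul_mem_center hS g
    have h1 : Commute t (s : G) := congrArg Subtype.val (h ⟨t, ht⟩)
    exact h1.mul_left (commute_of_mem_center hw)
  · intro h t
    exact Subtype.ext (h t)

theorem commutatorElement_mul_center {s t v w : G} (hv : v ∈ Subgroup.center G)
    (hw : w ∈ Subgroup.center G) : ⁅s * v, t * w⁆ = ⁅s, t⁆ := by
  have h1 : ∀ g : G, ⁅v, g⁆ = 1 := fun g => commutator_eq_one_of_mem_center hv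
  have h2 : ⁅s, w⁆ = 1 :=
    commutatorElement_eq_one_iff_commute.2 (commute_of_mem_center hw).symm
  rw [commutator_mul_left (by rw [h1]; exact one_mem _), h1, mul_one,
    commutator_mul_right (by rw [h2]; exact one_mem _), h2, mul_one]

theorem commutator_eq_map (hS : S ⊔ Subgroup.center G = ⊤) :
    commutator G = (commutator S).map S.subtype := by
  refine commutator_eq_of_forall (fun g h => ?_) ?_
  · obtain ⟨s, hs, v, hv, rfl⟩ := exists_mul_mem_center hS g
    obtain ⟨t, ht, w, hw, rfl⟩ := exists_mul_mem_center hS h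
    rw [commutatorElement_mul_center hv hw]
    exact ⟨⁅⟨s, hs⟩, ⟨t, ht⟩⁆, commutatorElement_mem_commutator _ _, rfl⟩
  · rw [commutator_def, commutator_def, Subgroup.map_commutator]
    exact Subgroup.commutator_mono le_top le_top

theorem structureOne_subgroup [Finite G] (hS : S ⊔ Subgroup.center G = ⊤)
    (hcl : ∀ a g : G, ⁅a, g⁆ ∈ Subgroup.center G) (hsq : ∀ g : G, g ^ 2 ∈ Subgroup.center G)
    {z : G} (hz : orderOf z = 2) (hD : commutator G = Subgroup.zpowers z) : StructureOne S := by
  have hzm : z ∈ (commutator S).map S.subtype := by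
    rw [← commutator_eq_map hS, hD]; exact Subgroup.mem_zpowers z
  obtain ⟨w, -, rfl⟩ := hzm
  refine structureOne_of_commutator (z := w) (fun a g => ?_) (fun g => ?_) ?_ ?_
  · exact (mem_center_of_sup_center hS).2 (hcl a g)
  · exact (mem_center_of_sup_center hS).2 (hsq g)
  · rw [← hz]; exact (Subgroup.orderOf_coe w).symm
  · rw [commutator_eq_map hS, ← MonoidHom.map_zpowers] at hD
    exact Subgroup.map_injective S.subtype_injective hD

theorem structureTwo_subgroup [Finite G] (hS : S ⊔ Subgroup.center G = ⊤)
    (hcl : ∀ a g : G, ⁅a, g⁆ ∈ Subgroup.center G) (hsq : ∀ g : G, g ^ 2 ∈ Subgroup.center G)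
    (h : StructureTwo G) : StructureTwo S := by
  obtain ⟨z, hz, hzc, hinf, hD, -, hcard, x, a, hgen, hr⟩ := h
  have hzm : ∀ i, ∃ w : S, (w : G) = z i := by
    intro i
    have : z i ∈ (commutator S).map S.subtype := by
      rw [← commutator_eq_map hS, hD]
      fin_cases i
      · exact Subgroup.mem_sup_left (Subgroup.mem_zpowers _)
      · exact Subgroup.mem_sup_right (Subgroup.mem_zpowers _)
    obtain ⟨w, -, hw⟩ := this
    exact ⟨w, hw⟩
  choose w hw using hzm
  have hfam : ∀ f : Fin 2 → G, ∃ f' : Fin 2 → S, ∀ i, ∃ v ∈ Subgroup.center G, f i = f' i * v := by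
    intro f
    choose s hs v hv h using fun i => exists_mul_mem_center hS (f i)
    exact ⟨fun i => ⟨s i, hs i⟩, fun i => ⟨v i, hv i, h i⟩⟩
  obtain ⟨x', hx'⟩ := hfam x
  obtain ⟨a', ha'⟩ := hfam a
  have hclS : ∀ a g : S, ⁅a, g⁆ ∈ Subgroup.center S := fun a g =>
    (mem_center_of_sup_center hS).2 (hcl a g)
  have hsqS : ∀ g : S, g ^ 2 ∈ Subgroup.center S := fun g =>
    (mem_center_of_sup_center hS).2 (hsq g)
  have hcomm : ∀ {f g : G} {s t : S}, (∃ v ∈ Subgroup.center G, f = s * v) →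
      (∃ v ∈ Subgroup.center G, g = t * v) → ((commElt s t : S) : G) = commElt f g := by
    rintro f g s t ⟨v, hv, rfl⟩ ⟨v', hv', rfl⟩
    rw [commElt_eq_commutatorElement (hclS _ _), commElt_eq_commutatorElement (hcl _ _),
      commutatorElement_mul_center hv hv']
    rfl
  have hmapz : ∀ i, (Subgroup.zpowers (w i)).map S.subtype = Subgroup.zpowers (z i) := fun i => by
    rw [MonoidHom.map_zpowers, ← hw i]; rfl
  refine ⟨w, fun i => ?_, ?_, ?_, ?_, isElementaryAbelianTwo_quotient hclS hsqS, ?_, x', a', ?_,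
    fun i j hij => ?_, fun i => ?_⟩
  · rw [← hz i, ← hw i, Subgroup.orderOf_coe]
  · refine Subtype.ext ?_
    simpa [hw] using hzc.eq
  · refine Subgroup.map_injective S.subtype_injective ?_
    rw [Subgroup.map_inf _ _ _ S.subtype_injective, hmapz, hmapz, hinf, Subgroup.map_bot]
  · refine Subgroup.map_injective S.subtype_injective ?_
    rw [Subgroup.map_sup, hmapz, hmapz, ← hD, commutator_eq_map hS]
  · have h1 : Subgroup.center S = (Subgroup.center G).subgroupOf S := by
      ext s
      rw [Subgroup.mem_subgroupOf, mem_center_of_sup_center hS]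
    change (Subgroup.center S).index = 16
    rw [h1]
    change (Subgroup.center G).relIndex S = 16
    rw [← Subgroup.relIndex_sup_right, hS, Subgroup.relIndex_top_right]
    exact hcard
  · rw [generateModCenter_iff] at hgen ⊢
    set E := Subgroup.closure (Set.range x' ∪ Set.range a') ⊔ Subgroup.center S with hE
    have hEtop : E.map S.subtype ⊔ Subgroup.center G = ⊤ := by
      rw [eq_top_iff, ← hgen]
      refine sup_le ((Subgroup.closure_le _).2 ?_) le_sup_right
      rintro _ (⟨i, rfl⟩ | ⟨i, rfl⟩)
      · obtain ⟨v, hv, h⟩ := hx' i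
        rw [h]
        exact Subgroup.mul_mem_sup ⟨x' i, Subgroup.mem_sup_left
          (Subgroup.subset_closure (Or.inl ⟨i, rfl⟩)), rfl⟩ hv
      · obtain ⟨v, hv, h⟩ := ha' i
        rw [h]
        exact Subgroup.mul_mem_sup ⟨a' i, Subgroup.mem_sup_left
          (Subgroup.subset_closure (Or.inr ⟨i, rfl⟩)), rfl⟩ hv
    rw [Subgroup.eq_top_iff']
    intro s
    obtain ⟨_, ⟨e, he, rfl⟩, v, hv, h⟩ := exists_mul_mem_center hEtop (s : G)
    have hv' : v = ((e⁻¹ * s : S) : G) := by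
      rw [Subgroup.coe_mul, h]; simp
    have : e⁻¹ * s ∈ E :=
      Subgroup.mem_sup_right ((mem_center_of_sup_center hS).2 (hv' ▸ hv))
    simpa using mul_mem he this
  · obtain ⟨h1, h2, h3⟩ := hr.1 i j hij
    refine ⟨Subtype.ext ?_, Subtype.ext ?_, Subtype.ext ?_⟩
    · rw [hcomm (hx' i) (hx' j), h1]; rfl
    · rw [hcomm (ha' i) (ha' j), h2]; rfl
    · rw [hcomm (ha' i) (hx' j), h3]; rfl
  · refine Subtype.ext ?_
    rw [hcomm (ha' i) (hx' i), hr.2 i, hw]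

end

/-! ### Sylow subgroups and the three types -/

section
variable {G : Type*} [Group G] [Finite G]

theorem eq_top_of_sylow_le {H : Subgroup G}
    (h : ∀ p : ℕ, p.Prime → ∃ Q : Sylow p G, (Q : Subgroup G) ≤ H) : H = ⊤ := by
  rw [← Subgroup.index_eq_one]
  by_contra hi
  obtain ⟨p, hp, hpd⟩ := Nat.exists_prime_and_dvd hi
  obtain ⟨Q, hQ⟩ := h p hp
  have : Fact p.Prime := ⟨hp⟩
  exact Q.not_dvd_index (hpd.trans (Subgroup.index_dvd_of_le hQ))

theorem orderOf_coprime_of_mem_sylow {G : Type*} [Group G] {p n : ℕ} (hp : p.Prime)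
    (hn : n.Prime) (hpn : p ≠ n) {Q : Sylow p G} {g : G} (hg : g ∈ Q) : (orderOf g).Coprime n := by
  obtain ⟨k, hk⟩ := Q.isPGroup' ⟨g, hg⟩
  have h1 : g ^ p ^ k = 1 := congrArg Subtype.val hk
  exact Nat.Coprime.coprime_dvd_left (orderOf_dvd_of_pow_eq_one h1)
    (((Nat.coprime_primes hp hn).2 hpn).pow_left k)

theorem mem_of_pow_mem_of_coprime {G : Type*} [Group G] {H : Subgroup G} {g : G} {n : ℕ}
    (h : (orderOf g).Coprime n) (hg : g ^ n ∈ H) : g ∈ H :=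
  Subgroup.zpowers_le.2 hg (mem_zpowers_pow_of_coprime h)

theorem exists_orderOf_eq_prime_of_isPGroup {Q : Subgroup G} {p : ℕ} (hp : p.Prime)
    (hQ : IsPGroup p Q) (hne : Q ≠ ⊥) : ∃ g ∈ Q, orderOf g = p := by
  have : Fact p.Prime := ⟨hp⟩
  obtain ⟨n, hn⟩ := IsPGroup.iff_card.1 hQ
  have hn0 : n ≠ 0 := by
    rintro rfl
    exact hne (Subgroup.eq_bot_of_card_eq _ (by simpa using hn))
  obtain ⟨g, hg⟩ := exists_prime_orderOf_dvd_card' (G := Q) p (hn ▸ dvd_pow_self p hn0)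
  exact ⟨g, g.2, by rw [Subgroup.orderOf_coe, hg]⟩

theorem sylow_sup_center_eq_top_of_sq (hsq : ∀ g : G, g ^ 2 ∈ Subgroup.center G)
    (S : Sylow 2 G) : (S : Subgroup G) ⊔ Subgroup.center G = ⊤ := by
  refine eq_top_of_sylow_le fun p hp => ?_
  by_cases h2 : p = 2
  · subst h2
    exact ⟨S, le_sup_left⟩
  · refine ⟨default, fun g hg => Subgroup.mem_sup_right ?_⟩
    exact mem_of_pow_mem_of_coprime (orderOf_coprime_of_mem_sylow hp Nat.prime_two h2 hg) (hsq g)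

/-- The odd Sylow subgroups are central: each is abelian, and in a nilpotent group it commutes with
the Sylow subgroups for other primes. -/
theorem sylow_sup_center_eq_top_of_nilpotent [Group.IsNilpotent G]
    (hodd : ∀ p : ℕ, p.Prime → 2 < p → ∀ P : Sylow p G, ∀ g ∈ P, ∀ h ∈ P, g * h = h * g)
    (S : Sylow 2 G) : (S : Subgroup G) ⊔ Subgroup.center G = ⊤ := by
  have hnorm : ∀ (p : ℕ) (_ : Fact p.Prime) (P : Sylow p G), (P : Subgroup G).Normal :=
    ((Group.isNilpotent_of_finite_tfae (G := G)).out 0 3).1 ‹_›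
  refine eq_top_of_sylow_le fun p hp => ?_
  by_cases h2 : p = 2
  · subst h2
    exact ⟨S, le_sup_left⟩
  · refine ⟨default, fun g hg => Subgroup.mem_sup_right ?_⟩
    have hcent : Subgroup.centralizer {g} = ⊤ := by
      refine eq_top_of_sylow_le fun q hq => ?_
      have : Fact p.Prime := ⟨hp⟩
      have : Fact q.Prime := ⟨hq⟩
      by_cases hqp : q = p
      · subst hqp
        refine ⟨default, fun h hh => mem_centralizer_iff_commute.2 ?_⟩
        exact hodd q hq (lt_of_le_of_ne hq.two_le (Ne.symm h2)) default g hg h hh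
      · refine ⟨default, fun h hh => mem_centralizer_iff_commute.2 ?_⟩
        exact Subgroup.commute_of_normal_of_disjoint _ _ (hnorm p ‹_› default)
          (hnorm q ‹_› default) (IsPGroup.disjoint_of_ne p q (Ne.symm hqp) _ _
            (Sylow.isPGroup' default) (Sylow.isPGroup' default)) g h hg hh
    exact Subgroup.mem_center_iff.2 fun h =>
      ((mem_centralizer_iff_commute.1 (hcent ▸ Subgroup.mem_top h)).eq).symm

theorem upperCentralSeries_two_eq_top_iff {G : Type*} [Group G] :
    Subgroup.upperCentralSeries G 2 = ⊤ ↔ ∀ a g : G, ⁅a, g⁆ ∈ Subgroup.center G := by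
  rw [Subgroup.eq_top_iff']
  simp only [Subgroup.mem_upperCentralSeries_succ_iff, Subgroup.upperCentralSeries_one]

theorem nilpotencyClass_eq_two {G : Type*} [Group G]
    (hcl : ∀ a g : G, ⁅a, g⁆ ∈ Subgroup.center G) (hab : Subgroup.center G ≠ ⊤) :
    Group.IsNilpotent G ∧ Group.nilpotencyClass G = 2 := by
  have htop := upperCentralSeries_two_eq_top_iff.2 hcl
  have : Group.IsNilpotent G := ⟨2, htop⟩
  refine ⟨this, le_antisymm (Subgroup.upperCentralSeries_eq_top_iff_nilpotencyClass_le.1 htop) ?_⟩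
  by_contra hlt
  refine hab ?_
  rw [← Subgroup.upperCentralSeries_one]
  exact Subgroup.upperCentralSeries_eq_top_iff_nilpotencyClass_le.2 (by omega)

theorem typeIII_of_class_two {α : G ≃* G} (hα : Nat.card G < 2 * (cubeSet α).ncard)
    (hab : Subgroup.center G ≠ ⊤) (hcl : ∀ a g : G, ⁅a, g⁆ ∈ Subgroup.center G)
    (hsq : ∀ g : G, g ^ 2 ∈ Subgroup.center G)
    (hstr : (∃ z : G, orderOf z = 2 ∧ commutator G = Subgroup.zpowers z) ∨ StructureTwo G) :
    TypeIII G := by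
  obtain ⟨hn, hc2⟩ := nilpotencyClass_eq_two hcl hab
  refine ⟨hn, hc2, ?_, ?_, default, ?_⟩
  · rw [Nat.coprime_comm, Nat.Prime.coprime_iff_not_dvd Nat.prime_three]
    intro h3
    have : Fact (Nat.Prime 3) := ⟨Nat.prime_three⟩
    obtain ⟨g, hg⟩ := exists_prime_orderOf_dvd_card' (G := G) 3 h3
    have hg3 : g ^ 3 = 1 := hg ▸ pow_orderOf_eq_one g
    have hgz : g ∈ Subgroup.center G :=
      mem_of_pow_mem_of_coprime (n := 2) (by rw [hg]; decide) (hsq g)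
    rw [eq_one_of_central_of_cube_eq_one hα hgz hg3, orderOf_one] at hg
    omega
  · intro p hp h2 P g hg h _
    exact (commute_of_mem_center (mem_of_pow_mem_of_coprime
      (orderOf_coprime_of_mem_sylow hp Nat.prime_two h2.ne' hg) (hsq g))).eq
  · have hS := sylow_sup_center_eq_top_of_sq hsq default
    rcases hstr with ⟨z, hz, hD⟩ | h
    · exact Or.inl (structureOne_subgroup hS hcl hsq hz hD)
    · exact Or.inr (structureTwo_subgroup hS hcl hsq h)

/-- Squares lie in K, so elements of 3-power order do. The abelian K normalizes S, leaving at most 2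
Sylow 3-subgroups; their number is 1 modulo 3, so S is normal. -/
theorem typeII_of_abelian_index_two (hnab : ¬ ∀ g h : G, g * h = h * g)
    (hK : ∃ K : Subgroup G, K.index = 2 ∧ ∀ g ∈ K, ∀ h ∈ K, g * h = h * g)
    (h3 : ∀ z ∈ Subgroup.center G, z ^ 3 = 1 → z = 1) : TypeII G := by
  obtain ⟨K, hi, hKab⟩ := hK
  have : Fact (Nat.Prime 3) := ⟨Nat.prime_three⟩
  let S : Sylow 3 G := default
  have hSK : (S : Subgroup G) ≤ K := fun g hg => mem_of_pow_mem_of_coprime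
    (orderOf_coprime_of_mem_sylow Nat.prime_three Nat.prime_two (by decide) hg)
    (Subgroup.sq_mem_of_index_two hi g)
  refine ⟨hnab, S, ?_, ⟨K, hSK, hi, hKab⟩, ?_⟩
  · have hKN : K ≤ Subgroup.normalizer (S : Set G) := by
      intro k hk
      change k ∈ Subgroup.normalizer ((S : Subgroup G) : Set G)
      rw [Subgroup.mem_normalizer_iff]
      intro s
      constructor
      · intro hs
        rw [hKab k hk s (hSK hs), mul_inv_cancel_right]
        exact hs
      · intro hs
        have h1 := hKab _ (inv_mem hk) _ (hSK hs)
        have h2 : s = k * s * k⁻¹ := by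
          calc s = k⁻¹ * (k * s * k⁻¹) * k := by group
            _ = k * s * k⁻¹ := by rw [h1]; group
        rw [h2]
        exact hs
    have hd : (Subgroup.normalizer (S : Set G)).index ∣ 2 := hi ▸ Subgroup.index_dvd_of_le hKN
    have hm := card_sylow_modEq_one 3 G
    rw [S.card_eq_index_normalizer] at hm
    have h1 : (Subgroup.normalizer (S : Set G)).index = 1 := by
      rcases (Nat.dvd_prime Nat.prime_two).1 hd with h | h
      · exact h
      · rw [h] at hm
        exact absurd hm (by decide)
    exact Subgroup.normalizer_eq_top_iff.1 (Subgroup.index_eq_one.1 h1)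
  · by_contra hne
    obtain ⟨g, hg, ho⟩ := exists_orderOf_eq_prime_of_isPGroup Nat.prime_three
      (S.isPGroup'.to_le inf_le_left) hne
    have := h3 g hg.2 (ho ▸ pow_orderOf_eq_one g)
    rw [this, orderOf_one] at ho
    omega

theorem TypeII.eq_one_of_central (h : TypeII G) {z : G} (hz : z ∈ Subgroup.center G)
    (h3 : z ^ 3 = 1) : z = 1 := by
  have : Fact (Nat.Prime 3) := ⟨Nat.prime_three⟩
  obtain ⟨-, S, hS, -, hbot⟩ := h
  have hp : IsPGroup 3 (Subgroup.zpowers z) := by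
    rintro ⟨_, n, rfl⟩
    refine ⟨1, Subtype.ext ?_⟩
    change (z ^ n) ^ 3 = 1
    rw [← zpow_natCast, ← zpow_mul, mul_comm, zpow_mul, zpow_natCast, h3, one_zpow]
  obtain ⟨Q, hQ⟩ := hp.exists_le_sylow
  have := Sylow.unique_of_normal S hS
  rw [Subsingleton.elim Q S] at hQ
  have : z ∈ (S : Subgroup G) ⊓ Subgroup.center G :=
    Subgroup.mem_inf.2 ⟨hQ (Subgroup.mem_zpowers z), hz⟩
  rwa [hbot, Subgroup.mem_bot] at this

/-! ### Automorphisms for types I and II -/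

theorem exists_cubing_of_injective (f : G →* G) (hf : Function.Injective f)
    (h : Nat.card G < 2 * {g : G | f g = g ^ 3}.ncard) :
    ∃ α : G ≃* G, Nat.card G < 2 * (cubeSet α).ncard :=
  ⟨MulEquiv.ofBijective f (Finite.injective_iff_bijective.1 hf), h⟩

theorem exists_cubing_of_abelian (hab : ∀ g h : G, g * h = h * g) (h3 : (Nat.card G).Coprime 3) :
    ∃ α : G ≃* G, Nat.card G < 2 * (cubeSet α).ncard := by
  refine exists_cubing_of_injective
    (MonoidHom.mk' (fun g => g ^ 3) fun g h => Commute.mul_pow (hab g h) 3) ?_ ?_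
  · rw [injective_iff_map_eq_one]
    intro g hg
    have h1 : orderOf g ∣ 3 := orderOf_dvd_of_pow_eq_one hg
    have h2 := Nat.dvd_gcd (orderOf_dvd_natCard g) h1
    rw [h3.gcd_eq_one, Nat.dvd_one] at h2
    exact orderOf_eq_one_iff.1 h2
  · have : {g : G | MonoidHom.mk' (fun g : G => g ^ 3)
        (fun g h => Commute.mul_pow (hab g h) 3) g = g ^ 3} = Set.univ := by
      ext g; simp
    rw [this, Set.ncard_univ]
    have := Nat.card_pos (α := G)
    omega

/-- For k ∈ K and g ∉ K, (kg)³ = k²·xkx⁻¹·g³, since g acts on K as x does and g² acts trivially.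
This dictates F on K. The complement of K, exactly half of G, is cubed; the identity supplies the
strict inequality. -/
theorem exists_cubing_of_abelian_index_two {K : Subgroup G} (hi : K.index = 2)
    (hKab : ∀ g ∈ K, ∀ h ∈ K, g * h = h * g)
    (h3 : ∀ z ∈ Subgroup.center G, z ^ 3 = 1 → z = 1) :
    ∃ α : G ≃* G, Nat.card G < 2 * (cubeSet α).ncard := by
  classical
  have hmem := fun {a b : G} => Subgroup.mul_mem_iff_of_index_two hi (a := a) (b := b)
  have hn : K.Normal := Subgroup.normal_of_index_eq_two hi
  obtain ⟨x, hx⟩ : ∃ x, x ∉ K := by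
    by_contra hcon
    push Not at hcon
    rw [(Subgroup.eq_top_iff' K).2 hcon, Subgroup.index_top] at hi
    omega
  have hconj : ∀ {k : G}, k ∈ K → ∀ g, g * k * g⁻¹ ∈ K := fun hk g => hn.conj_mem _ hk g
  have hindep : ∀ {g k : G}, g ∉ K → k ∈ K → g * k * g⁻¹ = x * k * x⁻¹ := by
    intro g k hg hk
    have h1 : x⁻¹ * g ∈ K := hmem.2 (by simp [hg, hx])
    calc g * k * g⁻¹ = x * (x⁻¹ * g * k) * g⁻¹ := by group
      _ = x * (k * (x⁻¹ * g)) * g⁻¹ := by rw [hKab _ h1 _ hk]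
      _ = x * k * x⁻¹ := by group
  have hsq2 : ∀ {g k : G}, k ∈ K → g ^ 2 * k * (g ^ 2)⁻¹ = k := by
    intro g k hk
    rw [hKab _ (Subgroup.sq_mem_of_index_two hi g) _ hk, mul_inv_cancel_right]
  let F : G → G := fun g => if g ∈ K then g ^ 2 * (x * g * x⁻¹) else g ^ 3
  have FK : ∀ {g}, g ∈ K → F g = g ^ 2 * (x * g * x⁻¹) := fun h => if_pos h
  have Fn : ∀ {g}, g ∉ K → F g = g ^ 3 := fun h => if_neg h
  have cube : ∀ {k g : G}, k ∈ K → g ∉ K → (k * g) ^ 3 = k ^ 2 * (x * k * x⁻¹) * g ^ 3 := by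
    intro k g hk hg
    calc (k * g) ^ 3 = k * (g * k * g⁻¹) * (g ^ 2 * k * (g ^ 2)⁻¹) * g ^ 3 := by
          simp only [pow_succ, pow_zero, one_mul]; group
      _ = k * ((x * k * x⁻¹) * k) * g ^ 3 := by rw [hindep hg hk, hsq2 hk]; group
      _ = k ^ 2 * (x * k * x⁻¹) * g ^ 3 := by rw [hKab _ (hconj hk x) _ hk, pow_two]; group
  have Fmul : ∀ g h, F (g * h) = F g * F h := by
    intro g h
    by_cases hg : g ∈ K <;> by_cases hh : h ∈ K
    · rw [FK hg, FK hh, FK (mul_mem hg hh), Commute.mul_pow (hKab g hg h hh)]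
      have e1 : x * (g * h) * x⁻¹ = (x * g * x⁻¹) * (x * h * x⁻¹) := by group
      rw [e1]
      calc g ^ 2 * h ^ 2 * (x * g * x⁻¹ * (x * h * x⁻¹))
          = g ^ 2 * (h ^ 2 * (x * g * x⁻¹)) * (x * h * x⁻¹) := by simp only [mul_assoc]
        _ = g ^ 2 * ((x * g * x⁻¹) * h ^ 2) * (x * h * x⁻¹) := by
          rw [hKab _ (pow_mem hh 2) _ (hconj hg x)]
        _ = _ := by simp only [mul_assoc]
    · rw [FK hg, Fn hh, Fn (by rw [hmem]; tauto), cube hg hh]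
    · rw [Fn hg, FK hh, Fn (by rw [hmem]; tauto)]
      have e1 : g * h = (g * h * g⁻¹) * g := by group
      rw [e1, cube (hconj hh g) hg, ← hindep hg (hconj hh g)]
      have e2 : g * (g * h * g⁻¹) * g⁻¹ = h := by
        conv_rhs => rw [← hsq2 (g := g) hh, pow_two]
        group
      have e3 : g ^ 3 * (h ^ 2 * (x * h * x⁻¹)) =
          (g ^ 3 * (h ^ 2 * (x * h * x⁻¹)) * (g ^ 3)⁻¹) * g ^ 3 := by group
      have hg3 : g ^ 3 ∉ K := by
        rw [pow_succ, hmem]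
        have := Subgroup.sq_mem_of_index_two hi g
        tauto
      rw [e2, e3, hindep hg3 (mul_mem (pow_mem hh 2) (hconj hh x)), hindep hg hh]
      have e4 : x * (h ^ 2 * (x * h * x⁻¹)) * x⁻¹ = (x * h * x⁻¹) ^ 2 * (x ^ 2 * h * (x ^ 2)⁻¹) := by
        rw [conj_pow]; group
      rw [e4, hsq2 hh]
    · have hk : g * h ∈ K := by rw [hmem]; tauto
      have e0 : h = g⁻¹ * (g * h) := by group
      rw [FK hk, Fn hg, Fn hh]
      generalize g * h = k at hk e0
      subst e0
      calc k ^ 2 * (x * k * x⁻¹) = k * (x * k * x⁻¹) * k := by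
            rw [mul_assoc k, hKab _ (hconj hk x) _ hk, pow_two]; group
        _ = (g ^ 2 * k * (g ^ 2)⁻¹) * (g * k * g⁻¹) * k := by rw [hsq2 hk, hindep hg hk]
        _ = g ^ 3 * (g⁻¹ * k) ^ 3 := by simp only [pow_succ, pow_zero, one_mul]; group
  refine exists_cubing_of_injective (MonoidHom.mk' F Fmul) ?_ ?_
  · rw [injective_iff_map_eq_one]
    intro g hg
    change F g = 1 at hg
    by_cases hgK : g ∈ K
    · rw [FK hgK] at hg
      have s1 : x * g * x⁻¹ = (g ^ 2)⁻¹ := eq_inv_of_mul_eq_one_right hg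
      -- Conjugation by x sends g to g⁻², and doing it twice is trivial on K. So g⁴ = g, and g is a
      -- central element of order dividing 3.
      have s2 : g = ((g ^ 2)⁻¹ ^ 2)⁻¹ := by
        calc g = x ^ 2 * g * (x ^ 2)⁻¹ := (hsq2 hgK).symm
          _ = x * (x * g * x⁻¹) * x⁻¹ := by rw [pow_two]; group
          _ = ((x * g * x⁻¹) ^ 2)⁻¹ := by rw [s1, ← s1, conj_pow, s1]; group
          _ = _ := by rw [s1]
      have s3 : g ^ 3 = 1 := by
        have : g ^ 4 = g := by conv_rhs => rw [s2]
                               group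
        calc g ^ 3 = g ^ 4 * g⁻¹ := by group
          _ = 1 := by rw [this, mul_inv_cancel]
      have s4 : x * g * x⁻¹ = g := by
        rw [s1, inv_eq_iff_mul_eq_one, ← pow_succ, s3]
      refine h3 g (Subgroup.mem_center_iff.2 fun h => ?_) s3
      by_cases hh : h ∈ K
      · exact hKab h hh g hgK
      · rw [← mul_inv_eq_iff_eq_mul, hindep hh hgK, s4]
    · rw [Fn hgK] at hg
      have := Subgroup.sq_mem_of_index_two hi g
      have h4 : g ^ 3 ∈ K := hg ▸ one_mem K
      rw [pow_succ, hmem] at h4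
      exact absurd (h4.1 this) hgK
  · have hsub : insert 1 ((K : Set G)ᶜ) ⊆ {g : G | MonoidHom.mk' F Fmul g = g ^ 3} := by
      rintro g (rfl | hg)
      · change F 1 = 1 ^ 3
        rw [FK (one_mem K)]; group
      · exact Fn hg
    have h1 := Set.ncard_le_ncard hsub (Set.toFinite _)
    rw [Set.ncard_insert_of_notMem (fun h : (1 : G) ∈ (K : Set G)ᶜ => h (one_mem K))] at h1
    have h2 := ncard_compl_subgroup K
    have h4 := K.card_mul_index
    rw [hi] at h4
    omega

end

/-! ### Automorphisms for type III -/

section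
variable {G : Type*} [Group G]

theorem commute_of_mem_closure {S : Set G} (h : ∀ a ∈ S, ∀ b ∈ S, Commute a b) {a b : G}
    (ha : a ∈ Subgroup.closure S) (hb : b ∈ Subgroup.closure S) : Commute a b := by
  have h1 : ∀ c ∈ S, Subgroup.closure S ≤ Subgroup.centralizer {c} := fun c hc =>
    (Subgroup.closure_le _).2 fun d hd => mem_centralizer_iff_commute.2 (h c hc d hd)
  have h2 : Subgroup.closure S ≤ Subgroup.centralizer {b} := (Subgroup.closure_le _).2 fun c hc =>
    mem_centralizer_iff_commute.2 (mem_centralizer_iff_commute.1 (h1 c hc hb)).symm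
  exact (mem_centralizer_iff_commute.1 (h2 ha)).symm

theorem commute_of_mem_closure_range_union_center {ι : Type*} {f : ι → G}
    (h : ∀ i j, Commute (f i) (f j)) {a b : G}
    (ha : a ∈ Subgroup.closure (Set.range f ∪ Subgroup.center G))
    (hb : b ∈ Subgroup.closure (Set.range f ∪ Subgroup.center G)) : Commute a b := by
  refine commute_of_mem_closure ?_ ha hb
  rintro _ (⟨i, rfl⟩ | ha) _ (⟨j, rfl⟩ | hb)
  · exact h i j
  · exact (commute_of_mem_center hb).symm
  · exact commute_of_mem_center ha
  · exact commute_of_mem_center ha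

theorem mul_cubes_of_central {g h p r s t : G} (hp : p ∈ Subgroup.center G)
    (hs : s ∈ Subgroup.center G) (ht : t ∈ Subgroup.center G)
    (hs2 : s ^ 2 = 1) (ht2 : t ^ 2 = 1) :
    t * s * (g * h) * (p * s * (t * r)) = g * p * (h * r) := by
  have cp := fun y => (commute_of_mem_center (g := y) hp).eq
  have cs := fun y => (commute_of_mem_center (g := y) hs).eq
  have ct := fun y => (commute_of_mem_center (g := y) ht).eq
  rw [pow_two] at hs2 ht2
  calc t * s * (g * h) * (p * s * (t * r)) = t * (s * (g * h * p)) * s * t * r := by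
        simp only [mul_assoc]
    _ = t * (g * (h * p)) * (s * s) * t * r := by rw [cs]; simp only [mul_assoc]
    _ = (t * (g * (h * p))) * t * r := by rw [hs2, mul_one]
    _ = g * (h * p) * (t * t) * r := by rw [ct]; simp only [mul_assoc]
    _ = g * p * (h * r) := by rw [ht2, mul_one, ← cp]; simp only [mul_assoc]

variable [Finite G]

/-- Set q(ax) = [a,x]. Neither cubing nor q is multiplicative, but for g = ax and h = by the defect
of each is [b,x][a,y], so g ↦ g³q(g) is a homomorphism. It cubes ax exactly when a and x commute. -/
theorem exists_cubing_of_factorization {A X D : Subgroup G}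
    (hcl : ∀ a g : G, ⁅a, g⁆ ∈ Subgroup.center G) (hD : ∀ a g : G, ⁅a, g⁆ ∈ D)
    (hD2 : ∀ d ∈ D, d ^ 2 = 1) (h3 : (Nat.card G).Coprime 3)
    (hA : ∀ {a b}, a ∈ A → b ∈ A → Commute a b) (hX : ∀ {a b}, a ∈ X → b ∈ X → Commute a b)
    (hZA : Subgroup.center G ≤ A) (hAX : ∀ g, ∃ a ∈ A, ∃ x ∈ X, a * x = g)
    (hcount : Nat.card A * Nat.card X <
      2 * Nat.card {p : A × X // Commute (p.1 : G) (p.2 : G)}) :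
    ∃ α : G ≃* G, Nat.card G < 2 * (cubeSet α).ncard := by
  have toComm : ∀ {a g : G}, Commute a g → ⁅a, g⁆ = 1 := commutatorElement_eq_one_iff_commute.2
  have mulL : ∀ a b g : G, ⁅a * b, g⁆ = ⁅a, g⁆ * ⁅b, g⁆ := fun a b g =>
    commutator_mul_left (hcl _ _)
  have mulR : ∀ a g h : G, ⁅a, g * h⁆ = ⁅a, g⁆ * ⁅a, h⁆ := fun a g h =>
    commutator_mul_right (hcl _ _)
  have hc2 : ∀ a g : G, ⁅a, g⁆ ^ 2 = 1 := fun a g => hD2 _ (hD a g)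
  have hswap : ∀ a g : G, ⁅a, g⁆ = ⁅g, a⁆ := fun a g => by
    rw [← commutatorElement_inv, inv_eq_self_of_sq (hc2 _ _)]
  choose fa hfa fx hfx hf using hAX
  have hcen : ∀ c, c ∈ A → c ∈ X → c ∈ Subgroup.center G := fun c hcA hcX =>
    Subgroup.mem_center_iff.2 fun g => by
      rw [← hf g]
      exact ((hA hcA (hfa g)).mul_right (hX hcX (hfx g))).eq.symm
  have hfc : ∀ a ∈ A, ∀ x ∈ X, (fa (a * x))⁻¹ * a ∈ A ∧ (fa (a * x))⁻¹ * a ∈ X ∧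
      x = ((fa (a * x))⁻¹ * a)⁻¹ * fx (a * x) := by
    intro a ha x hx
    have e : fa (a * x) * fx (a * x) = a * x := hf _
    have e1 : (fa (a * x))⁻¹ * a = fx (a * x) * x⁻¹ := by
      rw [inv_mul_eq_iff_eq_mul, ← mul_assoc, e, mul_inv_cancel_right]
    refine ⟨mul_mem (inv_mem (hfa _)) ha, e1 ▸ mul_mem (hfx _) (inv_mem hx), ?_⟩
    rw [e1]; group
  let q : G → G := fun g => ⁅fa g, fx g⁆
  have hqc : ∀ g, q g ∈ Subgroup.center G := fun g => hcl _ _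
  have hq2 : ∀ g, q g ^ 2 = 1 := fun g => hc2 _ _
  -- Independence of the chosen factorization: two factorizations differ by an element of A ∩ X,
  -- which is central because A and X are abelian with product G.
  have hq : ∀ a ∈ A, ∀ x ∈ X, q (a * x) = ⁅a, x⁆ := by
    intro a ha x hx
    obtain ⟨h1, h2, h3⟩ := hfc a ha x hx
    have hc := hcen _ h1 h2
    change ⁅fa (a * x), fx (a * x)⁆ = ⁅a, x⁆
    set c := (fa (a * x))⁻¹ * a with hcdef
    have ea : a = fa (a * x) * c := by rw [hcdef, mul_inv_cancel_left]
    conv_rhs => rw [h3, (commute_of_mem_center (inv_mem hc)).eq, ea]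
    rw [commutatorElement_mul_center hc (inv_mem hc), ← ea]
  have hqmul : ∀ g h, (g * h) ^ 3 * q (g * h) = g ^ 3 * q g * (h ^ 3 * q h) := by
    intro g h
    obtain ⟨a, ha, x, hx, rfl⟩ : ∃ a ∈ A, ∃ x ∈ X, a * x = g := ⟨_, hfa g, _, hfx g, hf g⟩
    obtain ⟨b, hb, y, hy, rfl⟩ : ∃ a ∈ A, ∃ x ∈ X, a * x = h := ⟨_, hfa h, _, hfx h, hf h⟩
    have e1 : a * x * (b * y) = (a * b * ⁅x, b⁆) * (x * y) := by
      have : x * b = ⁅x, b⁆ * (b * x) := by rw [commutatorElement_def]; group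
      calc a * x * (b * y) = a * (x * b) * y := by simp only [mul_assoc]
        _ = a * (b * x * ⁅x, b⁆) * y := by rw [this, (commute_of_mem_center (hcl x b)).eq]
        _ = a * b * (x * ⁅x, b⁆) * y := by simp only [mul_assoc]
        _ = _ := by rw [← (commute_of_mem_center (hcl x b) (g := x)).eq]; simp only [mul_assoc]
    have e2 : q (a * x * (b * y)) = ⁅a, x⁆ * ⁅a, y⁆ * (⁅b, x⁆ * ⁅b, y⁆) := by
      rw [e1, hq _ (mul_mem (mul_mem ha hb) (hZA (hcl _ _))) _ (mul_mem hx hy)]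
      have := commutatorElement_mul_center (s := a * b) (t := x * y) (hcl x b)
        (one_mem (Subgroup.center G))
      rw [mul_one] at this
      rw [this, mulL, mulR, mulR]
    have e3 : ⁅b * y, a * x⁆ = ⁅b, x⁆ * ⁅a, y⁆ := by
      rw [mulL, mulR, mulR, toComm (hA hb ha), toComm (hX hy hx), one_mul, mul_one, hswap y a]
    have e4 : (a * x * (b * y)) ^ 3 = ⁅b, x⁆ * ⁅a, y⁆ * ((a * x) ^ 3 * (b * y) ^ 3) := by
      have hcomm : Commute ((b * y) ^ 2) (a * x) := by
        rw [← commutatorElement_eq_one_iff_commute, pow_two, mulL, ← pow_two, hc2]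
      rw [pow_succ, sq_mul_eq (hcl _ _), e3]
      generalize a * x = g at hcomm ⊢
      generalize b * y = h at hcomm ⊢
      calc ⁅b, x⁆ * ⁅a, y⁆ * (g ^ 2 * h ^ 2) * (g * h)
          = ⁅b, x⁆ * ⁅a, y⁆ * (g ^ 2 * (h ^ 2 * g) * h) := by simp only [mul_assoc]
        _ = _ := by rw [hcomm.eq]; simp only [pow_succ, mul_assoc]
    rw [e4, e2, hq a ha x hx, hq b hb y hy]
    exact mul_cubes_of_central (hcl _ _) (hcl _ _) (hcl _ _) (hc2 _ _) (hc2 _ _)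
  refine exists_cubing_of_injective (MonoidHom.mk' (fun g => g ^ 3 * q g) hqmul) ?_ ?_
  · rw [injective_iff_map_eq_one]
    intro g hg
    change g ^ 3 * q g = 1 at hg
    -- In the kernel g³ = q(g) has order at most 2, so g⁶ = 1 and g² = 1 by coprimality to 3. Then g
    -- = q(g) is central, and q vanishes on the center.
    have hg3 : g ^ 3 = q g := by
      rw [← inv_eq_self_of_sq (hq2 g)]; exact eq_inv_of_mul_eq_one_left hg
    have h6 : (g ^ 2) ^ 3 = 1 := by
      rw [← pow_mul, mul_comm, pow_mul, hg3, hq2]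
    have h1 : orderOf (g ^ 2) ∣ 3 := orderOf_dvd_of_pow_eq_one h6
    have h2 := Nat.dvd_gcd (orderOf_dvd_natCard (g ^ 2)) h1
    rw [h3.gcd_eq_one, Nat.dvd_one, orderOf_eq_one_iff] at h2
    have hgz : g ∈ Subgroup.center G := by
      have : g = q g := by rw [← hg3, pow_succ, h2, one_mul]
      rw [this]; exact hqc g
    have hqg : q g = 1 := by
      have := hq g (hZA hgz) 1 (one_mem _)
      rwa [mul_one, commutatorElement_one_right] at this
    rw [← hg3, pow_succ, h2, one_mul] at hqg
    exact hqg
  · have hT : {g : G | MonoidHom.mk' (fun g => g ^ 3 * q g) hqmul g = g ^ 3} =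
        {g | q g = 1} := by
      ext g
      change g ^ 3 * q g = g ^ 3 ↔ q g = 1
      exact mul_eq_left
    rw [hT, ← Nat.card_coe_set_eq]
    -- Each g has |A ∩ X| factorizations, so proportions among pairs (a, x) are proportions in G;
    -- `i1` and `i2` are the two inequalities needed for this.
    have i1 : Nat.card {p : A × X // Commute (p.1 : G) (p.2 : G)} ≤
        Nat.card ({g | q g = 1} × (A ⊓ X : Subgroup G)) := by
      refine Nat.card_le_card_of_injective (fun p => (⟨p.1.1 * p.1.2,
        (hq _ p.1.1.2 _ p.1.2.2).trans (toComm p.2)⟩, ⟨(fa (p.1.1 * p.1.2))⁻¹ * p.1.1,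
        (hfc _ p.1.1.2 _ p.1.2.2).1, (hfc _ p.1.1.2 _ p.1.2.2).2.1⟩)) ?_
      rintro ⟨⟨⟨a, ha⟩, ⟨x, hx⟩⟩, hp⟩ ⟨⟨⟨b, hb⟩, ⟨y, hy⟩⟩, hp'⟩ h
      simp only [Prod.mk.injEq, Subtype.mk.injEq] at h ⊢
      obtain ⟨h1, h2⟩ := h
      replace h2 : (fa (a * x))⁻¹ * a = (fa (b * y))⁻¹ * b := congrArg Subtype.val h2
      rw [h1, mul_right_inj] at h2
      subst h2
      exact ⟨rfl, mul_left_cancel h1⟩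
    have i2 : Nat.card (G × (A ⊓ X : Subgroup G)) ≤ Nat.card (A × X) := by
      refine Nat.card_le_card_of_injective (fun p => (⟨fa p.1 * p.2,
        mul_mem (hfa _) p.2.2.1⟩, ⟨(p.2 : G)⁻¹ * fx p.1,
        mul_mem (inv_mem p.2.2.2) (hfx _)⟩)) ?_
      rintro ⟨g, ⟨c, hc⟩⟩ ⟨h, ⟨d, hd⟩⟩ heq
      simp only [Prod.mk.injEq, Subtype.mk.injEq] at heq ⊢
      obtain ⟨h1, h2⟩ := heq
      have hgh : g = h := by
        rw [← hf g, ← hf h]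
        calc fa g * fx g = (fa g * c) * (c⁻¹ * fx g) := by group
          _ = (fa h * d) * (d⁻¹ * fx h) := by rw [h1, h2]
          _ = _ := by group
      subst hgh
      exact ⟨rfl, mul_left_cancel h1⟩
    rw [Nat.card_prod] at i1
    rw [Nat.card_prod, Nat.card_prod] at i2
    refine Nat.lt_of_mul_lt_mul_right (a := Nat.card (A ⊓ X : Subgroup G)) ?_
    calc Nat.card G * Nat.card (A ⊓ X : Subgroup G) ≤ Nat.card A * Nat.card X := i2
      _ < 2 * Nat.card {p : A × X // Commute (p.1 : G) (p.2 : G)} := hcount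
      _ ≤ _ := by rw [mul_assoc]; exact Nat.mul_le_mul_left 2 i1

theorem card_commuting_pairs {A X : Subgroup G} [Fintype A] :
    Nat.card {p : A × X // Commute (p.1 : G) (p.2 : G)} =
      ∑ a : A, Nat.card ((Subgroup.centralizer {(a : G)}).subgroupOf X) := by
  rw [← Nat.card_sigma]
  refine Nat.card_congr ⟨fun p => ⟨p.1.1, p.1.2, ?_⟩, fun p => ⟨(p.1, p.2.1), ?_⟩,
    fun p => rfl, fun p => rfl⟩
  · exact Subgroup.mem_subgroupOf.2 (mem_centralizer_iff_commute.2 p.2)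
  · exact mem_centralizer_iff_commute.1 (Subgroup.mem_subgroupOf.1 p.2.2)

theorem card_le_mul_card_centralizer (hcl : ∀ a g : G, ⁅a, g⁆ ∈ Subgroup.center G)
    {X D : Subgroup G} {a : G} (h : ∀ x ∈ X, ⁅a, x⁆ ∈ D) :
    Nat.card X ≤ Nat.card D * Nat.card ((Subgroup.centralizer {a}).subgroupOf X) := by
  let f : X →* G := (commHom a (hcl a)).comp X.subtype
  have hker : f.ker = (Subgroup.centralizer {a}).subgroupOf X := by
    rw [← ker_commHom (hcl a)]; rfl
  have h1 := f.ker.card_mul_index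
  rw [Subgroup.index_ker, mul_comm, hker] at h1
  rw [← h1]
  refine Nat.mul_le_mul_right _ (Subgroup.card_le_of_le ?_)
  rintro _ ⟨x, rfl⟩
  exact h x x.2

theorem commutator_mem_of_mem_closure {G : Type*} [Group G] (hcl : ∀ a g : G, ⁅a, g⁆ ∈ Subgroup.center G)
    {ι : Type*} {f : ι → G} {D : Subgroup G} {a x : G} (h : ∀ i, ⁅a, f i⁆ ∈ D)
    (hx : x ∈ Subgroup.closure (Set.range f ∪ Subgroup.center G)) : ⁅a, x⁆ ∈ D := by
  have : Subgroup.closure (Set.range f ∪ Subgroup.center G) ≤ D.comap (commHom a (hcl a)) := by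
    refine (Subgroup.closure_le _).2 ?_
    rintro _ (⟨i, rfl⟩ | hc)
    · exact h i
    · change ⁅a, _⁆ ∈ D
      rw [commutatorElement_eq_one_iff_commute.2 (commute_of_mem_center hc).symm]
      exact one_mem _
  exact this hx

theorem exists_cubing_of_generators (hcl : ∀ a g : G, ⁅a, g⁆ ∈ Subgroup.center G)
    {D : Subgroup G} (hD : ∀ a g : G, ⁅a, g⁆ ∈ D)
    (hD2 : ∀ d ∈ D, d ^ 2 = 1) (h3 : (Nat.card G).Coprime 3) {k : ℕ} {x a : Fin k → G}
    (hgen : Subgroup.closure (Set.range x ∪ Set.range a) ⊔ Subgroup.center G = ⊤)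
    (hx : ∀ i j, Commute (x i) (x j)) (ha : ∀ i j, Commute (a i) (a j))
    (hcount : ∀ A X : Subgroup G, A = Subgroup.closure (Set.range a ∪ Subgroup.center G) →
      X = Subgroup.closure (Set.range x ∪ Subgroup.center G) → Nat.card A * Nat.card X <
      2 * Nat.card {p : A × X // Commute (p.1 : G) (p.2 : G)}) :
    ∃ α : G ≃* G, Nat.card G < 2 * (cubeSet α).ncard := by
  have hZA : Subgroup.center G ≤ Subgroup.closure (Set.range a ∪ Subgroup.center G) :=
    fun z hz => Subgroup.subset_closure (Or.inr hz)
  have hn : (Subgroup.closure (Set.range a ∪ Subgroup.center G : Set G)).Normal := by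
    refine ⟨fun n hn g => ?_⟩
    have : g * n * g⁻¹ = ⁅g, n⁆ * n := by rw [commutatorElement_def]; group
    rw [this]
    exact mul_mem (hZA (hcl _ _)) hn
  refine exists_cubing_of_factorization hcl hD hD2 h3
    (fun h1 h2 => commute_of_mem_closure_range_union_center ha h1 h2)
    (fun h1 h2 => commute_of_mem_closure_range_union_center hx h1 h2) hZA (fun g => ?_)
    (hcount _ _ rfl rfl)
  refine Subgroup.mem_sup_of_normal_left.1 ?_
  refine (hgen.ge.trans (sup_le ((Subgroup.closure_le _).2 ?_) ?_)) (Subgroup.mem_top g)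
  · rintro _ (⟨i, rfl⟩ | ⟨i, rfl⟩)
    · exact Subgroup.mem_sup_right (Subgroup.subset_closure (Or.inl ⟨i, rfl⟩))
    · exact Subgroup.mem_sup_left (Subgroup.subset_closure (Or.inl ⟨i, rfl⟩))
  · exact hZA.trans le_sup_left

/-- With |G'| = 2 every b ∈ A commutes with at least half of X, and b = 1 with all of it. The
symplectic basis is rebuilt in G, so only the commutator subgroup is required. -/
theorem exists_cubing_of_commutator (hcl : ∀ a g : G, ⁅a, g⁆ ∈ Subgroup.center G)
    (h3 : (Nat.card G).Coprime 3) {z : G} (hz : orderOf z = 2)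
    (hD : commutator G = Subgroup.zpowers z) :
    ∃ α : G ≃* G, Nat.card G < 2 * (cubeSet α).ncard := by
  classical
  have hsq : ∀ g : G, g ^ 2 ∈ Subgroup.center G := fun g => by
    refine Subgroup.mem_center_iff.2 fun h => (Commute.eq ?_).symm
    rw [← commutatorElement_eq_one_iff_commute, pow_two, commutator_mul_left (hcl _ _), ← pow_two]
    have hz2 : z ^ 2 = 1 := hz ▸ pow_orderOf_eq_one z
    rcases commutator_eq_one_or_of_commutator hz2 hD g h with h1 | h1
    · rw [h1, one_pow]
    · rw [h1, hz2]
  obtain ⟨w, hw, hDw, -, k, x, a, hgen, hr⟩ := structureOne_of_commutator hcl hsq hz hD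
  have hw2 : w ^ 2 = 1 := hw ▸ pow_orderOf_eq_one w
  have hDm : ∀ a g : G, ⁅a, g⁆ ∈ Subgroup.zpowers w := fun a g =>
    hDw ▸ commutatorElement_mem_commutator a g
  have hne : ∀ i j, i ≠ j → Commute (x i) (x j) ∧ Commute (a i) (a j) ∧ Commute (a i) (x j) :=
    fun i j hij => by simpa only [commElt_eq_one_iff] using hr.1 i j hij
  refine exists_cubing_of_generators hcl hDm ?_ h3 (generateModCenter_iff.1 hgen) (fun i j => ?_)
    (fun i j => ?_) fun A X _ _ => ?_
  · rintro _ ⟨n, rfl⟩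
    change (w ^ n) ^ 2 = 1
    rw [← zpow_natCast, ← zpow_mul, mul_comm, zpow_mul, zpow_natCast, hw2, one_zpow]
  · by_cases h : i = j
    · exact h ▸ Commute.refl _
    · exact (hne i j h).1
  · by_cases h : i = j
    · exact h ▸ Commute.refl _
    · exact (hne i j h).2.1
  · have : Fintype A := Fintype.ofFinite A
    rw [card_commuting_pairs, Finset.mul_sum, Nat.card_eq_fintype_card (α := A), ← smul_eq_mul,
      ← Finset.card_univ, ← Finset.sum_const]
    have key : ∀ b : A, Nat.card X ≤
        2 * Nat.card ((Subgroup.centralizer {(b : G)}).subgroupOf X) := fun b => by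
      have := card_le_mul_card_centralizer hcl (X := X) (a := (b : G)) fun x _ => hDm _ x
      rwa [Nat.card_zpowers, hw] at this
    refine Finset.sum_lt_sum (fun b _ => key b) ⟨1, Finset.mem_univ _, ?_⟩
    have htop : (Subgroup.centralizer {((1 : A) : G)}).subgroupOf X = ⊤ := by
      rw [Subgroup.eq_top_iff']
      intro x
      exact Subgroup.mem_subgroupOf.2 (mem_centralizer_iff_commute.2 (Commute.one_left _))
    rw [htop, Subgroup.card_top]
    have := Nat.card_pos (α := X)
    omega

theorem sum_indicator_subgroupOf {G : Type*} [Group G] {A H : Subgroup G} [Fintype A] [DecidablePred (· ∈ H)] :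
    ∑ a : A, (if (a : G) ∈ H then 1 else 0) = Nat.card (H.subgroupOf A) := by
  rw [Finset.sum_boole, Nat.cast_id, ← Fintype.card_subtype, ← Nat.card_eq_fintype_card]
  rfl

/-- Elements of A commute with a quarter, a half or all of X according to which of `x 0`, `x 1` they
centralize, and each `x i` centralizes at least half of A. The average share is just above 1/2. -/
theorem exists_cubing_of_two_relations (hcl : ∀ a g : G, ⁅a, g⁆ ∈ Subgroup.center G)
    (h3 : (Nat.card G).Coprime 3) {x a : Fin 2 → G} {z : Fin 2 → G}
    (hz : ∀ i, z i ^ 2 = 1)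
    (hD : commutator G = Subgroup.zpowers (z 0) ⊔ Subgroup.zpowers (z 1))
    (hgen : Subgroup.closure (Set.range x ∪ Set.range a) ⊔ Subgroup.center G = ⊤)
    (hr : CommutatorRelations x a z) :
    ∃ α : G ≃* G, Nat.card G < 2 * (cubeSet α).ncard := by
  classical
  have toComm : ∀ {a g : G}, Commute a g → ⁅a, g⁆ = 1 := commutatorElement_eq_one_iff_commute.2
  have hne : ∀ i j, i ≠ j → Commute (x i) (x j) ∧ Commute (a i) (a j) ∧ Commute (a i) (x j) :=
    fun i j hij => by simpa only [commElt_eq_one_iff] using hr.1 i j hij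
  have hax : ∀ i, ⁅a i, x i⁆ = z i := fun i => by
    rw [← commElt_eq_commutatorElement (hcl _ _)]; exact hr.2 i
  have hxa : ∀ i, ⁅x i, a i⁆ = z i := fun i => by
    rw [← commutatorElement_inv, hax, inv_eq_self_of_sq (hz i)]
  have hzc : ∀ i, z i ∈ Subgroup.center G := fun i => hax i ▸ hcl _ _
  have hxx : ∀ i j, Commute (x i) (x j) := fun i j => by
    by_cases h : i = j
    · exact h ▸ Commute.refl _
    · exact (hne i j h).1
  have haa : ∀ i j, Commute (a i) (a j) := fun i j => by
    by_cases h : i = j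
    · exact h ▸ Commute.refl _
    · exact (hne i j h).2.1
  set D := Subgroup.zpowers (z 0) ⊔ Subgroup.zpowers (z 1) with hDdef
  have hDm : ∀ a g : G, ⁅a, g⁆ ∈ D := fun a g => hD ▸ commutatorElement_mem_commutator a g
  have hnorm : (Subgroup.zpowers (z 0)).Normal := by
    refine ⟨fun n hn g => ?_⟩
    have hnc : n ∈ Subgroup.center G :=
      (Subgroup.zpowers_le.2 (hzc 0) : Subgroup.zpowers (z 0) ≤ _) hn
    rwa [← (commute_of_mem_center hnc (g := g)).eq, mul_inv_cancel_right]
  have hDelt : ∀ d ∈ D, ∃ s ∈ Subgroup.zpowers (z 0), ∃ t ∈ Subgroup.zpowers (z 1), s * t = d :=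
    fun d hd => Subgroup.mem_sup_of_normal_left.1 hd
  have hcard2 : ∀ i, Nat.card (Subgroup.zpowers (z i)) ≤ 2 := fun i => by
    rw [Nat.card_zpowers]
    exact Nat.le_of_dvd two_pos (orderOf_dvd_of_pow_eq_one (hz i))
  have hcard4 : Nat.card D ≤ 4 := by
    have h1 := card_le_two_mul_of_cover (A := Subgroup.zpowers (z 1)) (B := D) (z 0) fun d hd => by
      obtain ⟨s, hs, t, ht, rfl⟩ := hDelt d hd
      rcases (mem_zpowers_of_sq_eq_one (hz 0)).1 hs with rfl | rfl
      · exact Or.inl (by rwa [one_mul])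
      · refine Or.inr ?_
        rwa [← mul_assoc, ← pow_two, hz 0, one_mul]
    have h2 := hcard2 1
    omega
  refine exists_cubing_of_generators hcl hDm ?_ h3 hgen hxx haa fun A X hA hX => ?_
  · intro d hd
    obtain ⟨s, hs, t, ht, rfl⟩ := hDelt d hd
    have hs2 : s ^ 2 = 1 := by
      rcases (mem_zpowers_of_sq_eq_one (hz 0)).1 hs with rfl | rfl
      · exact one_pow 2
      · exact hz 0
    have ht2 : t ^ 2 = 1 := by
      rcases (mem_zpowers_of_sq_eq_one (hz 1)).1 ht with rfl | rfl
      · exact one_pow 2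
      · exact hz 1
    have hsc : s ∈ Subgroup.center G :=
      (Subgroup.zpowers_le.2 (hzc 0) : Subgroup.zpowers (z 0) ≤ _) hs
    rw [Commute.mul_pow (commute_of_mem_center hsc), hs2, ht2, one_mul]
  have : Fintype A := Fintype.ofFinite A
  have hZA : Subgroup.center G ≤ A := fun z hz => hA ▸ Subgroup.subset_closure (Or.inr hz)
  have hAX : A ⊔ X = ⊤ := by
    rw [eq_top_iff, ← hgen]
    refine sup_le ((Subgroup.closure_le _).2 ?_) (hZA.trans le_sup_left)
    rintro _ (⟨i, rfl⟩ | ⟨i, rfl⟩)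
    · exact Subgroup.mem_sup_right (hX ▸ Subgroup.subset_closure (Or.inl ⟨i, rfl⟩))
    · exact Subgroup.mem_sup_left (hA ▸ Subgroup.subset_closure (Or.inl ⟨i, rfl⟩))
  have hhalf : ∀ i, Nat.card A ≤
      2 * Nat.card ((Subgroup.centralizer {x i}).subgroupOf A) := fun i => by
    refine (card_le_mul_card_centralizer hcl (D := Subgroup.zpowers (z i)) fun b hb =>
      commutator_mem_of_mem_closure hcl (f := a) (fun j => ?_) (hA ▸ hb)).trans
      (Nat.mul_le_mul_right _ (hcard2 i))
    by_cases h : i = j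
    · rw [← h, hxa]; exact Subgroup.mem_zpowers _
    · rw [toComm (hne j i (Ne.symm h)).2.2.symm]; exact one_mem _
  have hx2 : ∀ b i j, i ≠ j → Commute b (x j) → ⁅b, x i⁆ ∈ Subgroup.zpowers (z i) → Nat.card X ≤
      2 * Nat.card ((Subgroup.centralizer {b}).subgroupOf X) := by
    intro b i j hij hbj hbi
    refine (card_le_mul_card_centralizer hcl (D := Subgroup.zpowers (z i)) fun y hy =>
      commutator_mem_of_mem_closure hcl (f := x) (fun l => ?_) (hX ▸ hy)).trans
      (Nat.mul_le_mul_right _ (hcard2 i))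
    obtain rfl | rfl : l = i ∨ l = j := by omega
    · exact hbi
    · rw [toComm hbj]; exact one_mem _
  have hbz : ∀ b ∈ A, ∀ i, ⁅b, x i⁆ ∈ Subgroup.zpowers (z i) := by
    intro b hb i
    rw [← commutatorElement_inv]
    refine inv_mem (commutator_mem_of_mem_closure hcl (f := a) (fun j => ?_) (hA ▸ hb))
    by_cases h : i = j
    · rw [← h, hxa]; exact Subgroup.mem_zpowers _
    · rw [toComm (hne j i (Ne.symm h)).2.2.symm]; exact one_mem _
  -- The bracket is a lower bound for four times the share of X commuting with b. Summed over A it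
  -- is at least |A| + |A|/2 + |A|/2 plus the number of central elements, hence more than 2|A|.
  have key : ∀ b : A, Nat.card X * (1 + (if (b : G) ∈ Subgroup.centralizer {x 1} then 1 else 0) +
      (if (b : G) ∈ Subgroup.centralizer {x 0} then 1 else 0) +
      (if (b : G) ∈ Subgroup.center G then 1 else 0)) ≤
      4 * Nat.card ((Subgroup.centralizer {(b : G)}).subgroupOf X) := by
    intro b
    simp only [mem_centralizer_iff_commute]
    by_cases h1 : Commute (x 1) (b : G) <;> by_cases h0 : Commute (x 0) (b : G)
    · have htop : (Subgroup.centralizer {(b : G)}).subgroupOf X = ⊤ := by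
        rw [Subgroup.eq_top_iff']
        intro y
        refine Subgroup.mem_subgroupOf.2 (mem_centralizer_iff_commute.2 ?_)
        rw [← commutatorElement_eq_one_iff_commute, ← Subgroup.mem_bot]
        refine commutator_mem_of_mem_closure hcl (f := x) (fun i => ?_) (hX ▸ y.2)
        rw [Subgroup.mem_bot]
        fin_cases i
        · exact toComm h0.symm
        · exact toComm h1.symm
      rw [htop, Subgroup.card_top, if_pos h1, if_pos h0, mul_comm]
      refine Nat.mul_le_mul_right _ ?_
      split_ifs <;> omega
    · have hc : (b : G) ∉ Subgroup.center G := fun h => h0 (commute_of_mem_center h).symm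
      rw [if_pos h1, if_neg h0, if_neg hc]
      have := hx2 b 0 1 (by decide) h1.symm (hbz _ b.2 0)
      omega
    · have hc : (b : G) ∉ Subgroup.center G := fun h => h1 (commute_of_mem_center h).symm
      rw [if_neg h1, if_pos h0, if_neg hc]
      have := hx2 b 1 0 (by decide) h0.symm (hbz _ b.2 1)
      omega
    · have hc : (b : G) ∉ Subgroup.center G := fun h => h1 (commute_of_mem_center h).symm
      rw [if_neg h1, if_neg h0, if_neg hc]
      have := (card_le_mul_card_centralizer hcl (X := X) fun y _ => hDm (b : G) y).trans
        (Nat.mul_le_mul_right _ hcard4)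
      omega
  have hsum := Finset.sum_le_sum fun b (_ : b ∈ (Finset.univ : Finset A)) => key b
  rw [← Finset.mul_sum, ← Finset.mul_sum, ← card_commuting_pairs] at hsum
  simp only [Finset.sum_add_distrib] at hsum
  rw [sum_indicator_subgroupOf, sum_indicator_subgroupOf, sum_indicator_subgroupOf,
    Finset.sum_const, Finset.card_univ, ← Nat.card_eq_fintype_card, smul_eq_mul, mul_one] at hsum
  have p0 := hhalf 0
  have p1 := hhalf 1
  have p2 := Nat.card_pos (α := (Subgroup.center G).subgroupOf A)
  have p3 := Nat.card_pos (α := X)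
  nlinarith

theorem exists_cubing_of_typeIII (h : TypeIII G) :
    ∃ α : G ≃* G, Nat.card G < 2 * (cubeSet α).ncard := by
  obtain ⟨hn, hc2, h3, hodd, S, hstr⟩ := h
  have hS := sylow_sup_center_eq_top_of_nilpotent hodd S
  have hcl := upperCentralSeries_two_eq_top_iff.1
    (Subgroup.upperCentralSeries_eq_top_iff_nilpotencyClass_le.2 hc2.le)
  rcases hstr with ⟨z, hz, hD, hel, -⟩ | ⟨z, hz, -, -, hD, -, -, x, a, hgen, hr⟩
  · refine exists_cubing_of_commutator hcl h3 (z := z) ?_ ?_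
    · rw [Subgroup.orderOf_coe, hz]
    · rw [commutator_eq_map hS, hD, MonoidHom.map_zpowers]; rfl
  · refine exists_cubing_of_two_relations hcl h3 (x := fun i => x i) (a := fun i => a i)
      (z := fun i => z i) (fun i => ?_) ?_ ?_ ⟨fun i j hij => ?_, fun i => ?_⟩
    · exact congrArg Subtype.val (orderOf_dvd_iff_pow_eq_one.1 (hz i).dvd)
    · rw [commutator_eq_map hS, hD, Subgroup.map_sup, MonoidHom.map_zpowers,
        MonoidHom.map_zpowers]; rfl
    · rw [generateModCenter_iff] at hgen
      have h1 := congrArg (Subgroup.map (S : Subgroup G).subtype) hgen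
      rw [Subgroup.map_sup, MonoidHom.map_closure, Set.image_union, ← Set.range_comp,
        ← Set.range_comp, ← MonoidHom.range_eq_map, Subgroup.range_subtype] at h1
      refine eq_top_iff.2 (hS.ge.trans (sup_le (h1.ge.trans (sup_le le_sup_left ?_)) le_sup_right))
      rintro _ ⟨c, hc, rfl⟩
      exact Subgroup.mem_sup_right ((mem_center_of_sup_center hS).1 hc)
    · obtain ⟨e1, e2, e3⟩ := hr.1 i j hij
      exact ⟨congrArg Subtype.val e1, congrArg Subtype.val e2, congrArg Subtype.val e3⟩
    · exact congrArg Subtype.val (hr.2 i)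

end

/-! ### The classification -/

section
variable {G : Type*} [Group G] [Finite G]

theorem half_lt_cubeRatio_iff {α : G ≃* G} :
    (1 / 2 : ℚ) < cubeRatio α ↔ Nat.card G < 2 * (cubeSet α).ncard := by
  have hpos : (0 : ℚ) < Nat.card G := by exact_mod_cast Nat.card_pos
  rw [cubeRatio, Nat.card_coe_set_eq, div_lt_div_iff₀ two_pos hpos, one_mul, mul_comm]
  exact_mod_cast Iff.rfl

theorem exists_cubing_iff : (∃ α : G ≃* G, Nat.card G < 2 * (cubeSet α).ncard) ↔
    TypeI G ∨ TypeII G ∨ TypeIII G := by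
  constructor
  · rintro ⟨α, hα⟩
    -- Used twice: it excludes 3 from |G| in the abelian case, and gives S ∩ Z(G) = 1 in type II.
    have h3 := fun z => eq_one_of_central_of_cube_eq_one hα (z := z)
    by_cases hab : ∀ g h : G, g * h = h * g
    · refine Or.inl ⟨hab, ?_⟩
      rw [Nat.coprime_comm, Nat.Prime.coprime_iff_not_dvd Nat.prime_three]
      intro hd
      have : Fact (Nat.Prime 3) := ⟨Nat.prime_three⟩
      obtain ⟨g, hg⟩ := exists_prime_orderOf_dvd_card' (G := G) 3 hd
      rw [h3 g (Subgroup.mem_center_iff.2 fun h => hab h g) (hg ▸ pow_orderOf_eq_one g),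
        orderOf_one] at hg
      omega
    · have hz : Subgroup.center G ≠ ⊤ := fun h => hab fun g k =>
        Subgroup.mem_center_iff.1 (h ▸ Subgroup.mem_top k) g
      rcases abelian_index_two_or_class_two_of_cubeSet hα hz with hK | ⟨hcl, hsq, hstr⟩
      · exact Or.inr (Or.inl (typeII_of_abelian_index_two hab hK h3))
      · exact Or.inr (Or.inr (typeIII_of_class_two hα hz hcl hsq hstr))
  · rintro (⟨hab, h3⟩ | h | h)
    · exact exists_cubing_of_abelian hab h3
    · obtain ⟨-, S, -, ⟨K, -, hi, hK⟩, -⟩ := id h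
      exact exists_cubing_of_abelian_index_two hi hK fun z hz h3 => h.eq_one_of_central hz h3
    · exact exists_cubing_of_typeIII h

end
end CubingAutomorphism

theorem theorem3p1 (G : Type*) [Group G] [Finite G] :
    ((∃ α : G ≃* G, (1 / 2 : ℚ) < CubingAutomorphism.cubeRatio α) ↔
      CubingAutomorphism.TypeI G ∨ CubingAutomorphism.TypeII G ∨
        CubingAutomorphism.TypeIII G) ∧
    ((¬ ∀ g h : G, g * h = h * g) → (Nat.card G).Coprime 3 →
      (∃ K : Subgroup G, K.index = 2 ∧ ∀ g ∈ K, ∀ h ∈ K, g * h = h * g) →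
        CubingAutomorphism.TypeII G) := by
  refine ⟨?_, fun hab h3 hK => ?_⟩
  · simp only [CubingAutomorphism.half_lt_cubeRatio_iff]
    exact CubingAutomorphism.exists_cubing_iff
  -- When 3 does not divide |G|, no non-trivial element has cube 1, so the condition on central
  -- elements is automatic.
  · refine CubingAutomorphism.typeII_of_abelian_index_two hab hK fun z _ hz => ?_
    have h := Nat.dvd_gcd (orderOf_dvd_natCard z) (orderOf_dvd_of_pow_eq_one hz)
    rw [h3.gcd_eq_one, Nat.dvd_one] at h
    exact orderOf_eq_one_iff.1 h
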